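/- Let $(M,g)$ be a compact smooth Riemannian manifold without boundary, of dimension $d\ge 2$, with Laplace–Beltrami operator $\Delta_g$ and Riemannian measure $dg$. Let $\kappa>0$, $\lambda\in\{1,-1\}$, let $p\in(2,\infty]$ and $q\in[2,\infty]$ satisfy $\frac2p+\frac dq=\frac d2$, and let $s>\frac d2-\frac1p$. Fix a finite family of smooth charts $e_\nu:U_\nu\subset M\to\mathbb{R}^d$ and a smooth partition of unity $(h_\nu)$ on $M$ with $\operatorname{supp}h_\nu\subset U_\nu$, and let $H^s(M)$ be the space of $f\in L^2(M)$ with $\|f\|_{H^s(M)}=\big(\sum_\nu\|(h_\nu f)\circ e_\nu^{-1}\|_{H^s(\mathbb{R}^d)}^2\big)^{1/2}<\infty$, the functions $(h_\nu f)\circ e_\nu^{-1}$ being extended by zero to $\mathbb{R}^d$. For $T>0$ put $X_T=C([0,T];H^s(M))\cap L^p([0,T];L^\infty(M))$, whose elements are represented by functions $w(t,x)$ that are jointly measurable on $[0,T]\times M$. Let $u_0\in H^s(M)$ be complex valued and $v_0\in H^s(M)\cap L^\infty(M)$ real valued. Let $T>0$ and let $u\in X_T$ be a solution on $[0,T]$,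 in the sense of distributions, of $$i\partial_tu+\Delta_gu=e^{-t/\kappa}\,u\,v_0+\frac{\lambda}{\kappa}\,u\int_0^te^{-(t-\ell)/\kappa}|u(\ell,x)|^2\,d\ell,\qquad u(0)=u_0 .$$ Define $$v(t,x)=e^{-t/\kappa}v_0(x)+\frac{\lambda}{\kappa}\int_0^te^{-(t-\ell)/\kappa}|u(\ell,x)|^2\,d\ell .$$ Then $$v\in C([0,T];H^s(M))\cap L^p([0,T];L^\infty(M)).$$ -/

import Mathlib

open Set Filter Topology MeasureTheory
open scoped ENNReal Manifold ContDiff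

noncomputable section

namespace SchrodingerDebye

/-- The model space `ℝ^d` with its Euclidean norm. -/
abbrev Eucl (d : ℕ) : Type := EuclideanSpace ℝ (Fin d)

/-- A smooth Riemannian metric on the manifold `M`. -/
abbrev Metric (d : ℕ) (M : Type*) [TopologicalSpace M] [ChartedSpace (Eucl d) M]
    [IsManifold (𝓡 d) ∞ M] : Type _ :=
  Bundle.ContMDiffRiemannianMetric (𝓡 d) ∞ (Eucl d) (fun x : M => TangentSpace (𝓡 d) x)

/-- A finite family of smooth charts of `M` together with a smooth partition of unity `h` on `M`
such that the (closed) support of `h i` lies in the domain of the `i`-th chart. In particular the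
domains of the charts cover `M`. -/
structure ChartPartition (d : ℕ) (M : Type*) [TopologicalSpace M] [ChartedSpace (Eucl d) M]
    [IsManifold (𝓡 d) ∞ M] where
  /-- The number of charts. -/
  n : ℕ
  /-- The charts, as maps from open subsets of `M` onto open subsets of `ℝ^d`. -/
  chart : Fin n → OpenPartialHomeomorph M (Eucl d)
  chart_mem : ∀ i, chart i ∈ IsManifold.maximalAtlas (𝓡 d) ∞ M
  /-- The partition of unity. -/
  h : SmoothPartitionOfUnity (Fin n) (𝓡 d) M univ
  subordinate : h.IsSubordinate fun i => (chart i).source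

section Geometry

variable {d : ℕ} {M : Type*} [TopologicalSpace M] [ChartedSpace (Eucl d) M]
  [IsManifold (𝓡 d) ∞ M]

/-- The `i`-th coordinate vector field `∂/∂x_i` of the chart `e`, at the point with
coordinates `y`. -/
def coordVector (e : OpenPartialHomeomorph M (Eucl d)) (y : Eucl d) (i : Fin d) :
    TangentSpace (𝓡 d) (e.symm y) :=
  mfderiv (𝓡 d) (𝓡 d) e.symm y (EuclideanSpace.single i (1 : ℝ) : Eucl d)

/-- The matrix `g_ij` of the metric in the chart `e`, at the point with coordinates `y`. -/
def metricMatrix (g : Metric d M) (e : OpenPartialHomeomorph M (Eucl d)) (y : Eucl d) :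
    Matrix (Fin d) (Fin d) ℝ :=
  Matrix.of fun i j => g.inner (e.symm y) (coordVector e y i) (coordVector e y j)

/-- The Riemannian volume density `√(det g_ij)` in the chart `e`. -/
def volDensity (g : Metric d M) (e : OpenPartialHomeomorph M (Eucl d)) (y : Eucl d) : ℝ :=
  Real.sqrt (metricMatrix g e y).det

/-- Partial derivative of a real function on `ℝ^d`. -/
def pderiv (i : Fin d) (f : Eucl d → ℝ) (y : Eucl d) : ℝ :=
  fderiv ℝ f y (EuclideanSpace.single i 1)

/-- The Laplace-Beltrami operator, in the preferred chart at `x`: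
`Δφ = (1 / √G) ∑_i ∂_i (√G ∑_j g^{ij} ∂_j φ)` with `G = det g_ij`. -/
def laplaceBeltrami (g : Metric d M) (φ : M → ℝ) (x : M) : ℝ :=
  let e := chartAt (Eucl d) x
  (volDensity g e (e x))⁻¹ *
    ∑ i, pderiv i (fun y => volDensity g e y *
      ∑ j, (metricMatrix g e y)⁻¹ i j * pderiv j (fun z => φ (e.symm z)) y) (e x)

/-- The Riemannian volume measure `dg`:
`∫ f dg = ∑_i ∫ (h_i f)(e_i⁻¹ y) √(det g)(y) dy`, the sum over the charts `e_i` and the functions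
`h_i` of a chart partition. By the change of variables formula the measure does not depend on
the chart partition. -/
def riemVolume [MeasurableSpace M] (g : Metric d M) (A : ChartPartition d M) : Measure M :=
  ∑ i, Measure.map (A.chart i).symm
    ((volume.restrict (A.chart i).target).withDensity fun y =>
      ENNReal.ofReal (A.h i ((A.chart i).symm y) * volDensity g (A.chart i) y))

/-- The function `(h_i f) ∘ e_i⁻¹`, extended by zero to all of `ℝ^d`. -/
def localPiece (A : ChartPartition d M) (f : M → ℂ) (i : Fin A.n) : Eucl d → ℂ :=
  (A.chart i).target.indicator fun y =>
    (A.h i ((A.chart i).symm y) : ℂ) * f ((A.chart i).symm y)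

/-- The `H^s(ℝ^d)` norm `(∫ (1 + |ξ|²)^s |F̂(ξ)|² dξ)^{1/2}` of a function `F ∈ L¹ ∩ L²`; the value
is `∞` if `F` is not in `H^s`. -/
def euclHsNorm (s : ℝ) (F : Eucl d → ℂ) : ℝ≥0∞ :=
  (∫⁻ ξ, ENNReal.ofReal ((1 + ‖ξ‖ ^ 2) ^ s) * ‖FourierTransform.fourier F ξ‖ₑ ^ 2) ^ (1 / 2 : ℝ)

/-- The `H^s(M)` norm `(∑_i ‖(h_i f) ∘ e_i⁻¹‖²_{H^s(ℝ^d)})^{1/2}` of a function `f ∈ L²(M)`. The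
pieces `(h_i f) ∘ e_i⁻¹` are square integrable with compact support, so that their Fourier
transforms are given by the Fourier integral. -/
def hsNorm (A : ChartPartition d M) (s : ℝ) (f : M → ℂ) : ℝ≥0∞ :=
  (∑ i, euclHsNorm s (localPiece A f i) ^ 2) ^ (1 / 2 : ℝ)

variable [MeasurableSpace M]

/-- `f ∈ H^s(M)`, for `s ≥ 0`. -/
def MemHs (g : Metric d M) (A : ChartPartition d M) (s : ℝ) (f : M → ℂ) : Prop :=
  MemLp f 2 (riemVolume g A) ∧ hsNorm A s f < ⊤

/-- `w ∈ C([0,T]; H^s(M))`. -/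
def MemContHs (g : Metric d M) (A : ChartPartition d M) (s T : ℝ) (w : ℝ → M → ℂ) : Prop :=
  (∀ t ∈ Icc 0 T, MemHs g A s (w t)) ∧
  ∀ t₀ ∈ Icc 0 T, Tendsto (fun t => hsNorm A s fun x => w t x - w t₀ x)
    (𝓝[Icc 0 T] t₀) (𝓝 0)

/-- `w ∈ L^p([0,T]; L^∞(M))` (Bochner space): the map `t ↦ w t` is, for almost every `t`, given by
a strongly measurable `L^∞(M)`-valued map whose norm is in `L^p([0,T])`. -/
def MemLpLinfty (g : Metric d M) (A : ChartPartition d M) (p : ℝ≥0∞) (T : ℝ)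
    (w : ℝ → M → ℂ) : Prop :=
  ∃ W : ℝ → Lp ℂ ⊤ (riemVolume g A),
    MemLp W p (volume.restrict (Icc 0 T)) ∧
    ∀ᵐ t ∂(volume.restrict (Icc 0 T)), w t =ᵐ[riemVolume g A] W t

/-- `w ∈ X_T = C([0,T]; H^s(M)) ∩ L^p([0,T]; L^∞(M))`, for a function `w(t,x)` that is
(almost everywhere) jointly measurable on `[0,T] × M`. -/
def MemXT (g : Metric d M) (A : ChartPartition d M) (s : ℝ) (p : ℝ≥0∞) (T : ℝ)
    (w : ℝ → M → ℂ) : Prop :=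
  AEStronglyMeasurable (fun z : ℝ × M => w z.1 z.2)
    ((volume.restrict (Icc 0 T)).prod (riemVolume g A)) ∧
  MemContHs g A s T w ∧ MemLpLinfty g A p T w

end Geometry

/-- The function
`v(t,x) = e^{-t/κ} v₀(x) + (λ/κ) ∫_0^t e^{-(t-ℓ)/κ} |u(ℓ,x)|² dℓ`. -/
def debye {M : Type*} (κ lam : ℝ) (v₀ : M → ℝ) (u : ℝ → M → ℂ) (t : ℝ) (x : M) : ℝ :=
  Real.exp (-t / κ) * v₀ x +
    lam / κ * (∫ l in (0 : ℝ)..t, Real.exp (-(t - l) / κ) * ‖u l x‖ ^ 2)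

/-- `u` solves on `[0,T]`, in the sense of distributions on `M`, the integro-differential equation
`i ∂_t u + Δ_g u = u (e^{-t/κ} v₀ + (λ/κ) ∫_0^t e^{-(t-ℓ)/κ} |u(ℓ)|² dℓ)` with `u(0) = u₀`.
The equation is integrated in time and tested against the smooth functions on `M`. -/
def IsSolution {d : ℕ} {M : Type*} [TopologicalSpace M] [ChartedSpace (Eucl d) M]
    [IsManifold (𝓡 d) ∞ M] [MeasurableSpace M] (g : Metric d M) (A : ChartPartition d M)
    (κ lam T : ℝ) (u₀ : M → ℂ) (v₀ : M → ℝ) (u : ℝ → M → ℂ) : Prop :=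
  u 0 =ᵐ[riemVolume g A] u₀ ∧
  ∀ φ : M → ℝ, ContMDiff (𝓡 d) 𝓘(ℝ) ∞ φ → ∀ t ∈ Icc 0 T,
    Complex.I * ((∫ x, u t x * (φ x : ℂ) ∂riemVolume g A) -
        ∫ x, u₀ x * (φ x : ℂ) ∂riemVolume g A) +
      (∫ τ in (0 : ℝ)..t, (∫ x, u τ x * (laplaceBeltrami g φ x : ℂ) ∂riemVolume g A)) =
    ∫ τ in (0 : ℝ)..t, (∫ x, u τ x * (debye κ lam v₀ u τ x : ℂ) * (φ x : ℂ) ∂riemVolume g A)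

/-- The pair `(p, q)` is `d`-admissible. -/
def Admissible (d : ℕ) (p q : ℝ≥0∞) : Prop :=
  2 / p + d / q = d / 2 ∧ 2 ≤ p ∧ 2 ≤ q ∧ ¬(p = 2 ∧ q = ⊤ ∧ d = 2)

end SchrodingerDebye

end

namespace SchrodingerDebye
-- Plancherel for the Fourier integral and uniform low-pass approximation
section FourierAnalysis
open FourierTransform SchwartzMap

variable {d : ℕ}

/-! Pulling e^{-t/κ} out of the memory integral writes v(t) = a(t) v₀ + b(t) ∫₀ᵗ G(l) dl with a, b
continuous and G(l) = e^{l/κ}|u(l)|², so everything rests on bounds for G. In L^∞, ‖G(l)‖ ≤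
e^{T/κ}‖u(l)‖²_{L^∞} is integrable in time because p ≥ 2, and the integral is then continuous in t
with values in L^∞. In H^s with s > 0, the tame estimate ‖|u|²‖_{H^s} ≤ C‖u‖_{L^∞}‖u‖_{H^s}
(`ChartPartition.exists_hsNorm_sq_normSq_le`) and the boundedness of ‖u(l)‖_{H^s} on [0,T] make
‖G‖_{H^s} square integrable in time; by Cauchy–Schwarz the integral over [t₀,t] is O(|t-t₀|^{1/2})
in H^s.

The exponent s is real, so the tame estimate on ℝ^d (`hsSq_mul_conj_le`) cannot come from the
Leibniz rule. It comes from a layer-cake formula: ‖F‖²_{H^s} is comparable to ‖F‖²_{L²} plus the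
integral over R > 1 of R^{2s-1} times the L² mass of F̂ above R. Replace two factors by low-pass
approximations at R/2, bounded in sup norm uniformly in R. The product of the approximations has no
frequency above R, and the error is bounded in L² by sup norms times high-frequency masses of the
factors.

On M one writes h_i|f|² = (h_i f)·conj(η_i f), where η_i = 1 on supp h_i. The second factor is a sum
of pieces h_j f seen in another chart, so H^s(ℝ^d) must be stable under cutoffs and changes of
coordinates (`IsCutoffChange.hsSq_le`). The layer-cake formula proves this as well, by interpolation
between L² and an integer order m > s, where the chain rule is available.

These estimates use pointwise bounds and joint measurability. Hence u and v₀ are first replaced by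
bounded measurable representatives, and `MemXT.congr_ae` carries the conclusion back. -/

theorem continuous_fourier_of_integrable {F : Eucl d → ℂ} (hF : Integrable F) :
    Continuous (𝓕 F) :=
  VectorFourier.fourierIntegral_continuous Real.continuous_fourierChar
    (innerSL ℝ).continuous₂ hF

theorem integral_fourier_mul_of_integrable {F G : Eucl d → ℂ} (hF : Integrable F)
    (hG : Integrable G) : ∫ ξ, 𝓕 F ξ * G ξ = ∫ x, F x * 𝓕 G x := by
  have := VectorFourier.integral_fourierIntegral_smul_eq_flip (L := innerₗ (Eucl d))
    Real.continuous_fourierChar continuous_inner hF hG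
  simpa [flip_innerₗ] using! this

/-- For a function in `L¹ ∩ L²` the Fourier integral represents the Fourier transform on `L²`. -/
theorem toLp_fourier_ae_eq {F : Eucl d → ℂ} (h1 : Integrable F) (h2 : MemLp F 2 volume) :
    (𝓕 (h2.toLp F) : Lp ℂ 2 (volume : Measure (Eucl d))) =ᵐ[volume] 𝓕 F := by
  apply ae_eq_of_integral_contDiff_smul_eq
  · exact (Lp.memLp _).locallyIntegrable (by norm_num)
  · exact (continuous_fourier_of_integrable h1).locallyIntegrable
  intro g hg hgc
  have hgC : ContDiff ℝ ∞ (fun x => (g x : ℂ)) := Complex.ofRealCLM.contDiff.comp hg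
  have hgcC : HasCompactSupport (fun x => (g x : ℂ)) := hgc.comp_left (g := fun r : ℝ => (r : ℂ)) rfl
  let φ : 𝓢(Eucl d, ℂ) := hgcC.toSchwartzMap hgC
  have hφ : ∀ x, φ x = (g x : ℂ) := fun x => rfl
  -- Both transforms are tested against φ: the L² transform agrees with the tempered one, and
  -- duality moves the transform from φ back to F.
  have key := Lp.fourier_toTemperedDistribution_eq (h2.toLp F)
  have key2 := congrArg (fun D => D φ) key
  simp only [TemperedDistribution.fourier_apply, Lp.toTemperedDistribution_apply] at key2
  have e1 : ∫ x, (𝓕 φ) x • (h2.toLp F) x = ∫ x, (𝓕 (φ : Eucl d → ℂ)) x * F x := by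
    apply integral_congr_ae
    filter_upwards [h2.coeFn_toLp] with x hx
    rw [hx]; rfl
  rw [e1, integral_fourier_mul_of_integrable φ.integrable h1] at key2
  calc _ = ∫ x, φ x • (𝓕 (h2.toLp F) : Lp ℂ 2 (volume : Measure (Eucl d))) x := by
        simp [hφ]
    _ = _ := by rw [← key2]; simp [hφ]

theorem eLpNorm_fourier_eq {F : Eucl d → ℂ} (h1 : Integrable F) (h2 : MemLp F 2 volume) :
    eLpNorm (𝓕 F) 2 volume = eLpNorm F 2 volume := by
  rw [← eLpNorm_congr_ae (toLp_fourier_ae_eq h1 h2), ← eLpNorm_congr_ae h2.coeFn_toLp,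
    ← Lp.enorm_def, ← Lp.enorm_def, ← ofReal_norm, ← ofReal_norm, Lp.norm_fourier_eq]

theorem eLpNorm_two_sq {α : Type*} [MeasurableSpace α] {μ : Measure α} (F : α → ℂ) :
    eLpNorm F 2 μ ^ 2 = ∫⁻ x, ‖F x‖ₑ ^ 2 ∂μ := by
  rw [eLpNorm_eq_lintegral_rpow_enorm_toReal (by norm_num) (by norm_num)]
  simp only [ENNReal.toReal_ofNat, ENNReal.rpow_ofNat]
  rw [← ENNReal.rpow_natCast, ← ENNReal.rpow_mul]
  norm_num

/-- Plancherel's identity for the Fourier integral of a function in `L¹ ∩ L²`. -/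
theorem lintegral_enorm_fourier_sq {F : Eucl d → ℂ} (h1 : Integrable F)
    (h2 : MemLp F 2 volume) : ∫⁻ ξ, ‖𝓕 F ξ‖ₑ ^ 2 = ∫⁻ x, ‖F x‖ₑ ^ 2 := by
  rw [← eLpNorm_two_sq, ← eLpNorm_two_sq, eLpNorm_fourier_eq h1 h2]

/-- A bounded measurable function with compact support. -/
structure BddCpt (F : Eucl d → ℂ) : Prop where
  meas : AEStronglyMeasurable F volume
  bdd : ∃ N : ℝ, ∀ x, ‖F x‖ ≤ N
  supp : HasCompactSupport F

namespace BddCpt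

variable {F G : Eucl d → ℂ}

theorem memLp (hF : BddCpt F) (p : ℝ≥0∞) : MemLp F p volume := by
  obtain ⟨N, hN⟩ := hF.bdd
  have hK : IsCompact (tsupport F) := hF.supp
  have hfin : IsFiniteMeasure (volume.restrict (tsupport F)) :=
    ⟨by simpa using hK.measure_lt_top⟩
  have h1 : MemLp F p (volume.restrict (tsupport F)) :=
    MemLp.of_bound hF.meas.restrict N (Eventually.of_forall hN)
  have h2 : (tsupport F).indicator F = F := by
    rw [indicator_eq_self]; exact subset_tsupport F
  rw [← h2, memLp_indicator_iff_restrict (isClosed_tsupport F).measurableSet]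
  exact h1

theorem integrable (hF : BddCpt F) : Integrable F := memLp_one_iff_integrable.1 (hF.memLp 1)

/-- Compact support makes all moments of F integrable. Smoothness of F̂ is what makes its
truncations Schwartz functions. -/
theorem contDiff_fourier (hF : BddCpt F) : ContDiff ℝ ∞ (𝓕 F) := by
  apply Real.contDiff_fourier (N := ⊤)
  intro n _
  obtain ⟨r, hr⟩ := hF.supp.isCompact.isBounded.subset_closedBall 0
  refine (hF.integrable.norm.const_mul (r ^ n)).mono' ?_ ?_
  · exact ((continuous_norm.pow n).aestronglyMeasurable).mul hF.meas.norm
  · refine Eventually.of_forall fun x => ?_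
    rw [Real.norm_of_nonneg (by positivity)]
    by_cases hx : F x = 0
    · simp [hx]
    · have : x ∈ Metric.closedBall (0 : Eucl d) r := hr (subset_tsupport F hx)
      rw [mem_closedBall_zero_iff] at this
      gcongr

theorem mul (hF : BddCpt F) (hG : BddCpt G) : BddCpt fun x => F x * G x := by
  obtain ⟨N, hN⟩ := hF.bdd
  obtain ⟨N', hN'⟩ := hG.bdd
  refine ⟨hF.meas.mul hG.meas, ⟨N * N', fun x => ?_⟩, hF.supp.mul_right⟩
  rw [norm_mul]
  exact mul_le_mul (hN x) (hN' x) (norm_nonneg _) ((norm_nonneg _).trans (hN x))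

theorem conj (hF : BddCpt F) : BddCpt fun x => starRingEnd ℂ (F x) := by
  obtain ⟨N, hN⟩ := hF.bdd
  refine ⟨Complex.continuous_conj.comp_aestronglyMeasurable hF.meas, ⟨N, fun x => ?_⟩,
    hF.supp.comp_left (g := starRingEnd ℂ) (map_zero _)⟩
  simpa using hN x

end BddCpt

theorem fourier_comp_inv_smul (φ : Eucl d → ℂ) {R : ℝ} (hR : 0 < R) (y : Eucl d) :
    𝓕 (fun ξ => φ (R⁻¹ • ξ)) y = R ^ d • 𝓕 φ (R • y) := by
  rw [Real.fourier_eq, Real.fourier_eq]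
  have := Measure.integral_comp_smul (volume : Measure (Eucl d))
    (fun v => Real.fourierChar (-inner ℝ v (R • y)) • φ v) R⁻¹
  rw [finrank_euclideanSpace_fin, abs_of_nonneg (by positivity), ← inv_pow, inv_inv] at this
  rw [← this]
  congr 1 with v
  rw [real_inner_smul_left, real_inner_smul_right, inv_mul_cancel_left₀ hR.ne']

/-- The L¹ norm of the convolution kernel of a low-pass filter is scale invariant; this keeps the
sup bound in `IsLowPass` independent of R. -/
theorem integral_norm_fourier_comp_inv_smul (φ : Eucl d → ℂ) {R : ℝ} (hR : 0 < R) :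
    ∫ y, ‖𝓕 (fun ξ => φ (R⁻¹ • ξ)) y‖ = ∫ y, ‖𝓕 φ y‖ := by
  have := Measure.integral_comp_smul (volume : Measure (Eucl d)) (fun v => ‖𝓕 φ v‖) R
  rw [finrank_euclideanSpace_fin, abs_of_nonneg (by positivity)] at this
  simp_rw [fourier_comp_inv_smul φ hR, norm_smul, integral_const_mul, this]
  rw [Real.norm_of_nonneg (by positivity), smul_eq_mul, ← mul_assoc,
    mul_inv_cancel₀ (by positivity), one_mul]

theorem fourier_char_mul (φ : Eucl d → ℂ) (x y : Eucl d) :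
    𝓕 (fun ξ => Real.fourierChar (inner ℝ ξ x) • φ ξ) y = 𝓕 φ (y - x) := by
  rw [Real.fourier_eq, Real.fourier_eq]
  congr 1 with v
  rw [smul_smul, ← AddChar.map_add_eq_mul]
  congr 2
  rw [inner_sub_right]; ring

/-- The approximation `B` of a function `F` by the frequencies of `F` below `R`. -/
structure IsLowPass (C R : ℝ) (F : Eucl d → ℂ) (B : 𝓢(Eucl d, ℂ)) : Prop where
  fourier_eq_zero : ∀ ξ, R ≤ ‖ξ‖ → 𝓕 (B : Eucl d → ℂ) ξ = 0
  fourier_eq : ∀ ξ, ‖ξ‖ ≤ R / 2 → 𝓕 (B : Eucl d → ℂ) ξ = 𝓕 F ξ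
  norm_fourier_le : ∀ ξ, ‖𝓕 (B : Eucl d → ℂ) ξ‖ ≤ ‖𝓕 F ξ‖
  norm_sub_le : ∀ ξ, ‖𝓕 F ξ - 𝓕 (B : Eucl d → ℂ) ξ‖ ≤ ‖𝓕 F ξ‖
  norm_le : ∀ N, (∀ x, ‖F x‖ ≤ N) → ∀ x, ‖B x‖ ≤ C * N

variable (d) in
-- B has Fourier transform φ(·/R) F̂, with φ a bump equal to 1 on the ball of radius 1/2 and 0 off
-- the unit ball. As B is F convolved with a kernel of L¹ norm ‖φ̂‖_{L¹}, that norm serves as C.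
theorem exists_isLowPass : ∃ C : ℝ, 0 ≤ C ∧ ∀ F : Eucl d → ℂ, BddCpt F → ∀ R : ℝ, 0 < R →
    ∃ B : 𝓢(Eucl d, ℂ), IsLowPass C R F B := by
  let b : ContDiffBump (0 : Eucl d) := ⟨1 / 2, 1, by norm_num, by norm_num⟩
  let φ : Eucl d → ℂ := fun x => ((b x : ℝ) : ℂ)
  have hφs : ContDiff ℝ ∞ φ := Complex.ofRealCLM.contDiff.comp b.contDiff
  have hφc : HasCompactSupport φ := b.hasCompactSupport.comp_left (g := fun r : ℝ => (r : ℂ)) rfl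
  let Φ : 𝓢(Eucl d, ℂ) := hφc.toSchwartzMap hφs
  refine ⟨∫ y, ‖𝓕 φ y‖, by positivity, fun F hF R hR => ?_⟩
  let φR : Eucl d → ℂ := fun ξ => φ (R⁻¹ • ξ)
  have hφRs : ContDiff ℝ ∞ φR := hφs.comp (contDiff_const_smul _)
  have hφRc : HasCompactSupport φR := hφc.comp_smul (inv_ne_zero hR.ne')
  let m : Eucl d → ℂ := fun ξ => φR ξ * 𝓕 F ξ
  have hms : ContDiff ℝ ∞ m := hφRs.mul hF.contDiff_fourier
  have hmc : HasCompactSupport m := hφRc.mul_right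
  let Mm : 𝓢(Eucl d, ℂ) := hmc.toSchwartzMap hms
  have hB : 𝓕 ((𝓕⁻ Mm : 𝓢(Eucl d, ℂ)) : Eucl d → ℂ) = m := by
    rw [← fourier_coe, fourier_fourierInv_eq]; rfl
  have hφ1 : ∀ x, 0 ≤ b x ∧ b x ≤ 1 := fun x => ⟨b.nonneg, b.le_one⟩
  have hφRn : ∀ ξ, φR ξ = ((b (R⁻¹ • ξ) : ℝ) : ℂ) := fun ξ => rfl
  refine ⟨𝓕⁻ Mm, ?_, ?_, ?_, ?_, ?_⟩
  · intro ξ hξ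
    rw [hB]
    have : b (R⁻¹ • ξ) = 0 := by
      apply b.zero_of_le_dist
      rw [dist_zero_right, norm_smul, norm_inv, Real.norm_of_nonneg hR.le]
      change (1 : ℝ) ≤ _
      rw [inv_mul_eq_div, one_le_div hR]; exact hξ
    simp only [m, hφRn, this]; simp
  · intro ξ hξ
    rw [hB]
    have : b (R⁻¹ • ξ) = 1 := by
      apply b.one_of_mem_closedBall
      rw [mem_closedBall_zero_iff, norm_smul, norm_inv, Real.norm_of_nonneg hR.le]
      change _ ≤ (1 / 2 : ℝ)
      rw [inv_mul_eq_div, div_le_iff₀ hR]; linarith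
    simp only [m, hφRn, this]; simp
  · intro ξ
    rw [hB]
    simp only [m, hφRn, norm_mul, Complex.norm_real, Real.norm_of_nonneg (hφ1 _).1]
    exact mul_le_of_le_one_left (norm_nonneg _) (hφ1 _).2
  · intro ξ
    rw [hB]
    have : 𝓕 F ξ - m ξ = ((1 - b (R⁻¹ • ξ) : ℝ) : ℂ) * 𝓕 F ξ := by
      simp only [m, hφRn]; push_cast; ring
    rw [this, norm_mul, Complex.norm_real, Real.norm_of_nonneg (by linarith [(hφ1 (R⁻¹ • ξ)).2])]
    exact mul_le_of_le_one_left (norm_nonneg _) (by linarith [(hφ1 (R⁻¹ • ξ)).1])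
  · intro N hN x
    have hN0 : 0 ≤ N := (norm_nonneg _).trans (hN 0)
    -- Modulating the multiplier by x turns inversion at x into a pairing of φR·F̂ with a character.
    -- Duality moves the transform off F, and ĝ is a translate of the kernel.
    let g : Eucl d → ℂ := fun ξ => Real.fourierChar (inner ℝ ξ x) • φR ξ
    have hφRi : Integrable φR := hφRs.continuous.integrable_of_hasCompactSupport hφRc
    have hgi : Integrable g := by
      refine hφRi.norm.mono' ?_ (Eventually.of_forall fun ξ => ?_)
      · refine Continuous.aestronglyMeasurable ?_
        have : Continuous fun ξ : Eucl d => Real.fourierChar (inner ℝ ξ x) :=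
          Real.continuous_fourierChar.comp (continuous_id.inner continuous_const)
        exact this.smul hφRs.continuous
      · simp [g]
    have e1 : (𝓕⁻ Mm : 𝓢(Eucl d, ℂ)) x = ∫ y, 𝓕 g y * F y := by
      rw [integral_fourier_mul_of_integrable hgi hF.integrable, fourierInv_coe, Real.fourierInv_eq]
      congr 1 with v
      simp only [g, smul_mul_assoc]; rfl
    have hΦ : Integrable (𝓕 φR) := (𝓕 (hφRc.toSchwartzMap hφRs)).integrable
    rw [e1, ← integral_norm_fourier_comp_inv_smul φ hR]
    calc ‖∫ y, 𝓕 g y * F y‖ ≤ ∫ y, ‖𝓕 φR (y - x)‖ * N := by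
          apply norm_integral_le_of_norm_le ((hΦ.comp_sub_right x).norm.mul_const N)
          refine Eventually.of_forall fun y => ?_
          rw [norm_mul]
          simp only [g, fourier_char_mul]
          gcongr
          exact hN y
      _ = (∫ y, ‖𝓕 φR y‖) * N := by
          rw [integral_mul_const, integral_sub_right_eq_self (fun y => ‖𝓕 φR y‖) x]

end FourierAnalysis
-- The H^s norm as an integral over frequency thresholds
section LayerCake
open FourierTransform SchwartzMap

variable {d : ℕ}

/-- The square of the `H^s(ℝ^d)` norm. -/
noncomputable def hsSq (s : ℝ) (F : Eucl d → ℂ) : ℝ≥0∞ :=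
  ∫⁻ ξ, ENNReal.ofReal ((1 + ‖ξ‖ ^ 2) ^ s) * ‖𝓕 F ξ‖ₑ ^ 2

theorem euclHsNorm_sq (s : ℝ) (F : Eucl d → ℂ) : euclHsNorm s F ^ 2 = hsSq s F := by
  unfold euclHsNorm hsSq
  rw [← ENNReal.rpow_natCast, ← ENNReal.rpow_mul]
  norm_num

/-- The `L²` mass of the Fourier transform at frequencies above `R`. -/
noncomputable def highFreq (R : ℝ) (F : Eucl d → ℂ) : ℝ≥0∞ :=
  ∫⁻ ξ in {ξ | R < ‖ξ‖}, ‖𝓕 F ξ‖ₑ ^ 2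

theorem measurable_highFreq_comp_mul {c : ℝ} (hc : 0 ≤ c) (F : Eucl d → ℂ) :
    Measurable fun R => highFreq (c * R) F := by
  refine Antitone.measurable fun R R' h => ?_
  refine lintegral_mono_set fun ξ (hξ : c * R' < ‖ξ‖) => ?_
  exact (mul_le_mul_of_nonneg_left h hc).trans_lt hξ

theorem setLIntegral_mul_setLIntegral_swap {w : ℝ → ℝ≥0∞} (hw : Measurable w)
    {G : Eucl d → ℝ≥0∞} (hG : Measurable G) {P : ℝ → Eucl d → Prop}
    (hP : MeasurableSet {p : ℝ × Eucl d | P p.1 p.2}) (A : Set ℝ) :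
    ∫⁻ R in A, w R * ∫⁻ ξ in {ξ | P R ξ}, G ξ =
      ∫⁻ ξ, G ξ * ∫⁻ R in A, {R | P R ξ}.indicator w R := by
  have h1 : ∀ R, w R * ∫⁻ ξ in {ξ | P R ξ}, G ξ =
      ∫⁻ ξ, {p : ℝ × Eucl d | P p.1 p.2}.indicator (fun p => w p.1 * G p.2) (R, ξ) := by
    intro R
    have hm : MeasurableSet {ξ | P R ξ} := measurable_prodMk_left hP
    rw [← lintegral_indicator hm, ← lintegral_const_mul _ (hG.indicator hm)]
    congr 1 with ξ
    by_cases h : P R ξ <;> simp [indicator, h]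
  simp_rw [h1]
  rw [lintegral_lintegral_swap]
  · congr 1 with ξ
    have hm : MeasurableSet {R | P R ξ} := measurable_prodMk_right hP
    rw [← lintegral_const_mul _ (hw.indicator hm)]
    congr 1 with R
    by_cases h : P R ξ <;> simp [indicator, h, mul_comm]
  · exact (((hw.comp measurable_fst).mul (hG.comp measurable_snd)).indicator hP).aemeasurable

theorem measurable_rpowWeight (a : ℝ) : Measurable fun R : ℝ => ENNReal.ofReal (R ^ a) :=
  (measurable_id.pow_const a).ennreal_ofReal

theorem lintegral_Ioo_rpow {s X Y : ℝ} (hs : 0 < s) (hX : 0 ≤ X) (hXY : X ≤ Y) :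
    ∫⁻ R in Ioo X Y, ENNReal.ofReal (R ^ (2 * s - 1)) =
      ENNReal.ofReal ((Y ^ (2 * s) - X ^ (2 * s)) / (2 * s)) := by
  have hi : IntervalIntegrable (fun x : ℝ => x ^ (2 * s - 1)) volume X Y :=
    intervalIntegral.intervalIntegrable_rpow' (by linarith)
  rw [intervalIntegrable_iff_integrableOn_Ioo_of_le hXY] at hi
  rw [← ofReal_integral_eq_lintegral_ofReal hi]
  · rw [← integral_Ioc_eq_integral_Ioo, ← intervalIntegral.integral_of_le hXY,
      integral_rpow (Or.inl (by linarith))]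
    simp
  · refine (ae_restrict_mem measurableSet_Ioo).mono fun x hx => ?_
    exact Real.rpow_nonneg (hX.trans hx.1.le) _

theorem lintegral_Ioi_rpow {a Y : ℝ} (ha : 0 < a) (hY : 0 < Y) :
    ∫⁻ R in Ioi Y, ENNReal.ofReal (R ^ (-a - 1)) = ENNReal.ofReal (Y ^ (-a) / a) := by
  rw [← ofReal_integral_eq_lintegral_ofReal (integrableOn_Ioi_rpow_of_lt (by linarith) hY)]
  · rw [integral_Ioi_rpow_of_lt (by linarith) hY]
    congr 1
    rw [show -a - 1 + 1 = -a by ring, neg_div_neg_eq]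
  · refine (ae_restrict_mem measurableSet_Ioi).mono fun x hx => ?_
    exact Real.rpow_nonneg (hY.le.trans (le_of_lt hx)) _

theorem measurable_enorm_fourier_sq {F : Eucl d → ℂ} (hF : Integrable F) :
    Measurable fun ξ => ‖𝓕 F ξ‖ₑ ^ 2 :=
  ((continuous_fourier_of_integrable hF).measurable.enorm).pow_const 2

theorem lintegral_highFreq {s c : ℝ} {F : Eucl d → ℂ} (hF : Integrable F) :
    ∫⁻ R in Ioi (1 : ℝ), ENNReal.ofReal (R ^ (2 * s - 1)) * highFreq (c * R) F =
      ∫⁻ ξ, ‖𝓕 F ξ‖ₑ ^ 2 * ∫⁻ R in Ioi (1 : ℝ),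
        {R | c * R < ‖ξ‖}.indicator (fun R => ENNReal.ofReal (R ^ (2 * s - 1))) R := by
  refine setLIntegral_mul_setLIntegral_swap (P := fun R ξ => c * R < ‖ξ‖)
    (measurable_rpowWeight _) (measurable_enorm_fourier_sq hF) ?_ _
  exact measurableSet_lt (by fun_prop) (by fun_prop)

/-- By Tonelli the weight of |F̂(ξ)|² is at most ∫₀^{|ξ|/c} R^{2s-1} dR, a multiple of |ξ|^{2s}. The
factor c absorbs the loss of frequency in low-pass approximations. -/
theorem lintegral_highFreq_le (d : ℕ) {s c : ℝ} (hs : 0 < s) (hc : 0 < c) :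
    ∃ C : ℝ, ∀ F : Eucl d → ℂ, Integrable F →
      ∫⁻ R in Ioi (1 : ℝ), ENNReal.ofReal (R ^ (2 * s - 1)) * highFreq (c * R) F ≤
        ENNReal.ofReal C * hsSq s F := by
  refine ⟨(c ^ (2 * s))⁻¹ / (2 * s), fun F hF => ?_⟩
  rw [lintegral_highFreq hF, hsSq, ← lintegral_const_mul' _ _ ENNReal.ofReal_ne_top]
  refine lintegral_mono fun ξ => ?_
  rw [mul_comm, ← mul_assoc, ← ENNReal.ofReal_mul (by positivity)]
  gcongr
  have hX : 0 ≤ ‖ξ‖ / c := by positivity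
  calc _ ≤ ∫⁻ R in Ioo 0 (‖ξ‖ / c), ENNReal.ofReal (R ^ (2 * s - 1)) := by
        rw [← lintegral_indicator measurableSet_Ioi, ← lintegral_indicator measurableSet_Ioo]
        refine lintegral_mono fun R => ?_
        by_cases h1 : 1 < R
        · by_cases h2 : c * R < ‖ξ‖
          · have : R ∈ Ioo 0 (‖ξ‖ / c) := ⟨by linarith, by rw [lt_div_iff₀ hc]; linarith⟩
            simp [indicator, h1, h2, this.1, this.2]
          · simp [indicator, h2]
        · simp [indicator, h1]
    _ = ENNReal.ofReal ((‖ξ‖ / c) ^ (2 * s) / (2 * s)) := by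
        rw [lintegral_Ioo_rpow hs le_rfl hX, Real.zero_rpow (by positivity), sub_zero]
    _ ≤ _ := by
        refine ENNReal.ofReal_le_ofReal ?_
        rw [Real.div_rpow (norm_nonneg _) hc.le, Real.rpow_mul (norm_nonneg _)]
        have : (‖ξ‖ ^ (2 : ℝ)) ^ s ≤ (1 + ‖ξ‖ ^ 2) ^ s := by
          rw [Real.rpow_two]; gcongr; linarith
        calc _ = (c ^ (2 * s))⁻¹ / (2 * s) * (‖ξ‖ ^ (2 : ℝ)) ^ s := by field_simp
          _ ≤ _ := by gcongr

/-- The converse comparison: the thresholds 1 < R < |ξ| contribute (|ξ|^{2s} - 1)/(2s), which misses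
|ξ| ≤ 1, so the L² mass is added. Both ranges of ξ are covered by the constant 2^s(1 + 2s). -/
theorem hsSq_le_lintegral_highFreq (d : ℕ) {s : ℝ} (hs : 0 < s) :
    ∃ C : ℝ, ∀ F : Eucl d → ℂ, Integrable F →
      hsSq s F ≤ ENNReal.ofReal C * ((∫⁻ ξ, ‖𝓕 F ξ‖ₑ ^ 2) +
        ∫⁻ R in Ioi (1 : ℝ), ENNReal.ofReal (R ^ (2 * s - 1)) * highFreq R F) := by
  refine ⟨2 ^ s * (1 + 2 * s), fun F hF => ?_⟩
  have h1 := lintegral_highFreq (s := s) (c := 1) hF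
  simp only [one_mul] at h1
  have hm := measurable_enorm_fourier_sq hF
  rw [h1, ← lintegral_add_left hm, hsSq, ← lintegral_const_mul' _ _ ENNReal.ofReal_ne_top]
  refine lintegral_mono fun ξ => ?_
  have hfac : ∀ a b c : ℝ≥0∞, c * (a + a * b) = (c * (1 + b)) * a := fun a b c => by ring
  rw [hfac]
  gcongr
  have h2 : (0 : ℝ) < 2 ^ s := by positivity
  rcases le_or_gt ‖ξ‖ 1 with hξ | hξ
  · refine le_trans ?_ (le_mul_of_one_le_right zero_le (le_add_of_nonneg_right zero_le))
    refine ENNReal.ofReal_le_ofReal ?_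
    have : (1 + ‖ξ‖ ^ 2) ^ s ≤ 2 ^ s := by
      gcongr; nlinarith [norm_nonneg ξ]
    nlinarith
  · have h3 : ∫⁻ R in Ioi (1 : ℝ), {R | R < ‖ξ‖}.indicator
        (fun R => ENNReal.ofReal (R ^ (2 * s - 1))) R =
        ENNReal.ofReal ((‖ξ‖ ^ (2 * s) - 1) / (2 * s)) := by
      rw [show {R | R < ‖ξ‖} = Iio ‖ξ‖ from rfl, setLIntegral_indicator measurableSet_Iio,
        Iio_inter_Ioi, lintegral_Ioo_rpow hs zero_le_one hξ.le, Real.one_rpow]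
    have h4 : 1 ≤ ‖ξ‖ ^ (2 * s) := Real.one_le_rpow hξ.le (by positivity)
    rw [h3, ← ENNReal.ofReal_one, ← ENNReal.ofReal_add zero_le_one
      (div_nonneg (by linarith) (by positivity)), ← ENNReal.ofReal_mul (by positivity)]
    refine ENNReal.ofReal_le_ofReal ?_
    have h5 : (1 + ‖ξ‖ ^ 2) ^ s ≤ 2 ^ s * ‖ξ‖ ^ (2 * s) := by
      rw [Real.rpow_mul (norm_nonneg _), Real.rpow_two, ← Real.mul_rpow (by norm_num) (by positivity)]
      gcongr
      nlinarith
    refine h5.trans ?_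
    rw [mul_assoc]
    gcongr
    have : (1 + 2 * s) * (1 + (‖ξ‖ ^ (2 * s) - 1) / (2 * s)) =
      ‖ξ‖ ^ (2 * s) + 2 * s + (‖ξ‖ ^ (2 * s) - 1) / (2 * s) := by field_simp; ring
    rw [this]
    have : 0 ≤ (‖ξ‖ ^ (2 * s) - 1) / (2 * s) := div_nonneg (by linarith) (by positivity)
    linarith

/-- A Hardy inequality for the part of the `H^m` norm below the frequency `R`. -/
theorem lintegral_lowFreq_le (d : ℕ) {s m : ℝ} (hsm : s < m) :
    ∃ C : ℝ, ∀ F : Eucl d → ℂ, Integrable F →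
      ∫⁻ R in Ioi (1 : ℝ), ENNReal.ofReal (R ^ (-(2 * (m - s)) - 1)) *
        (∫⁻ ξ in {ξ | ‖ξ‖ < R}, ENNReal.ofReal ((1 + ‖ξ‖ ^ 2) ^ m) * ‖𝓕 F ξ‖ₑ ^ 2) ≤
        ENNReal.ofReal C * hsSq s F := by
  have ha : 0 < 2 * (m - s) := by linarith
  refine ⟨2 ^ (m - s) / (2 * (m - s)), fun F hF => ?_⟩
  have hG : Measurable fun ξ : Eucl d =>
      ENNReal.ofReal ((1 + ‖ξ‖ ^ 2) ^ m) * ‖𝓕 F ξ‖ₑ ^ 2 := by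
    refine Measurable.mul ?_ (measurable_enorm_fourier_sq hF)
    exact ((measurable_const.add (measurable_norm.pow_const 2)).pow_const m).ennreal_ofReal
  rw [setLIntegral_mul_setLIntegral_swap (P := fun R ξ => ‖ξ‖ < R)
    (measurable_rpowWeight _) hG (measurableSet_lt (by fun_prop) (by fun_prop)), hsSq,
    ← lintegral_const_mul' _ _ ENNReal.ofReal_ne_top]
  refine lintegral_mono fun ξ => ?_
  rw [mul_right_comm, ← mul_assoc]
  refine mul_le_mul' ?_ le_rfl
  set Z : ℝ := 1 + ‖ξ‖ ^ 2 with hZ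
  have hZ0 : 0 < Z := by positivity
  -- If R > 1 and R > |ξ| then R² > (1+|ξ|²)/2 = Y². So Y is a lower limit for R that is comparable
  -- to (1+|ξ|²)^{1/2} and positive also at ξ = 0.
  set Y : ℝ := (Z / 2) ^ (1 / 2 : ℝ) with hY
  have hY0 : 0 < Y := by positivity
  have hYsq : Y ^ 2 = Z / 2 := by
    rw [hY, ← Real.rpow_natCast, ← Real.rpow_mul (by positivity)]; norm_num
  calc _ ≤ ENNReal.ofReal (Z ^ m) *
        ∫⁻ R in Ioi Y, ENNReal.ofReal (R ^ (-(2 * (m - s)) - 1)) := by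
        refine mul_le_mul' le_rfl ?_
        rw [show {R | ‖ξ‖ < R} = Ioi ‖ξ‖ from rfl, setLIntegral_indicator measurableSet_Ioi]
        refine lintegral_mono_set fun R hR => ?_
        have h1 : ‖ξ‖ < R := hR.1
        have h2 : 1 < R := hR.2
        change Y < R
        refine lt_of_pow_lt_pow_left₀ 2 (by linarith) ?_
        rw [hYsq, hZ]
        nlinarith [norm_nonneg ξ]
    _ = ENNReal.ofReal (Z ^ m * (Y ^ (-(2 * (m - s))) / (2 * (m - s)))) := by
        rw [lintegral_Ioi_rpow ha hY0, ENNReal.ofReal_mul (by positivity)]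
    _ = _ := by
        rw [← ENNReal.ofReal_mul (by positivity)]
        congr 1
        have : Y ^ (-(2 * (m - s))) = 2 ^ (m - s) * Z ^ s / Z ^ m := by
          rw [hY, ← Real.rpow_mul (by positivity), Real.div_rpow hZ0.le (by norm_num),
            show 1 / 2 * -(2 * (m - s)) = s - m by ring, Real.rpow_sub hZ0,
            show s - m = -(m - s) by ring, Real.rpow_neg (by norm_num : (0 : ℝ) ≤ 2)]
          field_simp
        rw [this]
        field_simp

end LayerCake
-- The tame product estimate on ℝ^d
section Product
open FourierTransform SchwartzMap

variable {d : ℕ}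

theorem ennreal_add_sq_le (a b : ℝ≥0∞) : (a + b) ^ 2 ≤ 2 * a ^ 2 + 2 * b ^ 2 := by
  have := ENNReal.rpow_add_le_mul_rpow_add_rpow a b (p := 2) (by norm_num)
  norm_num at this
  rwa [mul_add] at this

theorem two_mul_ofReal (a : ℝ) : 2 * ENNReal.ofReal a = ENNReal.ofReal (2 * a) := by
  rw [ENNReal.ofReal_mul zero_le_two, ENNReal.ofReal_ofNat]

theorem enorm_add_sq_le (a b : ℂ) : ‖a + b‖ₑ ^ 2 ≤ 2 * ‖a‖ₑ ^ 2 + 2 * ‖b‖ₑ ^ 2 :=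
  (pow_le_pow_left' (enorm_add_le a b) 2).trans (ennreal_add_sq_le _ _)

theorem fourier_sub_of_integrable {F G : Eucl d → ℂ} (hF : Integrable F) (hG : Integrable G)
    (ξ : Eucl d) : 𝓕 (fun x => F x - G x) ξ = 𝓕 F ξ - 𝓕 G ξ := by
  simp only [Real.fourier_eq, smul_sub]
  exact integral_sub ((Real.fourierIntegral_convergent_iff ξ).2 hF)
    ((Real.fourierIntegral_convergent_iff ξ).2 hG)

theorem highFreq_le_of_approx {F P : Eucl d → ℂ} (hF : Integrable F) (hF2 : MemLp F 2 volume)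
    (hP : Integrable P) (hP2 : MemLp P 2 volume) (R : ℝ) :
    highFreq R F ≤ 2 * (∫⁻ x, ‖F x - P x‖ₑ ^ 2) + 2 * highFreq R P := by
  have h1 : ∫⁻ x, ‖F x - P x‖ₑ ^ 2 = ∫⁻ ξ, ‖𝓕 F ξ - 𝓕 P ξ‖ₑ ^ 2 := by
    rw [← lintegral_enorm_fourier_sq (F := fun x => F x - P x) (hF.sub hP) (hF2.sub hP2)]
    simp_rw [fourier_sub_of_integrable hF hP]
  have hm : Measurable fun ξ => ‖𝓕 F ξ - 𝓕 P ξ‖ₑ ^ 2 :=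
    (((continuous_fourier_of_integrable hF).sub
      (continuous_fourier_of_integrable hP)).measurable.enorm).pow_const 2
  calc highFreq R F ≤ ∫⁻ ξ in {ξ | R < ‖ξ‖}, (2 * ‖𝓕 F ξ - 𝓕 P ξ‖ₑ ^ 2 + 2 * ‖𝓕 P ξ‖ₑ ^ 2) := by
        refine lintegral_mono fun ξ => ?_
        have := enorm_add_sq_le (𝓕 F ξ - 𝓕 P ξ) (𝓕 P ξ)
        rwa [sub_add_cancel] at this
    _ = 2 * (∫⁻ ξ in {ξ | R < ‖ξ‖}, ‖𝓕 F ξ - 𝓕 P ξ‖ₑ ^ 2) + 2 * highFreq R P := by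
        rw [lintegral_add_left (hm.const_mul 2), lintegral_const_mul' _ _ (by norm_num),
          lintegral_const_mul' _ _ (by norm_num)]
        rfl
    _ ≤ _ := by
        rw [h1]
        gcongr
        exact Measure.restrict_le_self

/-- F̂ - B̂ vanishes below R/2 and is dominated by F̂ above; then Plancherel. -/
theorem IsLowPass.lintegral_sub_le {C R : ℝ} {F : Eucl d → ℂ} {B : 𝓢(Eucl d, ℂ)}
    (h : IsLowPass C R F B) (hF : BddCpt F) :
    ∫⁻ x, ‖F x - B x‖ₑ ^ 2 ≤ highFreq (R / 2) F := by
  rw [← lintegral_enorm_fourier_sq (F := fun x => F x - B x) (hF.integrable.sub B.integrable)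
    ((hF.memLp 2).sub (B.memLp 2))]
  simp_rw [fourier_sub_of_integrable hF.integrable B.integrable]
  rw [highFreq, ← lintegral_indicator (measurableSet_lt measurable_const measurable_norm)]
  refine lintegral_mono fun ξ => ?_
  by_cases hξ : R / 2 < ‖ξ‖
  · simp only [indicator, mem_ofPred_eq, hξ, if_true]
    gcongr
    rw [enorm_le_iff_norm_le]
    exact h.norm_sub_le ξ
  · rw [← h.fourier_eq ξ (not_lt.1 hξ)]
    simp

theorem lintegral_sq_le_hsSq {s : ℝ} (hs : 0 ≤ s) {F : Eucl d → ℂ} (hF : BddCpt F) :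
    ∫⁻ x, ‖F x‖ₑ ^ 2 ≤ hsSq s F := by
  rw [← lintegral_enorm_fourier_sq hF.integrable (hF.memLp 2)]
  refine lintegral_mono fun ξ => le_mul_of_one_le_left zero_le ?_
  rw [← ENNReal.ofReal_one]
  exact ENNReal.ofReal_le_ofReal (Real.one_le_rpow (by nlinarith [sq_nonneg ‖ξ‖]) hs)

/-- The spectrum of a product lies in the sum of the spectra. Here the convolution is written by
duality as an integral over η, and when |ξ| > R one of |η|, |ξ + η| exceeds R/2, or η lies on the
sphere |η| = R/2 where the first factor vanishes already. -/
theorem fourier_mul_conj_eq_zero {B D : 𝓢(Eucl d, ℂ)} {R : ℝ}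
    (hB : ∀ ξ, R / 2 ≤ ‖ξ‖ → 𝓕 (B : Eucl d → ℂ) ξ = 0)
    (hD : ∀ ξ, R / 2 ≤ ‖ξ‖ → 𝓕 (D : Eucl d → ℂ) ξ = 0) {ξ : Eucl d} (hξ : R < ‖ξ‖) :
    𝓕 (fun x => B x * starRingEnd ℂ (D x)) ξ = 0 := by
  let g : Eucl d → ℂ := fun x => Real.fourierChar (-inner ℝ x ξ) • starRingEnd ℂ (D x)
  have hgi : Integrable g := (Real.fourierIntegral_convergent_iff ξ).2
    (Complex.conjLIE.toContinuousLinearEquiv.integrable_comp_iff.2 D.integrable)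
  have hg : ∀ η, 𝓕 g η = starRingEnd ℂ (𝓕 (D : Eucl d → ℂ) (-(ξ + η))) := by
    intro η
    rw [Real.fourier_eq, Real.fourier_eq, ← integral_conj]
    congr 1 with x
    simp only [g, Circle.smul_def, smul_eq_mul, map_mul, ← mul_assoc]
    congr 1
    rw [← Circle.coe_mul, ← AddChar.map_add_eq_mul, ← Circle.coe_inv_eq_conj,
      ← AddChar.map_neg_eq_inv]
    congr 2
    rw [inner_neg_right, inner_add_right]; ring
  have hBi : ∀ x, B x = 𝓕 ((𝓕⁻ B : 𝓢(Eucl d, ℂ)) : Eucl d → ℂ) x := by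
    intro x
    rw [← fourier_coe, fourier_fourierInv_eq]
  rw [Real.fourier_eq]
  calc _ = ∫ x, 𝓕 ((𝓕⁻ B : 𝓢(Eucl d, ℂ)) : Eucl d → ℂ) x * g x := by
        congr 1 with x
        rw [← hBi]
        simp only [g, Circle.smul_def, smul_eq_mul]; ring
    _ = ∫ η, (𝓕⁻ B : 𝓢(Eucl d, ℂ)) η * 𝓕 g η :=
        integral_fourier_mul_of_integrable (𝓕⁻ B : 𝓢(Eucl d, ℂ)).integrable hgi
    _ = ∫ η, (0 : ℂ) := by
        congr 1 with η
        rw [hg, fourierInv_coe, Real.fourierInv_eq_fourier_neg]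
        rcases le_or_gt (R / 2) ‖η‖ with h | h
        · rw [hB _ (by rwa [norm_neg]), zero_mul]
        · rw [hD, map_zero, mul_zero]
          rw [norm_neg]
          have := norm_sub_le (ξ + η) η
          rw [add_sub_cancel_right] at this
          linarith
    _ = 0 := by simp

theorem SchwartzMap_memLp_mul_conj (B D : 𝓢(Eucl d, ℂ)) (p : ℝ≥0∞) :
    MemLp (fun x => B x * starRingEnd ℂ (D x)) p volume :=
  (D.memLp ⊤).star.mul' (B.memLp p)

variable (d) in
/-- The tame product estimate in `H^s ∩ L^∞`. -/
theorem hsSq_mul_conj_le {s : ℝ} (hs : 0 < s) :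
    ∃ C : ℝ, 0 ≤ C ∧ ∀ (F G : Eucl d → ℂ) (N : ℝ), BddCpt F → BddCpt G →
      (∀ x, ‖F x‖ ≤ N) → (∀ x, ‖G x‖ ≤ N) →
      hsSq s (fun x => F x * starRingEnd ℂ (G x)) ≤
        ENNReal.ofReal (C * N ^ 2) * (hsSq s F + hsSq s G) := by
  obtain ⟨C₀, hC₀, hlp⟩ := exists_isLowPass d
  obtain ⟨C₁, hC₁⟩ := hsSq_le_lintegral_highFreq d hs
  obtain ⟨C₂, hC₂⟩ := lintegral_highFreq_le d hs (c := 1 / 4) (by norm_num)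
  refine ⟨max C₁ 0 * (1 + (4 + 4 * C₀ ^ 2) * max C₂ 0), by positivity,
    fun F G N hF hG hFN hGN => ?_⟩
  have hN : 0 ≤ N := (norm_nonneg _).trans (hFN 0)
  set H : Eucl d → ℂ := fun x => F x * starRingEnd ℂ (G x) with hHdef
  have hH : BddCpt H := hF.mul hG.conj
  have hL2 : ∫⁻ ξ, ‖𝓕 H ξ‖ₑ ^ 2 ≤ ENNReal.ofReal (N ^ 2) * (hsSq s F + hsSq s G) := by
    rw [lintegral_enorm_fourier_sq hH.integrable (hH.memLp 2)]
    refine le_trans ?_ (mul_le_mul' le_rfl (le_add_right (lintegral_sq_le_hsSq hs.le hF)))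
    rw [← lintegral_const_mul' _ _ ENNReal.ofReal_ne_top]
    refine lintegral_mono fun x => ?_
    rw [hHdef, enorm_mul, mul_pow, mul_comm, ENNReal.ofReal_pow hN]
    gcongr
    rw [← ofReal_norm]
    exact ENNReal.ofReal_le_ofReal (by simpa using hGN x)
  have hhigh : ∀ R ∈ Ioi (1 : ℝ), highFreq R H ≤ ENNReal.ofReal ((4 + 4 * C₀ ^ 2) * N ^ 2) *
      (highFreq (1 / 4 * R) F + highFreq (1 / 4 * R) G) := by
    intro R hR
    have hR0 : 0 < R / 2 := by have : 1 < R := hR; linarith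
    -- With both cuts at R/2 the product of the approximations has no mass above R. Each
    -- approximation error lives above R/4, whence the factor 1/4.
    obtain ⟨B, hB⟩ := hlp F hF (R / 2) hR0
    obtain ⟨D, hD⟩ := hlp G hG (R / 2) hR0
    have hz : highFreq R (fun x => B x * starRingEnd ℂ (D x)) = 0 := by
      rw [highFreq, lintegral_eq_zero_iff']
      · refine (ae_restrict_mem (measurableSet_lt measurable_const measurable_norm)).mono
          fun ξ hξ => ?_
        simp [fourier_mul_conj_eq_zero hB.fourier_eq_zero hD.fourier_eq_zero hξ]
      · exact (measurable_enorm_fourier_sq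
          (memLp_one_iff_integrable.1 (SchwartzMap_memLp_mul_conj B D 1))).aemeasurable
    refine (highFreq_le_of_approx hH.integrable (hH.memLp 2)
      (memLp_one_iff_integrable.1 (SchwartzMap_memLp_mul_conj B D 1))
      (SchwartzMap_memLp_mul_conj B D 2) R).trans ?_
    rw [hz, mul_zero, add_zero]
    have hpt : ∀ x, ‖H x - B x * starRingEnd ℂ (D x)‖ₑ ^ 2 ≤
        ENNReal.ofReal (2 * N ^ 2) * ‖F x - B x‖ₑ ^ 2 +
        ENNReal.ofReal (2 * C₀ ^ 2 * N ^ 2) * ‖G x - D x‖ₑ ^ 2 := by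
      intro x
      -- Telescoping pairs each error with a factor bounded in sup norm: G by N, and B by C₀N
      -- uniformly in R.
      have e : H x - B x * starRingEnd ℂ (D x) = (F x - B x) * starRingEnd ℂ (G x) +
          B x * starRingEnd ℂ (G x - D x) := by simp only [hHdef, map_sub]; ring
      rw [e]
      refine (enorm_add_sq_le _ _).trans ?_
      simp only [← ofReal_norm, norm_mul, RCLike.norm_conj]
      rw [← ENNReal.ofReal_pow (by positivity), ← ENNReal.ofReal_pow (by positivity),
        ← ENNReal.ofReal_pow (by positivity), ← ENNReal.ofReal_pow (by positivity),
        ← ENNReal.ofReal_mul (by positivity), ← ENNReal.ofReal_mul (by positivity),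
        two_mul_ofReal, two_mul_ofReal]
      refine add_le_add (ENNReal.ofReal_le_ofReal ?_) (ENNReal.ofReal_le_ofReal ?_)
      · rw [mul_pow]
        have := hGN x
        nlinarith [mul_le_mul_of_nonneg_left (pow_le_pow_left₀ (norm_nonneg (G x)) this 2)
          (sq_nonneg ‖F x - B x‖)]
      · rw [mul_pow]
        have := hB.norm_le N hFN x
        nlinarith [mul_le_mul_of_nonneg_right (pow_le_pow_left₀ (norm_nonneg (B x)) this 2)
          (sq_nonneg ‖G x - D x‖)]
    have hq : 1 / 4 * R = R / 2 / 2 := by ring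
    calc _ ≤ 2 * (∫⁻ x, (ENNReal.ofReal (2 * N ^ 2) * ‖F x - B x‖ₑ ^ 2 +
          ENNReal.ofReal (2 * C₀ ^ 2 * N ^ 2) * ‖G x - D x‖ₑ ^ 2)) := by
          gcongr with x; exact hpt x
      _ = 2 * (ENNReal.ofReal (2 * N ^ 2) * (∫⁻ x, ‖F x - B x‖ₑ ^ 2) +
          ENNReal.ofReal (2 * C₀ ^ 2 * N ^ 2) * (∫⁻ x, ‖G x - D x‖ₑ ^ 2)) := by
          rw [lintegral_add_left', lintegral_const_mul' _ _ ENNReal.ofReal_ne_top,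
            lintegral_const_mul' _ _ ENNReal.ofReal_ne_top]
          exact ((hF.meas.sub B.continuous.aestronglyMeasurable).enorm.pow_const 2).const_mul _
      _ ≤ 2 * (ENNReal.ofReal (2 * N ^ 2) * highFreq (R / 2 / 2) F +
          ENNReal.ofReal (2 * C₀ ^ 2 * N ^ 2) * highFreq (R / 2 / 2) G) := by
          gcongr
          · exact hB.lintegral_sub_le hF
          · exact hD.lintegral_sub_le hG
      _ ≤ _ := by
          rw [hq, mul_add, mul_add, ← mul_assoc, ← mul_assoc, two_mul_ofReal, two_mul_ofReal]
          refine add_le_add (mul_le_mul' (ENNReal.ofReal_le_ofReal ?_) le_rfl)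
            (mul_le_mul' (ENNReal.ofReal_le_ofReal ?_) le_rfl)
          · nlinarith [mul_nonneg (sq_nonneg C₀) (sq_nonneg N)]
          · nlinarith [mul_nonneg (sq_nonneg C₀) (sq_nonneg N), sq_nonneg N]
  have hint : ∫⁻ R in Ioi (1 : ℝ), ENNReal.ofReal (R ^ (2 * s - 1)) * highFreq R H ≤
      ENNReal.ofReal ((4 + 4 * C₀ ^ 2) * max C₂ 0 * N ^ 2) * (hsSq s F + hsSq s G) := by
    calc _ ≤ ∫⁻ R in Ioi (1 : ℝ), ENNReal.ofReal ((4 + 4 * C₀ ^ 2) * N ^ 2) *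
          (ENNReal.ofReal (R ^ (2 * s - 1)) * highFreq (1 / 4 * R) F +
            ENNReal.ofReal (R ^ (2 * s - 1)) * highFreq (1 / 4 * R) G) := by
          refine setLIntegral_mono' measurableSet_Ioi fun R hR => ?_
          refine (mul_le_mul' le_rfl (hhigh R hR)).trans (le_of_eq ?_)
          ring
      _ = ENNReal.ofReal ((4 + 4 * C₀ ^ 2) * N ^ 2) *
          ((∫⁻ R in Ioi (1 : ℝ), ENNReal.ofReal (R ^ (2 * s - 1)) * highFreq (1 / 4 * R) F) +
          ∫⁻ R in Ioi (1 : ℝ), ENNReal.ofReal (R ^ (2 * s - 1)) * highFreq (1 / 4 * R) G) := by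
          rw [lintegral_const_mul' _ _ ENNReal.ofReal_ne_top, lintegral_add_left]
          exact (measurable_rpowWeight _).mul (measurable_highFreq_comp_mul (by norm_num) F)
      _ ≤ ENNReal.ofReal ((4 + 4 * C₀ ^ 2) * N ^ 2) *
          (ENNReal.ofReal (max C₂ 0) * hsSq s F + ENNReal.ofReal (max C₂ 0) * hsSq s G) := by
          have hmax : ENNReal.ofReal C₂ ≤ ENNReal.ofReal (max C₂ 0) :=
            ENNReal.ofReal_le_ofReal (le_max_left _ _)
          refine mul_le_mul' le_rfl (add_le_add ?_ ?_)
          · exact (hC₂ F hF.integrable).trans (mul_le_mul' hmax le_rfl)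
          · exact (hC₂ G hG.integrable).trans (mul_le_mul' hmax le_rfl)
      _ = _ := by
          rw [← mul_add, ← mul_assoc, ← ENNReal.ofReal_mul (by positivity)]
          congr 2; ring
  refine (hC₁ H hH.integrable).trans ?_
  calc _ ≤ ENNReal.ofReal (max C₁ 0) * (ENNReal.ofReal (N ^ 2) * (hsSq s F + hsSq s G) +
        ENNReal.ofReal ((4 + 4 * C₀ ^ 2) * max C₂ 0 * N ^ 2) * (hsSq s F + hsSq s G)) :=
        mul_le_mul' (ENNReal.ofReal_le_ofReal (le_max_left _ _)) (add_le_add hL2 hint)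
    _ = _ := by
        rw [← add_mul, ← ENNReal.ofReal_add (by positivity) (by positivity), ← mul_assoc,
          ← ENNReal.ofReal_mul (by positivity)]
        congr 2; ring

end Product
-- Integer-order Sobolev norms through derivatives
section Derivatives
open FourierTransform SchwartzMap

variable {d : ℕ}

/-- The tuple of standard basis vectors with indices `r`. -/
noncomputable def basisTuple {n : ℕ} (r : Fin n → Fin d) (k : Fin n) : Eucl d :=
  EuclideanSpace.single (r k) (1 : ℝ)

theorem eucl_eq_sum (v : Eucl d) : v = ∑ j, v j • EuclideanSpace.single j (1 : ℝ) := by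
  have := (EuclideanSpace.basisFun (Fin d) ℝ).sum_repr v
  simpa using this.symm

theorem norm_multilinear_le_sum {n : ℕ} (f : ContinuousMultilinearMap ℝ (fun _ : Fin n => Eucl d) ℂ) :
    ‖f‖ ≤ ∑ r : Fin n → Fin d, ‖f (basisTuple r)‖ := by
  refine ContinuousMultilinearMap.opNorm_le_bound (Finset.sum_nonneg fun _ _ => norm_nonneg _)
    fun m => ?_
  have e : f m = ∑ r : Fin n → Fin d, (∏ k, m k (r k)) • f (basisTuple r) := by
    conv_lhs => rw [show m = fun k => ∑ j, m k j • EuclideanSpace.single j (1 : ℝ) from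
      funext fun k => eucl_eq_sum (m k)]
    rw [ContinuousMultilinearMap.map_sum]
    refine Finset.sum_congr rfl fun r _ => ?_
    rw [ContinuousMultilinearMap.map_smul_univ]
    rfl
  rw [e, Finset.sum_mul]
  refine (norm_sum_le _ _).trans (Finset.sum_le_sum fun r _ => ?_)
  rw [norm_smul, mul_comm, norm_prod]
  gcongr with k
  exact PiLp.norm_apply_le _ _

theorem norm_apply_basisTuple_le {n : ℕ}
    (f : ContinuousMultilinearMap ℝ (fun _ : Fin n => Eucl d) ℂ) (r : Fin n → Fin d) :
    ‖f (basisTuple r)‖ ≤ ‖f‖ := by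
  refine (f.le_opNorm _).trans ?_
  simp [basisTuple]

/-- Each derivative multiplies |f̂| by a product of factors 2π|ξ_{r k}|. Summing squares over
ordered tuples, rather than multi-indices, gives exactly (∑ ξ_j²)^n, with no multinomial
coefficients. -/
theorem sum_norm_sq_fourier_deriv (f : 𝓢(Eucl d, ℂ)) (n : ℕ) (ξ : Eucl d) :
    ∑ r : Fin n → Fin d, ‖𝓕 (fun x => iteratedFDeriv ℝ n f x (basisTuple r)) ξ‖ ^ 2 =
      (2 * Real.pi * ‖ξ‖) ^ (2 * n) * ‖𝓕 (f : Eucl d → ℂ) ξ‖ ^ 2 := by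
  have hint : ∀ k : ℕ, Integrable (iteratedFDeriv ℝ k f) := fun k => by
    have := f.integrable_pow_mul_iteratedFDeriv volume 0 k
    simp only [pow_zero, one_mul] at this
    have hc : Continuous (iteratedFDeriv ℝ k f) :=
      (f.smooth ⊤).continuous_iteratedFDeriv (by exact_mod_cast le_top)
    exact (integrable_norm_iff hc.aestronglyMeasurable).1 this
  have h1 := Real.fourier_iteratedFDeriv (N := ⊤) (f.smooth ⊤) (fun k _ => hint k) (n := n) le_top
  have h2 : ∀ r : Fin n → Fin d,
      ‖𝓕 (fun x => iteratedFDeriv ℝ n f x (basisTuple r)) ξ‖ ^ 2 =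
      (2 * Real.pi) ^ (2 * n) * (∏ k, (ξ (r k)) ^ 2) * ‖𝓕 (f : Eucl d → ℂ) ξ‖ ^ 2 := by
    intro r
    rw [← Real.fourier_continuousMultilinearMap_apply (hint n), h1]
    simp only [VectorFourier.fourierPowSMulRight_apply, norm_smul, norm_pow, norm_neg, norm_mul,
      Complex.norm_I, mul_one, Complex.norm_ofNat, Complex.norm_real, norm_prod]
    have h3 : ∀ k, ‖(-innerSL ℝ) ξ (basisTuple r k)‖ = |ξ (r k)| := fun k => by
      simp [basisTuple, EuclideanSpace.inner_single_right]
    simp_rw [h3, mul_pow, ← Finset.prod_pow, sq_abs, Real.norm_of_nonneg Real.pi_pos.le, ← pow_mul,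
      mul_comm n 2]
    ring
  simp_rw [h2]
  rw [← Finset.sum_mul, ← Finset.mul_sum, ← Fintype.sum_pow (fun j => ξ j ^ 2)]
  have : ∑ j, ξ j ^ 2 = ‖ξ‖ ^ 2 := by simp [EuclideanSpace.norm_sq_eq]
  rw [this, mul_pow (2 * Real.pi), ← pow_mul]

theorem sum_lintegral_deriv (f : 𝓢(Eucl d, ℂ)) (n : ℕ) :
    ∑ r : Fin n → Fin d, ∫⁻ x, ‖iteratedFDeriv ℝ n f x (basisTuple r)‖ₑ ^ 2 =
      ∫⁻ ξ, ENNReal.ofReal ((2 * Real.pi * ‖ξ‖) ^ (2 * n)) * ‖𝓕 (f : Eucl d → ℂ) ξ‖ₑ ^ 2 := by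
  have hs : ∀ r : Fin n → Fin d, ∃ g : 𝓢(Eucl d, ℂ),
      (fun x => iteratedFDeriv ℝ n f x (basisTuple r)) = g := fun r =>
    ⟨LineDeriv.iteratedLineDerivOp (basisTuple r) f, funext fun x =>
      (SchwartzMap.iteratedLineDerivOp_eq_iteratedFDeriv).symm⟩
  have h1 : ∀ r : Fin n → Fin d, ∫⁻ x, ‖iteratedFDeriv ℝ n f x (basisTuple r)‖ₑ ^ 2 =
      ∫⁻ ξ, ‖𝓕 (fun x => iteratedFDeriv ℝ n f x (basisTuple r)) ξ‖ₑ ^ 2 := by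
    intro r
    obtain ⟨g, hg⟩ := hs r
    rw [hg, lintegral_enorm_fourier_sq g.integrable (g.memLp 2), ← hg]
  simp_rw [h1]
  rw [← lintegral_finsetSum]
  · congr 1 with ξ
    simp_rw [← ofReal_norm, ← ENNReal.ofReal_pow (norm_nonneg _)]
    rw [← ENNReal.ofReal_sum_of_nonneg (fun _ _ => by positivity), sum_norm_sq_fourier_deriv,
      ENNReal.ofReal_mul (by positivity)]
  · intro r _
    obtain ⟨g, hg⟩ := hs r
    rw [hg]
    exact measurable_enorm_fourier_sq g.integrable

/-- The operator norm is at most the sum of the components on basis tuples; d^n is the number of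
tuples, paid in Cauchy–Schwarz. -/
theorem lintegral_iteratedFDeriv_sq_le (f : 𝓢(Eucl d, ℂ)) (n : ℕ) :
    ∫⁻ x, ‖iteratedFDeriv ℝ n f x‖ₑ ^ 2 ≤ ENNReal.ofReal ((d : ℝ) ^ n) *
      ∫⁻ ξ, ENNReal.ofReal ((2 * Real.pi * ‖ξ‖) ^ (2 * n)) * ‖𝓕 (f : Eucl d → ℂ) ξ‖ₑ ^ 2 := by
  have hc : ∀ r : Fin n → Fin d, Continuous fun x => iteratedFDeriv ℝ n f x (basisTuple r) := by
    intro r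
    have h := (f.smooth ⊤).continuous_iteratedFDeriv (m := n) (by exact_mod_cast le_top)
    exact (ContinuousMultilinearMap.apply ℝ (fun _ : Fin n => Eucl d) ℂ
      (basisTuple r)).continuous.comp h
  rw [← sum_lintegral_deriv, ← lintegral_finsetSum _
    (fun r _ => ((hc r).measurable.enorm.pow_const 2)),
    ← lintegral_const_mul' _ _ ENNReal.ofReal_ne_top]
  refine lintegral_mono fun x => ?_
  simp_rw [← ofReal_norm, ← ENNReal.ofReal_pow (norm_nonneg _)]
  rw [← ENNReal.ofReal_sum_of_nonneg (fun _ _ => by positivity),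
    ← ENNReal.ofReal_mul (by positivity)]
  refine ENNReal.ofReal_le_ofReal ?_
  refine (pow_le_pow_left₀ (norm_nonneg _) (norm_multilinear_le_sum _) 2).trans ?_
  refine sq_sum_le_card_mul_sum_sq.trans (le_of_eq ?_)
  simp

theorem lintegral_fourier_le_iteratedFDeriv (f : 𝓢(Eucl d, ℂ)) (n : ℕ) :
    ∫⁻ ξ, ENNReal.ofReal ((2 * Real.pi * ‖ξ‖) ^ (2 * n)) * ‖𝓕 (f : Eucl d → ℂ) ξ‖ₑ ^ 2 ≤
      ENNReal.ofReal ((d : ℝ) ^ n) * ∫⁻ x, ‖iteratedFDeriv ℝ n f x‖ₑ ^ 2 := by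
  rw [← sum_lintegral_deriv]
  have : ∀ r ∈ (Finset.univ : Finset (Fin n → Fin d)),
      ∫⁻ x, ‖iteratedFDeriv ℝ n f x (basisTuple r)‖ₑ ^ 2 ≤
      ∫⁻ x, ‖iteratedFDeriv ℝ n f x‖ₑ ^ 2 := fun r _ => by
    refine lintegral_mono fun x => ?_
    gcongr
    rw [← ofReal_norm, ← ofReal_norm]
    exact ENNReal.ofReal_le_ofReal (norm_apply_basisTuple_le _ r)
  refine (Finset.sum_le_card_nsmul _ _ _ this).trans (le_of_eq ?_)
  simp [nsmul_eq_mul, ENNReal.ofReal_pow]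

end Derivatives
-- Cutoffs and changes of coordinates in L² and at integer order
section CoordinateChange
open FourierTransform SchwartzMap

variable {d : ℕ}

/-- A diffeomorphism `ψ` of an open set `V` onto its image and a smooth cutoff `χ` which is
compactly supported in `V`. -/
structure IsCutoffChange (V : Set (Eucl d)) (ψ : Eucl d → Eucl d) (χ : Eucl d → ℂ) : Prop where
  isOpen : IsOpen V
  contDiffOn : ContDiffOn ℝ ∞ ψ V
  injOn : InjOn ψ V
  det_ne_zero : ∀ y ∈ V, (fderiv ℝ ψ y).det ≠ 0
  contDiff : ContDiff ℝ ∞ χ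
  supp : HasCompactSupport χ
  subset : tsupport χ ⊆ V

namespace IsCutoffChange

variable {V : Set (Eucl d)} {ψ : Eucl d → Eucl d} {χ : Eucl d → ℂ}

theorem continuousOn_fderiv (h : IsCutoffChange V ψ χ) : ContinuousOn (fderiv ℝ ψ) V :=
  h.contDiffOn.continuousOn_fderiv_of_isOpen h.isOpen (by norm_num)

/-- The Jacobian of ψ is bounded below on the compact support of χ, so the change of variables
formula applies with constant 1/min|det|. -/
theorem lintegral_comp_le (h : IsCutoffChange V ψ χ) : ∃ C : ℝ, 0 ≤ C ∧
    ∀ H : Eucl d → ℝ≥0∞, ∫⁻ y in tsupport χ, H (ψ y) ≤ ENNReal.ofReal C * ∫⁻ x, H x := by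
  rcases (tsupport χ).eq_empty_or_nonempty with he | hne
  · exact ⟨0, le_rfl, fun H => by simp [he]⟩
  have hdet : ContinuousOn (fun y => |(fderiv ℝ ψ y).det|) (tsupport χ) :=
    (ContinuousLinearMap.continuous_det.comp_continuousOn
      (h.continuousOn_fderiv.mono h.subset)).abs
  obtain ⟨y₀, hy₀, hmin⟩ := h.supp.isCompact.exists_isMinOn hne hdet
  set c := |(fderiv ℝ ψ y₀).det| with hc
  have hc0 : 0 < c := abs_pos.2 (h.det_ne_zero y₀ (h.subset hy₀))
  refine ⟨c⁻¹, by positivity, fun H => ?_⟩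
  have hms := (isClosed_tsupport χ).measurableSet
  have hd : ∀ x ∈ tsupport χ, HasFDerivWithinAt ψ (fderiv ℝ ψ x) (tsupport χ) x := fun x hx =>
    ((h.contDiffOn.contDiffAt (h.isOpen.mem_nhds (h.subset hx))).differentiableAt
      (by norm_num)).hasFDerivAt.hasFDerivWithinAt
  have key := lintegral_image_eq_lintegral_abs_det_fderiv_mul volume hms hd
    (h.injOn.mono h.subset) H
  calc ∫⁻ y in tsupport χ, H (ψ y)
      ≤ ∫⁻ y in tsupport χ, ENNReal.ofReal c⁻¹ *
        (ENNReal.ofReal |(fderiv ℝ ψ y).det| * H (ψ y)) := by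
        refine setLIntegral_mono' hms fun y hy => ?_
        rw [← mul_assoc, ← ENNReal.ofReal_mul (by positivity)]
        refine le_mul_of_one_le_left zero_le ?_
        rw [← ENNReal.ofReal_one]
        refine ENNReal.ofReal_le_ofReal ?_
        rw [inv_mul_eq_div, one_le_div hc0]
        exact hmin hy
    _ = ENNReal.ofReal c⁻¹ * ∫⁻ x in ψ '' tsupport χ, H x := by
        rw [lintegral_const_mul' _ _ ENNReal.ofReal_ne_top, key]
    _ ≤ _ := mul_le_mul' le_rfl (lintegral_mono' Measure.restrict_le_self le_rfl)

theorem contDiff_mul_comp (h : IsCutoffChange V ψ χ) {B : Eucl d → ℂ} (hB : ContDiff ℝ ∞ B) :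
    ContDiff ℝ ∞ fun y => χ y * B (ψ y) := by
  rw [contDiff_iff_contDiffAt]
  intro y
  by_cases hy : y ∈ tsupport χ
  · exact h.contDiff.contDiffAt.mul
      (hB.contDiffAt.comp y (h.contDiffOn.contDiffAt (h.isOpen.mem_nhds (h.subset hy))))
  · have h0 : χ =ᶠ[𝓝 y] 0 := notMem_tsupport_iff_eventuallyEq.1 hy
    have : (fun y => χ y * B (ψ y)) =ᶠ[𝓝 y] fun _ => 0 := by
      filter_upwards [h0] with z hz; simp [hz]
    exact contDiffAt_const.congr_of_eventuallyEq this

/-- Leibniz and Faà di Bruno, with the derivatives of χ and ψ bounded on the compact support of χ.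
They are taken within V because ψ is smooth only there. -/
theorem exists_norm_iteratedFDeriv_le (h : IsCutoffChange V ψ χ) (m : ℕ) : ∃ C : ℝ, 0 ≤ C ∧
    ∀ B : Eucl d → ℂ, ContDiff ℝ ∞ B → ∀ y ∈ tsupport χ,
      ‖iteratedFDeriv ℝ m (fun y => χ y * B (ψ y)) y‖ ≤
        C * ∑ j ∈ Finset.range (m + 1), ‖iteratedFDeriv ℝ j B (ψ y)‖ := by
  have hnat : ∀ k : ℕ, (k : WithTop ℕ∞) ≤ ((⊤ : ℕ∞) : WithTop ℕ∞) := fun k => by exact_mod_cast le_top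
  have hVu : UniqueDiffOn ℝ V := h.isOpen.uniqueDiffOn
  have hψ : ∀ i : ℕ, ∃ D, ∀ y ∈ tsupport χ, ‖iteratedFDerivWithin ℝ i ψ V y‖ ≤ D := fun i =>
    h.supp.isCompact.exists_bound_of_continuousOn
      ((h.contDiffOn.continuousOn_iteratedFDerivWithin (by exact_mod_cast le_top) hVu).mono h.subset)
  have hχ : ∀ i : ℕ, ∃ D, ∀ y ∈ tsupport χ, ‖iteratedFDerivWithin ℝ i χ V y‖ ≤ D := fun i =>
    h.supp.isCompact.exists_bound_of_continuousOn
      ((h.contDiff.contDiffOn.continuousOn_iteratedFDerivWithin (by exact_mod_cast le_top) hVu).mono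
        h.subset)
  choose D hD using hψ
  choose D' hD' using hχ
  -- The composition estimate asks for ‖D^jψ‖ ≤ K^j; the summand 1 ensures K ≥ 1, hence K ≤ K^j for
  -- j ≥ 1.
  set K : ℝ := 1 + ∑ i ∈ Finset.range (m + 1), |D i| with hK
  set K' : ℝ := ∑ i ∈ Finset.range (m + 1), |D' i| with hK'
  have hle : ∀ (D : ℕ → ℝ) (i : ℕ), i ≤ m → D i ≤ ∑ i ∈ Finset.range (m + 1), |D i| :=
    fun D i hi => (le_abs_self _).trans (Finset.single_le_sum (f := fun i => |D i|)
      (fun _ _ => abs_nonneg _) (Finset.mem_range.2 (by omega)))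
  have hK1 : 1 ≤ K := by
    have : 0 ≤ ∑ i ∈ Finset.range (m + 1), |D i| := Finset.sum_nonneg fun _ _ => abs_nonneg _
    linarith
  have hK'0 : 0 ≤ K' := Finset.sum_nonneg fun _ _ => abs_nonneg _
  refine ⟨∑ i ∈ Finset.range (m + 1), (m.choose i : ℝ) * K' * ((m - i).factorial * K ^ (m - i)),
    by positivity, fun B hB y hy => ?_⟩
  set S : ℝ := ∑ j ∈ Finset.range (m + 1), ‖iteratedFDeriv ℝ j B (ψ y)‖ with hS
  have hyV := h.subset hy
  rw [← iteratedFDerivWithin_of_isOpen m h.isOpen hyV]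
  have hBψ : ContDiffOn ℝ ∞ (fun y => B (ψ y)) V := hB.comp_contDiffOn h.contDiffOn
  refine (norm_iteratedFDerivWithin_mul_le h.contDiff.contDiffOn hBψ hVu hyV
    (n := m) (by exact_mod_cast le_top)).trans ?_
  rw [Finset.sum_mul]
  refine Finset.sum_le_sum fun i hi => ?_
  have him : i ≤ m := by have := Finset.mem_range.1 hi; omega
  have h1 : ‖iteratedFDerivWithin ℝ i χ V y‖ ≤ K' := (hD' i y hy).trans (hle D' i him)
  have h2 : ‖iteratedFDerivWithin ℝ (m - i) (fun y => B (ψ y)) V y‖ ≤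
      (m - i).factorial * S * K ^ (m - i) := by
    refine norm_iteratedFDerivWithin_comp_le (t := univ) (g := B) (f := ψ) (N := ∞)
      hB.contDiffOn h.contDiffOn (hnat _) uniqueDiffOn_univ hVu
      (mapsTo_univ _ _) hyV ?_ ?_
    · intro j hj
      rw [iteratedFDerivWithin_univ]
      exact Finset.single_le_sum (f := fun j => ‖iteratedFDeriv ℝ j B (ψ y)‖)
        (fun _ _ => norm_nonneg _) (Finset.mem_range.2 (by omega))
    · intro j hj1 hj
      have : ‖iteratedFDerivWithin ℝ j ψ V y‖ ≤ K := by
        have := (hD j y hy).trans (hle D j (by omega))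
        linarith
      exact this.trans (le_self_pow₀ hK1 (by omega))
  calc _ ≤ (m.choose i : ℝ) * K' * ((m - i).factorial * S * K ^ (m - i)) := by gcongr
    _ = _ := by ring

theorem lintegral_deriv_le (h : IsCutoffChange V ψ χ) (m : ℕ) : ∃ C : ℝ, 0 ≤ C ∧
    ∀ B : 𝓢(Eucl d, ℂ),
      ∫⁻ y, ‖iteratedFDeriv ℝ m (fun y => χ y * B (ψ y)) y‖ₑ ^ 2 ≤
        ENNReal.ofReal C *
          ∫⁻ ξ, ENNReal.ofReal ((1 + ‖ξ‖ ^ 2) ^ m) * ‖𝓕 (B : Eucl d → ℂ) ξ‖ₑ ^ 2 := by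
  obtain ⟨C₁, hC₁, h1⟩ := h.exists_norm_iteratedFDeriv_le m
  obtain ⟨C₂, hC₂, h2⟩ := h.lintegral_comp_le
  refine ⟨C₁ ^ 2 * (m + 1) * (C₂ * ∑ j ∈ Finset.range (m + 1),
    (d : ℝ) ^ j * (2 * Real.pi) ^ (2 * j)), by positivity, fun B => ?_⟩
  have hms := (isClosed_tsupport χ).measurableSet
  set I := ∫⁻ ξ, ENNReal.ofReal ((1 + ‖ξ‖ ^ 2) ^ m) * ‖𝓕 (B : Eucl d → ℂ) ξ‖ₑ ^ 2 with hI
  have hmeas : ∀ j, Measurable fun x => ‖iteratedFDeriv ℝ j B x‖ₑ ^ 2 := fun j => by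
    have hc : Continuous (iteratedFDeriv ℝ j B) :=
      (B.smooth ⊤).continuous_iteratedFDeriv (by exact_mod_cast le_top)
    exact hc.enorm.measurable.pow_const 2
  have h3 : ∀ j ∈ Finset.range (m + 1), ∫⁻ x, ‖iteratedFDeriv ℝ j B x‖ₑ ^ 2 ≤
      ENNReal.ofReal ((d : ℝ) ^ j * (2 * Real.pi) ^ (2 * j)) * I := by
    intro j hj
    refine (lintegral_iteratedFDeriv_sq_le B j).trans ?_
    rw [ENNReal.ofReal_mul (by positivity), mul_assoc]
    refine mul_le_mul' le_rfl ?_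
    rw [hI, ← lintegral_const_mul' _ _ ENNReal.ofReal_ne_top]
    refine lintegral_mono fun ξ => ?_
    rw [← mul_assoc, ← ENNReal.ofReal_mul (by positivity)]
    refine mul_le_mul' (ENNReal.ofReal_le_ofReal ?_) le_rfl
    rw [mul_pow]
    refine mul_le_mul_of_nonneg_left ?_ (by positivity)
    rw [pow_mul]
    calc (‖ξ‖ ^ 2) ^ j ≤ (1 + ‖ξ‖ ^ 2) ^ j := by gcongr; linarith
      _ ≤ (1 + ‖ξ‖ ^ 2) ^ m := pow_le_pow_right₀ (by nlinarith [sq_nonneg ‖ξ‖])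
          (by have := Finset.mem_range.1 hj; omega)
  calc ∫⁻ y, ‖iteratedFDeriv ℝ m (fun y => χ y * B (ψ y)) y‖ₑ ^ 2
      = ∫⁻ y in tsupport χ, ‖iteratedFDeriv ℝ m (fun y => χ y * B (ψ y)) y‖ₑ ^ 2 := by
        refine (setLIntegral_eq_of_support_subset ?_).symm
        intro y hy
        by_contra hyn
        apply hy
        have : y ∉ tsupport (iteratedFDeriv ℝ m fun y => χ y * B (ψ y)) := fun hy' =>
          hyn (closure_mono (Function.support_mul_subset_left χ _)
            (tsupport_iteratedFDeriv_subset (𝕜 := ℝ) m hy'))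
        simp [image_eq_zero_of_notMem_tsupport this]
    _ ≤ ∫⁻ y in tsupport χ, ENNReal.ofReal (C₁ ^ 2 * (m + 1)) *
          ∑ j ∈ Finset.range (m + 1), ‖iteratedFDeriv ℝ j B (ψ y)‖ₑ ^ 2 := by
        refine setLIntegral_mono' hms fun y hy => ?_
        simp_rw [← ofReal_norm, ← ENNReal.ofReal_pow (norm_nonneg _)]
        rw [← ENNReal.ofReal_sum_of_nonneg (fun _ _ => by positivity),
          ← ENNReal.ofReal_mul (by positivity)]
        refine ENNReal.ofReal_le_ofReal ?_
        refine (pow_le_pow_left₀ (norm_nonneg _) (h1 B (B.smooth ⊤) y hy) 2).trans ?_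
        rw [mul_pow, mul_assoc]
        refine mul_le_mul_of_nonneg_left ?_ (sq_nonneg _)
        refine sq_sum_le_card_mul_sum_sq.trans (le_of_eq ?_)
        simp
    _ ≤ ENNReal.ofReal (C₁ ^ 2 * (m + 1)) * (ENNReal.ofReal C₂ *
          ∫⁻ x, ∑ j ∈ Finset.range (m + 1), ‖iteratedFDeriv ℝ j B x‖ₑ ^ 2) := by
        rw [lintegral_const_mul' _ _ ENNReal.ofReal_ne_top]
        exact mul_le_mul' le_rfl
          (h2 fun x => ∑ j ∈ Finset.range (m + 1), ‖iteratedFDeriv ℝ j B x‖ₑ ^ 2)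
    _ ≤ ENNReal.ofReal (C₁ ^ 2 * (m + 1)) * (ENNReal.ofReal C₂ *
          ∑ j ∈ Finset.range (m + 1), ENNReal.ofReal ((d : ℝ) ^ j * (2 * Real.pi) ^ (2 * j)) * I) := by
        rw [lintegral_finsetSum _ (fun j _ => hmeas j)]
        exact mul_le_mul' le_rfl (mul_le_mul' le_rfl (Finset.sum_le_sum h3))
    _ = _ := by
        rw [← Finset.sum_mul, ← ENNReal.ofReal_sum_of_nonneg (fun _ _ => by positivity),
          ← mul_assoc, ← mul_assoc, mul_assoc (ENNReal.ofReal (C₁ ^ 2 * (m + 1))),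
          ← ENNReal.ofReal_mul hC₂, ← ENNReal.ofReal_mul (by positivity)]

/-- Chebyshev at order m: above R the weight (2π|ξ|)^{2m} is at least R^{2m}, and the H^m mass of
χ·(B∘ψ) is controlled by that of B. -/
theorem highFreq_mul_comp_le (h : IsCutoffChange V ψ χ) (m : ℕ) : ∃ C : ℝ, 0 ≤ C ∧
    ∀ (B : 𝓢(Eucl d, ℂ)) (R : ℝ), 0 < R →
      highFreq R (fun y => χ y * B (ψ y)) ≤ ENNReal.ofReal (C * (R ^ (2 * m))⁻¹) *
        ∫⁻ ξ, ENNReal.ofReal ((1 + ‖ξ‖ ^ 2) ^ m) * ‖𝓕 (B : Eucl d → ℂ) ξ‖ₑ ^ 2 := by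
  obtain ⟨C, hC, h1⟩ := h.lintegral_deriv_le m
  refine ⟨(d : ℝ) ^ m * C, by positivity, fun B R hR => ?_⟩
  have hc : HasCompactSupport fun y => χ y * B (ψ y) := h.supp.mul_right
  let f : 𝓢(Eucl d, ℂ) := hc.toSchwartzMap (h.contDiff_mul_comp (B.smooth ⊤))
  have h2 := lintegral_fourier_le_iteratedFDeriv f m
  calc highFreq R (fun y => χ y * B (ψ y))
      ≤ ∫⁻ ξ in {ξ | R < ‖ξ‖}, ENNReal.ofReal (R ^ (2 * m))⁻¹ *
        (ENNReal.ofReal ((2 * Real.pi * ‖ξ‖) ^ (2 * m)) * ‖𝓕 (f : Eucl d → ℂ) ξ‖ₑ ^ 2) := by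
        refine setLIntegral_mono' (measurableSet_lt measurable_const measurable_norm) fun ξ hξ => ?_
        rw [← mul_assoc, ← ENNReal.ofReal_mul (by positivity)]
        refine le_mul_of_one_le_left zero_le ?_
        rw [← ENNReal.ofReal_one]
        refine ENNReal.ofReal_le_ofReal ?_
        rw [inv_mul_eq_div, one_le_div (by positivity)]
        refine pow_le_pow_left₀ hR.le ?_ _
        have h3 : R < ‖ξ‖ := hξ
        nlinarith [Real.pi_gt_three]
    _ ≤ ENNReal.ofReal (R ^ (2 * m))⁻¹ *
        ∫⁻ ξ, ENNReal.ofReal ((2 * Real.pi * ‖ξ‖) ^ (2 * m)) * ‖𝓕 (f : Eucl d → ℂ) ξ‖ₑ ^ 2 := by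
        rw [lintegral_const_mul' _ _ ENNReal.ofReal_ne_top]
        exact mul_le_mul' le_rfl (lintegral_mono' Measure.restrict_le_self le_rfl)
    _ ≤ ENNReal.ofReal (R ^ (2 * m))⁻¹ * (ENNReal.ofReal ((d : ℝ) ^ m) * (ENNReal.ofReal C *
        ∫⁻ ξ, ENNReal.ofReal ((1 + ‖ξ‖ ^ 2) ^ m) * ‖𝓕 (B : Eucl d → ℂ) ξ‖ₑ ^ 2)) :=
        mul_le_mul' le_rfl (h2.trans (mul_le_mul' le_rfl (h1 B)))
    _ = _ := by
        rw [← mul_assoc, ← mul_assoc, ← ENNReal.ofReal_mul (by positivity),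
          ← ENNReal.ofReal_mul (by positivity)]
        congr 2; ring

end IsCutoffChange

end CoordinateChange
-- Coordinate changes on H^s for real s
section Interpolation
open FourierTransform SchwartzMap

variable {d : ℕ}

/-- Multiplication by a smooth cutoff after a smooth change of coordinates is bounded on `H^s`,
by interpolation between `L²` and an integer order `m > s`. -/
theorem IsCutoffChange.hsSq_le {V : Set (Eucl d)} {ψ : Eucl d → Eucl d} {χ : Eucl d → ℂ}
    (h : IsCutoffChange V ψ χ) {s : ℝ} (hs : 0 < s) : ∃ C : ℝ, 0 ≤ C ∧
    ∀ F : Eucl d → ℂ, BddCpt F → BddCpt (fun y => χ y * F (ψ y)) →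
      hsSq s (fun y => χ y * F (ψ y)) ≤ ENNReal.ofReal C * hsSq s F := by
  -- Strict inequality is needed: after weighting by R^{2s-1} the smooth part carries R^{-2(m-s)-1},
  -- which must be integrable at infinity.
  obtain ⟨m, hm⟩ := exists_nat_gt s
  obtain ⟨C₀, hC₀, hlp⟩ := exists_isLowPass d
  obtain ⟨C₁, hC₁⟩ := hsSq_le_lintegral_highFreq d hs
  obtain ⟨C₂, hC₂⟩ := lintegral_highFreq_le d hs (c := 1 / 2) (by norm_num)
  obtain ⟨C₃, hC₃⟩ := lintegral_lowFreq_le d hm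
  obtain ⟨C₄, hC₄, h4⟩ := h.highFreq_mul_comp_le m
  obtain ⟨C₅, hC₅, h5⟩ := h.lintegral_comp_le
  obtain ⟨X, hX⟩ := h.supp.exists_bound_of_continuous h.contDiff.continuous
  obtain ⟨A, hA0, hL2⟩ : ∃ A : ℝ, 0 ≤ A ∧ ∀ F : Eucl d → ℂ, ∫⁻ y, ‖χ y * F (ψ y)‖ₑ ^ 2 ≤
      ENNReal.ofReal A * ∫⁻ x, ‖F x‖ₑ ^ 2 := by
    refine ⟨X ^ 2 * C₅, by positivity, fun F => ?_⟩
    calc ∫⁻ y, ‖χ y * F (ψ y)‖ₑ ^ 2 = ∫⁻ y in tsupport χ, ‖χ y * F (ψ y)‖ₑ ^ 2 := by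
          refine (setLIntegral_eq_of_support_subset ?_).symm
          intro y hy
          by_contra hyn
          apply hy
          simp [image_eq_zero_of_notMem_tsupport hyn]
      _ ≤ ∫⁻ y in tsupport χ, ENNReal.ofReal (X ^ 2) * ‖F (ψ y)‖ₑ ^ 2 := by
          refine lintegral_mono fun y => ?_
          rw [enorm_mul, mul_pow, ← ofReal_norm, ← ENNReal.ofReal_pow (norm_nonneg _)]
          exact mul_le_mul' (ENNReal.ofReal_le_ofReal
            (pow_le_pow_left₀ (norm_nonneg _) (hX y) 2)) le_rfl
      _ ≤ ENNReal.ofReal (X ^ 2) * (ENNReal.ofReal C₅ * ∫⁻ x, ‖F x‖ₑ ^ 2) := by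
          rw [lintegral_const_mul' _ _ ENNReal.ofReal_ne_top]
          exact mul_le_mul' le_rfl (h5 fun x => ‖F x‖ₑ ^ 2)
      _ = _ := by rw [← mul_assoc, ← ENNReal.ofReal_mul (by positivity)]
  refine ⟨max C₁ 0 * (A + 2 * A * max C₂ 0 + 2 * C₄ * max C₃ 0), by positivity,
    fun F hF hTF => ?_⟩
  set H : Eucl d → ℂ := fun y => χ y * F (ψ y) with hH
  set Lo : ℝ → ℝ≥0∞ := fun R =>
    ∫⁻ ξ in {ξ | ‖ξ‖ < R}, ENNReal.ofReal ((1 + ‖ξ‖ ^ 2) ^ (m : ℝ)) * ‖𝓕 F ξ‖ₑ ^ 2 with hLo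
  have hplan : ∫⁻ ξ, ‖𝓕 H ξ‖ₑ ^ 2 ≤ ENNReal.ofReal A * hsSq s F := by
    rw [lintegral_enorm_fourier_sq hTF.integrable (hTF.memLp 2)]
    exact (hL2 F).trans (mul_le_mul' le_rfl (lintegral_sq_le_hsSq hs.le hF))
  -- At each threshold F is split at frequency R as in the K-method. The rough part F - B is
  -- measured in L², and the smooth part B in H^m with gain R^{-2m}.
  have hhigh : ∀ R ∈ Ioi (1 : ℝ), highFreq R H ≤ ENNReal.ofReal (2 * A) * highFreq (1 / 2 * R) F +
      ENNReal.ofReal (2 * C₄ * (R ^ (2 * m))⁻¹) * Lo R := by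
    intro R hR
    have hR0 : 0 < R := zero_lt_one.trans hR
    obtain ⟨B, hB⟩ := hlp F hF R hR0
    have hPc : HasCompactSupport fun y => χ y * B (ψ y) := h.supp.mul_right
    have hPs : ContDiff ℝ ∞ fun y => χ y * B (ψ y) := h.contDiff_mul_comp (B.smooth ⊤)
    refine (highFreq_le_of_approx hTF.integrable (hTF.memLp 2)
      (hPs.continuous.integrable_of_hasCompactSupport hPc)
      (hPs.continuous.memLp_of_hasCompactSupport hPc) R).trans (add_le_add ?_ ?_)
    · have h6 := hL2 (fun x => F x - B x)
      simp only [mul_sub] at h6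
      rw [← two_mul_ofReal, mul_assoc, show 1 / 2 * R = R / 2 by ring]
      exact mul_le_mul' le_rfl (h6.trans (mul_le_mul' le_rfl (hB.lintegral_sub_le hF)))
    · rw [mul_assoc, ← two_mul_ofReal, mul_assoc]
      refine mul_le_mul' le_rfl ((h4 B R hR0).trans (mul_le_mul' le_rfl ?_))
      simp only [hLo]
      rw [← lintegral_indicator (measurableSet_lt measurable_norm measurable_const)]
      refine lintegral_mono fun ξ => ?_
      by_cases hξ : ‖ξ‖ < R
      · simp only [indicator, mem_ofPred_eq, hξ, if_true, Real.rpow_natCast]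
        refine mul_le_mul' le_rfl ?_
        gcongr
        rw [enorm_le_iff_norm_le]
        exact hB.norm_fourier_le ξ
      · rw [hB.fourier_eq_zero ξ (not_lt.1 hξ)]
        simp
  have hint : ∫⁻ R in Ioi (1 : ℝ), ENNReal.ofReal (R ^ (2 * s - 1)) * highFreq R H ≤
      ENNReal.ofReal (2 * A * max C₂ 0 + 2 * C₄ * max C₃ 0) * hsSq s F := by
    calc _ ≤ ∫⁻ R in Ioi (1 : ℝ), (ENNReal.ofReal (2 * A) *
            (ENNReal.ofReal (R ^ (2 * s - 1)) * highFreq (1 / 2 * R) F) +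
          ENNReal.ofReal (2 * C₄) * (ENNReal.ofReal (R ^ (-(2 * (m - s)) - 1)) * Lo R)) := by
          refine setLIntegral_mono' measurableSet_Ioi fun R hR => ?_
          have hR0 : 0 < R := zero_lt_one.trans hR
          refine (mul_le_mul' le_rfl (hhigh R hR)).trans (le_of_eq ?_)
          rw [mul_add]
          congr 1
          · ring
          · rw [← mul_assoc, ← mul_assoc, ← ENNReal.ofReal_mul (by positivity),
              ← ENNReal.ofReal_mul (by positivity)]
            congr 2
            have e : R ^ (-(2 * (m - s)) - 1) = R ^ (2 * s - 1) / R ^ (2 * m) := by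
              rw [show -(2 * (m - s)) - 1 = (2 * s - 1) - ((2 * m : ℕ) : ℝ) by push_cast; ring,
                Real.rpow_sub hR0, Real.rpow_natCast]
            rw [e]
            ring
      _ = ENNReal.ofReal (2 * A) * (∫⁻ R in Ioi (1 : ℝ),
            ENNReal.ofReal (R ^ (2 * s - 1)) * highFreq (1 / 2 * R) F) +
          ENNReal.ofReal (2 * C₄) * ∫⁻ R in Ioi (1 : ℝ),
            (ENNReal.ofReal (R ^ (-(2 * (m - s)) - 1)) * Lo R) := by
          rw [lintegral_add_left, lintegral_const_mul' _ _ ENNReal.ofReal_ne_top,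
            lintegral_const_mul' _ _ ENNReal.ofReal_ne_top]
          exact ((measurable_rpowWeight _).mul
            (measurable_highFreq_comp_mul (by norm_num) F)).const_mul _
      _ ≤ ENNReal.ofReal (2 * A) * (ENNReal.ofReal (max C₂ 0) * hsSq s F) +
          ENNReal.ofReal (2 * C₄) * (ENNReal.ofReal (max C₃ 0) * hsSq s F) := by
          refine add_le_add (mul_le_mul' le_rfl ?_) (mul_le_mul' le_rfl ?_)
          · exact (hC₂ F hF.integrable).trans
              (mul_le_mul' (ENNReal.ofReal_le_ofReal (le_max_left _ _)) le_rfl)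
          · exact (hC₃ F hF.integrable).trans
              (mul_le_mul' (ENNReal.ofReal_le_ofReal (le_max_left _ _)) le_rfl)
      _ = _ := by
          rw [← mul_assoc, ← mul_assoc, ← add_mul, ← ENNReal.ofReal_mul (by positivity),
            ← ENNReal.ofReal_mul (by positivity),
            ← ENNReal.ofReal_add (by positivity) (by positivity)]
  refine (hC₁ H hTF.integrable).trans ?_
  calc _ ≤ ENNReal.ofReal (max C₁ 0) * (ENNReal.ofReal A * hsSq s F +
        ENNReal.ofReal (2 * A * max C₂ 0 + 2 * C₄ * max C₃ 0) * hsSq s F) :=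
        mul_le_mul' (ENNReal.ofReal_le_ofReal (le_max_left _ _)) (add_le_add hplan hint)
    _ = _ := by
        rw [← add_mul, ← ENNReal.ofReal_add (by positivity) (by positivity), ← mul_assoc,
          ← ENNReal.ofReal_mul (by positivity)]
        congr 2; ring

end Interpolation
-- Continuity and positivity of the Riemannian density
section Density

variable {d : ℕ} {M : Type*} [TopologicalSpace M] [ChartedSpace (Eucl d) M]
  [IsManifold (𝓡 d) ∞ M]

omit [IsManifold (𝓡 d) ∞ M] in
theorem mdifferentiable_of_mem_maximalAtlas {e : OpenPartialHomeomorph M (Eucl d)}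
    (he : e ∈ IsManifold.maximalAtlas (𝓡 d) ∞ M) : e.MDifferentiable (𝓡 d) (𝓡 d) :=
  ⟨(contMDiffOn_of_mem_maximalAtlas he).mdifferentiableOn (by norm_num),
    (contMDiffOn_symm_of_mem_maximalAtlas he).mdifferentiableOn (by norm_num)⟩

/-- The field is the tangent map of the inverse chart applied to a constant section, and the tangent
map of a smooth map is continuous. -/
theorem continuousOn_coordVector {e : OpenPartialHomeomorph M (Eucl d)}
    (he : e ∈ IsManifold.maximalAtlas (𝓡 d) ∞ M) (i : Fin d) :
    ContinuousOn (fun y => (⟨e.symm y, coordVector e y i⟩ : TangentBundle (𝓡 d) M)) e.target := by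
  have h1 := (contMDiffOn_symm_of_mem_maximalAtlas he).continuousOn_tangentMapWithin
    (by norm_num) e.open_target.uniqueMDiffOn
  have h2 : Continuous fun y : Eucl d =>
      (⟨y, (EuclideanSpace.single i (1 : ℝ) : Eucl d)⟩ : TangentBundle (𝓡 d) (Eucl d)) :=
    (tangentBundleModelSpaceHomeomorph (𝓡 d)).symm.continuous.comp
      (Continuous.prodMk continuous_id continuous_const)
  refine (h1.comp h2.continuousOn fun y hy => hy).congr fun y hy => ?_
  simp only [Function.comp, tangentMapWithin, coordVector]
  rw [mfderivWithin_of_isOpen e.open_target hy]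

theorem continuousOn_metricMatrix (g : Metric d M) {e : OpenPartialHomeomorph M (Eucl d)}
    (he : e ∈ IsManifold.maximalAtlas (𝓡 d) ∞ M) (i j : Fin d) :
    ContinuousOn (fun y => metricMatrix g e y i j) e.target := by
  intro y hy
  have hg : ContMDiffWithinAt (𝓡 d) ((𝓡 d).prod 𝓘(ℝ, Eucl d →L[ℝ] Eucl d →L[ℝ] ℝ)) 0
      (fun y => Bundle.TotalSpace.mk' (Eucl d →L[ℝ] Eucl d →L[ℝ] ℝ)
        (E := fun x : M => TangentSpace (𝓡 d) x →L[ℝ] TangentSpace (𝓡 d) x →L[ℝ] ℝ)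
        (e.symm y) (g.inner (e.symm y))) e.target y :=
    ((g.contMDiff.of_le (m := 0) (by simp)).contMDiffAt.comp_contMDiffWithinAt y
      ((contMDiffOn_symm_of_mem_maximalAtlas he y hy).of_le (by simp)))
  have hv : ∀ k, ContMDiffWithinAt (𝓡 d) ((𝓡 d).prod 𝓘(ℝ, Eucl d)) 0
      (fun y => Bundle.TotalSpace.mk' (Eucl d) (E := fun x : M => TangentSpace (𝓡 d) x)
        (e.symm y) (coordVector e y k)) e.target y := fun k =>
    (contMDiffOn_zero_iff.2 (continuousOn_coordVector he k)) y hy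
  have key := ContMDiffWithinAt.clm_bundle_apply₂ (E₃ := fun _ : M => ℝ) hg (hv i) (hv j)
  have := ((Bundle.contMDiffWithinAt_totalSpace).1 key).2.continuousWithinAt
  simpa [metricMatrix] using! this

theorem continuousOn_volDensity (g : Metric d M) {e : OpenPartialHomeomorph M (Eucl d)}
    (he : e ∈ IsManifold.maximalAtlas (𝓡 d) ∞ M) :
    ContinuousOn (volDensity g e) e.target := by
  refine Real.continuous_sqrt.comp_continuousOn ?_
  rw [continuousOn_iff_continuous_domRestrict]
  refine Continuous.matrix_det ?_
  refine continuous_matrix fun i j => ?_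
  exact continuousOn_iff_continuous_domRestrict.1 (continuousOn_metricMatrix g he i j)

/-- The metric matrix is the Gram matrix of the coordinate vectors, which are independent because
the derivative of the inverse chart is injective. -/
theorem volDensity_pos (g : Metric d M) {e : OpenPartialHomeomorph M (Eucl d)}
    (he : e ∈ IsManifold.maximalAtlas (𝓡 d) ∞ M) {y : Eucl d} (hy : y ∈ e.target) :
    0 < volDensity g e y := by
  refine Real.sqrt_pos.2 ?_
  refine Matrix.PosDef.det_pos (Matrix.PosDef.of_dotProduct_mulVec_pos ?_ ?_)
  · ext i j
    simp [metricMatrix, Matrix.conjTranspose_apply, g.symm (e.symm y) (coordVector e y j)]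
  · intro x hx
    let L : Eucl d →L[ℝ] TangentSpace (𝓡 d) (e.symm y) := mfderiv (𝓡 d) (𝓡 d) e.symm y
    have hL : Function.Injective L :=
      (mdifferentiable_of_mem_maximalAtlas he).symm.mfderiv_injective hy
    have hx' : L (WithLp.toLp 2 x) ≠ 0 := by
      intro h0
      have := hL (h0.trans (map_zero L).symm)
      apply hx
      simpa using congrArg WithLp.ofLp this
    have hpos := g.pos (e.symm y) _ hx'
    have e1 : L (WithLp.toLp 2 x) = ∑ i, x i • coordVector e y i := by
      conv_lhs => rw [eucl_eq_sum (WithLp.toLp 2 x)]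
      rw [map_sum]
      simp only [map_smul]
      rfl
    rw [e1] at hpos
    simp only [map_sum, map_smul, FunLike.coe_sum, FunLike.coe_smul,
      Finset.sum_apply, Pi.smul_apply, smul_eq_mul] at hpos
    simp only [dotProduct, Matrix.mulVec, metricMatrix, Matrix.of_apply, Finset.mul_sum,
      star_trivial]
    refine hpos.trans_eq ?_
    simp only [Finset.mul_sum]
    rw [Finset.sum_comm]
    refine Finset.sum_congr rfl fun i _ => Finset.sum_congr rfl fun j _ => ?_
    ring

end Density
-- The Riemannian measure compared with Lebesgue measure in charts
section Volume

variable {d : ℕ} {M : Type*} [TopologicalSpace M] [ChartedSpace (Eucl d) M]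
  [IsManifold (𝓡 d) ∞ M]

namespace ChartPartition

variable (A : ChartPartition d M)

/-- The image in the `i`-th chart of the support of the `i`-th function of the partition. -/
def cell (i : Fin A.n) : Set (Eucl d) := A.chart i '' tsupport (A.h i)

theorem tsupport_subset (i : Fin A.n) : tsupport (A.h i) ⊆ (A.chart i).source := A.subordinate i

theorem cell_subset_target (i : Fin A.n) : A.cell i ⊆ (A.chart i).target := by
  rintro _ ⟨x, hx, rfl⟩
  exact (A.chart i).map_source (A.tsupport_subset i hx)

theorem isCompact_cell [CompactSpace M] (i : Fin A.n) : IsCompact (A.cell i) :=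
  (isClosed_tsupport (A.h i)).isCompact.image_of_continuousOn
    ((A.chart i).continuousOn.mono (A.tsupport_subset i))

theorem mem_cell_of_ne_zero {i : Fin A.n} {y : Eucl d} (hy : y ∈ (A.chart i).target)
    (h : A.h i ((A.chart i).symm y) ≠ 0) : y ∈ A.cell i :=
  ⟨(A.chart i).symm y, subset_tsupport _ h, (A.chart i).right_inv hy⟩

theorem sum_h (x : M) : ∑ i, A.h i x = 1 := by
  have := A.h.sum_eq_one (mem_univ x)
  rwa [finsum_eq_sum_of_fintype] at this

/-- The density of the `i`-th piece of the Riemannian measure. -/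
noncomputable def density (g : Metric d M) (i : Fin A.n) (y : Eucl d) : ℝ :=
  A.h i ((A.chart i).symm y) * volDensity g (A.chart i) y

theorem continuousOn_h_symm (i : Fin A.n) :
    ContinuousOn (fun y => A.h i ((A.chart i).symm y)) (A.chart i).target :=
  (A.h i).contMDiff.continuous.comp_continuousOn (A.chart i).continuousOn_symm

theorem continuousOn_density (g : Metric d M) (i : Fin A.n) :
    ContinuousOn (A.density g i) (A.chart i).target :=
  (A.continuousOn_h_symm i).mul (continuousOn_volDensity g (A.chart_mem i))

theorem aemeasurable_density (g : Metric d M) (i : Fin A.n) :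
    AEMeasurable (fun y => ENNReal.ofReal (A.density g i y))
      (volume.restrict (A.chart i).target) :=
  ((A.continuousOn_density g i).aemeasurable (A.chart i).open_target.measurableSet).ennreal_ofReal

/-- The measure on the `i`-th chart whose image is the `i`-th piece of the Riemannian measure. -/
noncomputable def chartMeasure (g : Metric d M) (i : Fin A.n) : Measure (Eucl d) :=
  (volume.restrict (A.chart i).target).withDensity fun y => ENNReal.ofReal (A.density g i y)

theorem chartMeasure_absolutelyContinuous (g : Metric d M) (i : Fin A.n) :
    A.chartMeasure g i ≪ volume.restrict (A.chart i).target :=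
  withDensity_absolutelyContinuous _ _

/-- The density vanishes off the compact cell and is continuous, hence bounded, on it. -/
theorem isFiniteMeasure_chartMeasure [CompactSpace M] (g : Metric d M) (i : Fin A.n) :
    IsFiniteMeasure (A.chartMeasure g i) := by
  have hK := A.isCompact_cell i
  obtain ⟨C, hC⟩ := hK.exists_bound_of_continuousOn
    ((A.continuousOn_density g i).mono (A.cell_subset_target i))
  refine isFiniteMeasure_withDensity (ne_of_lt ?_)
  calc ∫⁻ y in (A.chart i).target, ENNReal.ofReal (A.density g i y)
      ≤ ∫⁻ y in (A.chart i).target, (A.cell i).indicator (fun _ => ENNReal.ofReal C) y := by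
        refine setLIntegral_mono' (A.chart i).open_target.measurableSet fun y hy => ?_
        by_cases h : y ∈ A.cell i
        · rw [indicator_of_mem h]
          exact ENNReal.ofReal_le_ofReal ((le_abs_self _).trans (hC y h))
        · have : A.h i ((A.chart i).symm y) = 0 := by
            by_contra h0
            exact h (A.mem_cell_of_ne_zero hy h0)
          simp [density, this]
    _ ≤ ∫⁻ y, (A.cell i).indicator (fun _ => ENNReal.ofReal C) y :=
        lintegral_mono' Measure.restrict_le_self le_rfl
    _ = ENNReal.ofReal C * volume (A.cell i) := by
        rw [lintegral_indicator_const hK.measurableSet]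
    _ < ⊤ := ENNReal.mul_lt_top ENNReal.ofReal_lt_top hK.measure_lt_top

variable [MeasurableSpace M]

theorem riemVolume_eq (g : Metric d M) :
    riemVolume g A = ∑ i, Measure.map (A.chart i).symm (A.chartMeasure g i) := rfl

variable [BorelSpace M]

theorem aemeasurable_symm (i : Fin A.n) :
    AEMeasurable (A.chart i).symm (volume.restrict (A.chart i).target) :=
  (A.chart i).continuousOn_symm.aemeasurable (A.chart i).open_target.measurableSet

theorem aemeasurable_symm' (g : Metric d M) (i : Fin A.n) :
    AEMeasurable (A.chart i).symm (A.chartMeasure g i) :=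
  (A.aemeasurable_symm i).mono_ac (A.chartMeasure_absolutelyContinuous g i)

omit [BorelSpace M] in
theorem isFiniteMeasure_riemVolume [CompactSpace M] (g : Metric d M) :
    IsFiniteMeasure (riemVolume g A) := by
  have := fun i => A.isFiniteMeasure_chartMeasure g i
  rw [riemVolume_eq]
  infer_instance

/-- A property that holds almost everywhere on `M` holds almost everywhere in the charts, where the
functions of the partition do not vanish. -/
theorem ae_chart (g : Metric d M) {P : M → Prop} (hP : ∀ᵐ x ∂riemVolume g A, P x) (i : Fin A.n) :
    ∀ᵐ y : Eucl d, y ∈ (A.chart i).target → A.h i ((A.chart i).symm y) ≠ 0 →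
      P ((A.chart i).symm y) := by
  have h1 : ∀ᵐ x ∂Measure.map (A.chart i).symm (A.chartMeasure g i), P x := by
    refine ae_mono ?_ hP
    rw [riemVolume_eq]
    exact Finset.single_le_sum (f := fun i => Measure.map (A.chart i).symm (A.chartMeasure g i))
      (fun _ _ => Measure.zero_le _) (Finset.mem_univ i)
  have h2 := ae_of_ae_map (A.aemeasurable_symm' g i) h1
  rw [chartMeasure, ae_withDensity_iff' (A.aemeasurable_density g i),
    ae_restrict_iff' (A.chart i).open_target.measurableSet] at h2
  filter_upwards [h2] with y hy hyt hyh
  -- Where h_i ≠ 0 the density h_i√det g is positive, so null sets of the weighted measure are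
  -- Lebesgue null there.
  refine hy hyt (ne_of_gt (ENNReal.ofReal_pos.2 ?_))
  exact mul_pos ((A.h.nonneg i _).lt_of_ne' hyh) (volDensity_pos g (A.chart_mem i) hyt)

/-- Where h_i = 0 both pieces vanish, so the region that the measure does not see is harmless. This
lets H^s norms be computed with any representative. -/
theorem localPiece_congr_ae (g : Metric d M) {f f' : M → ℂ} (h : f =ᵐ[riemVolume g A] f')
    (i : Fin A.n) : localPiece A f i =ᵐ[volume] localPiece A f' i := by
  filter_upwards [A.ae_chart g h i] with y hy
  by_cases hyt : y ∈ (A.chart i).target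
  · simp only [localPiece, indicator_of_mem hyt]
    by_cases h0 : A.h i ((A.chart i).symm y) = 0
    · simp [h0]
    · rw [hy hyt h0]
  · simp [localPiece, indicator_of_notMem hyt]

theorem fourier_congr_ae {F G : Eucl d → ℂ} (h : F =ᵐ[volume] G) :
    FourierTransform.fourier F = FourierTransform.fourier G := by
  ext ξ
  rw [Real.fourier_eq, Real.fourier_eq]
  exact integral_congr_ae (h.mono fun x hx => by simp only [hx])

theorem hsNorm_congr_ae (g : Metric d M) (s : ℝ) {f f' : M → ℂ} (h : f =ᵐ[riemVolume g A] f') :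
    hsNorm A s f = hsNorm A s f' := by
  simp only [hsNorm, euclHsNorm, fourier_congr_ae (A.localPiece_congr_ae g h _)]

/-- The inverse of the `i`-th chart is measurable after a modification off its domain. -/
theorem exists_measurable_symm (i : Fin A.n) : ∃ σ : Eucl d → M, Measurable σ ∧
    EqOn σ (A.chart i).symm (A.chart i).target := by
  classical
  refine ⟨(A.chart i).target.piecewise (A.chart i).symm fun _ => (A.chart i).symm 0, ?_,
    piecewise_eqOn _ _ _⟩
  exact (A.chart i).continuousOn_symm.measurable_piecewise continuousOn_const
    (A.chart i).open_target.measurableSet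

/-- Joint measurability of the local pieces of a family of functions. -/
theorem measurable_chart_pull {Ω : Type*} [MeasurableSpace Ω] {f : Ω → M → ℂ}
    (hf : Measurable fun z : Ω × M => f z.1 z.2) {θ : M → ℝ} (hθ : Continuous θ) (i : Fin A.n) :
    Measurable fun z : Ω × Eucl d => (A.chart i).target.indicator
      (fun y => (θ ((A.chart i).symm y) : ℂ) * f z.1 ((A.chart i).symm y)) z.2 := by
  obtain ⟨σ, hσ, hσe⟩ := A.exists_measurable_symm i
  have h1 : Measurable fun z : Ω × Eucl d => (θ (σ z.2) : ℂ) * f z.1 (σ z.2) :=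
    (Complex.measurable_ofReal.comp (hθ.measurable.comp (hσ.comp measurable_snd))).mul
      (hf.comp (measurable_fst.prodMk (hσ.comp measurable_snd)))
  have h2 : MeasurableSet (Prod.snd ⁻¹' (A.chart i).target : Set (Ω × Eucl d)) :=
    measurable_snd (A.chart i).open_target.measurableSet
  convert h1.indicator h2 using 1
  ext z
  by_cases hz : z.2 ∈ (A.chart i).target
  · rw [indicator_of_mem hz, indicator_of_mem (show z ∈ Prod.snd ⁻¹' (A.chart i).target from hz),
      hσe hz]
  · rw [indicator_of_notMem hz, indicator_of_notMem (show z ∉ Prod.snd ⁻¹' _ from hz)]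

theorem measurable_localPiece {Ω : Type*} [MeasurableSpace Ω] {f : Ω → M → ℂ}
    (hf : Measurable fun z : Ω × M => f z.1 z.2) (i : Fin A.n) :
    Measurable fun z : Ω × Eucl d => localPiece A (f z.1) i z.2 :=
  A.measurable_chart_pull hf (A.h i).contMDiff.continuous i

theorem measurable_localPiece' {f : M → ℂ} (hf : Measurable f) (i : Fin A.n) :
    Measurable (localPiece A f i) :=
  (A.measurable_localPiece (Ω := Unit) (f := fun _ => f) (hf.comp measurable_snd) i).comp
    (measurable_const.prodMk measurable_id : Measurable fun y : Eucl d => ((), y))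

/-- Both the piece and the Riemannian density contain the factor h_i. Comparing with Lebesgue
measure thus requires a lower bound only for √det g, which compactness of the cell supplies. -/
theorem integrable_localPiece [CompactSpace M] (g : Metric d M) {f : M → ℂ}
    (hf : Integrable f (riemVolume g A)) (i : Fin A.n) : Integrable (localPiece A f i) := by
  have hfm := hf.aestronglyMeasurable.aemeasurable
  set f' := hfm.mk f with hf'
  have hff' : f =ᵐ[riemVolume g A] f' := hfm.ae_eq_mk
  refine Integrable.congr ?_ (A.localPiece_congr_ae g hff' i).symm
  have hm : Measurable f' := hfm.measurable_mk
  refine ⟨(A.measurable_localPiece' hm i).aestronglyMeasurable, ?_⟩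
  have ht := (A.chart i).open_target.measurableSet
  -- a lower bound for the density
  obtain ⟨c, hc, hcb⟩ : ∃ c : ℝ, 0 < c ∧ ∀ y ∈ A.cell i, c ≤ volDensity g (A.chart i) y := by
    rcases (A.cell i).eq_empty_or_nonempty with he | hne
    · exact ⟨1, one_pos, by simp [he]⟩
    obtain ⟨y₀, hy₀, hmin⟩ := (A.isCompact_cell i).exists_isMinOn hne
      ((continuousOn_volDensity g (A.chart_mem i)).mono (A.cell_subset_target i))
    exact ⟨_, volDensity_pos g (A.chart_mem i) (A.cell_subset_target i hy₀), fun y hy => hmin hy⟩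
  have hfin : ∫⁻ y, ‖f' ((A.chart i).symm y)‖ₑ ∂A.chartMeasure g i < ⊤ := by
    rw [← lintegral_map' (f := fun x => ‖f' x‖ₑ) hm.enorm.aemeasurable (A.aemeasurable_symm' g i)]
    refine lt_of_le_of_lt (lintegral_mono' (?_ : _ ≤ riemVolume g A) le_rfl) (hf.congr hff').2
    rw [riemVolume_eq]
    exact Finset.single_le_sum (f := fun i => Measure.map (A.chart i).symm (A.chartMeasure g i))
      (fun _ _ => Measure.zero_le _) (Finset.mem_univ i)
  have hm' : AEMeasurable (fun y => ‖f' ((A.chart i).symm y)‖ₑ) (A.chartMeasure g i) :=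
    hm.enorm.comp_aemeasurable (A.aemeasurable_symm' g i)
  rw [chartMeasure, lintegral_withDensity_eq_lintegral_mul₀' (A.aemeasurable_density g i) hm']
    at hfin
  have hle : ∫⁻ y, ‖localPiece A f' i y‖ₑ ≤ ENNReal.ofReal c⁻¹ *
      ∫⁻ y in (A.chart i).target, (((fun y => ENNReal.ofReal (A.density g i y)) *
        fun y => ‖f' ((A.chart i).symm y)‖ₑ) y) := by
    rw [← lintegral_const_mul' _ _ ENNReal.ofReal_ne_top, ← lintegral_indicator ht]
    refine lintegral_mono fun y => ?_
    by_cases hy : y ∈ (A.chart i).target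
    · simp only [localPiece, indicator_of_mem hy, Pi.mul_apply]
      rw [enorm_mul, ← mul_assoc, ← ENNReal.ofReal_mul (by positivity), ← ofReal_norm]
      refine mul_le_mul' (ENNReal.ofReal_le_ofReal ?_) le_rfl
      rw [Complex.norm_real, Real.norm_of_nonneg (A.h.nonneg i _)]
      by_cases h0 : A.h i ((A.chart i).symm y) = 0
      · simp [density, h0]
      · have := hcb y (A.mem_cell_of_ne_zero hy h0)
        have hh := A.h.nonneg i ((A.chart i).symm y)
        rw [density, inv_mul_eq_div, le_div_iff₀ hc]
        gcongr
    · simp [localPiece, indicator_of_notMem hy]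
  exact hle.trans_lt (ENNReal.mul_lt_top ENNReal.ofReal_lt_top hfin)

end ChartPartition

end Volume
-- Changing charts on M and the tame estimate for |f|²
section Cutoff
open FourierTransform

variable {d : ℕ} {M : Type*} [TopologicalSpace M]

/-- The function `θ ∘ e⁻¹`, extended by zero. -/
noncomputable def pullCutoff (e : OpenPartialHomeomorph M (Eucl d)) (θ : M → ℝ) : Eucl d → ℂ :=
  e.target.indicator fun y => ((θ (e.symm y) : ℝ) : ℂ)

theorem support_pullCutoff_subset (e : OpenPartialHomeomorph M (Eucl d)) (θ : M → ℝ) :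
    Function.support (pullCutoff e θ) ⊆ e '' tsupport θ := by
  intro y hy
  by_cases hyt : y ∈ e.target
  · refine ⟨e.symm y, subset_tsupport θ ?_, e.right_inv hyt⟩
    intro h0
    apply hy
    simp [pullCutoff, indicator_of_mem hyt, h0]
  · exact absurd (indicator_of_notMem hyt _) hy

theorem tsupport_pullCutoff_subset [CompactSpace M] {e : OpenPartialHomeomorph M (Eucl d)}
    {θ : M → ℝ} (h : tsupport θ ⊆ e.source) : tsupport (pullCutoff e θ) ⊆ e '' tsupport θ := by
  refine closure_minimal (support_pullCutoff_subset e θ) (IsCompact.isClosed ?_)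
  exact (isClosed_tsupport θ).isCompact.image_of_continuousOn (e.continuousOn.mono h)

theorem hasCompactSupport_pullCutoff [CompactSpace M] {e : OpenPartialHomeomorph M (Eucl d)}
    {θ : M → ℝ} (h : tsupport θ ⊆ e.source) : HasCompactSupport (pullCutoff e θ) :=
  HasCompactSupport.intro
    ((isClosed_tsupport θ).isCompact.image_of_continuousOn (e.continuousOn.mono h))
    fun _ hy => Function.notMem_support.1 fun h' => hy (support_pullCutoff_subset e θ h')

variable [ChartedSpace (Eucl d) M]

/-- The chart image of the support is compact, hence closed in ℝ^d; the extension by zero is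
therefore smooth across the boundary of the chart's target. -/
theorem contDiff_pullCutoff [CompactSpace M] {e : OpenPartialHomeomorph M (Eucl d)}
    (he : e ∈ IsManifold.maximalAtlas (𝓡 d) ∞ M) {θ : M → ℝ} (hθ : ContMDiff (𝓡 d) 𝓘(ℝ) ∞ θ)
    (h : tsupport θ ⊆ e.source) : ContDiff ℝ ∞ (pullCutoff e θ) := by
  rw [contDiff_iff_contDiffAt]
  intro y
  by_cases hy : y ∈ tsupport (pullCutoff e θ)
  · obtain ⟨x, hx, rfl⟩ := tsupport_pullCutoff_subset h hy
    have hyt : e x ∈ e.target := e.map_source (h hx)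
    have h1 : ContMDiffOn (𝓡 d) 𝓘(ℝ) ∞ (θ ∘ e.symm) e.target :=
      hθ.comp_contMDiffOn (contMDiffOn_symm_of_mem_maximalAtlas he)
    have h2 : ContDiffAt ℝ ∞ (θ ∘ e.symm) (e x) :=
      (contMDiffOn_iff_contDiffOn.1 h1).contDiffAt (e.open_target.mem_nhds hyt)
    have h3 : ContDiffAt ℝ ∞ (fun y => ((θ (e.symm y) : ℝ) : ℂ)) (e x) :=
      Complex.ofRealCLM.contDiff.contDiffAt.comp (e x) h2
    refine h3.congr_of_eventuallyEq ?_
    filter_upwards [e.open_target.mem_nhds hyt] with z hz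
    simp [pullCutoff, indicator_of_mem hz]
  · have : pullCutoff e θ =ᶠ[𝓝 y] fun _ => 0 := notMem_tsupport_iff_eventuallyEq.1 hy
    exact contDiffAt_const.congr_of_eventuallyEq this

theorem isCutoffChange_transition [CompactSpace M]
    {e e' : OpenPartialHomeomorph M (Eucl d)}
    (he : e ∈ IsManifold.maximalAtlas (𝓡 d) ∞ M) (he' : e' ∈ IsManifold.maximalAtlas (𝓡 d) ∞ M)
    {θ : M → ℝ} (hθ : ContMDiff (𝓡 d) 𝓘(ℝ) ∞ θ) (h : tsupport θ ⊆ e.source)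
    (h' : tsupport θ ⊆ e'.source) :
    IsCutoffChange (e.symm.trans e').source (e.symm.trans e') (pullCutoff e θ) := by
  have hsm : ∀ {e e' : OpenPartialHomeomorph M (Eucl d)},
      e ∈ IsManifold.maximalAtlas (𝓡 d) ∞ M → e' ∈ IsManifold.maximalAtlas (𝓡 d) ∞ M →
      ContDiffOn ℝ ∞ (e.symm.trans e') (e.symm.trans e').source := by
    intro e e' he he'
    rw [← contMDiffOn_iff_contDiffOn]
    exact (contMDiffOn_of_mem_maximalAtlas he').comp
      ((contMDiffOn_symm_of_mem_maximalAtlas he).mono fun y hy => hy.1) fun y hy => hy.2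
  set φ := e.symm.trans e' with hφ
  refine ⟨φ.open_source, hsm he he', φ.injOn, fun y hy => ?_, contDiff_pullCutoff he hθ h,
    hasCompactSupport_pullCutoff h, ?_⟩
  · have hd : DifferentiableAt ℝ φ y :=
      ((hsm he he').contDiffAt (φ.open_source.mem_nhds hy)).differentiableAt (by norm_num)
    have hsymm : φ.symm = e'.symm.trans e := by
      rw [hφ, OpenPartialHomeomorph.trans_symm_eq_symm_trans_symm,
        OpenPartialHomeomorph.symm_symm]
    have hd' : DifferentiableAt ℝ φ.symm (φ y) := by
      have := hsm he' he
      rw [← hsymm] at this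
      exact (this.contDiffAt (φ.symm.open_source.mem_nhds (φ.map_source hy))).differentiableAt
        (by norm_num)
    -- Differentiating φ⁻¹∘φ = id shows that the Jacobian determinant of the transition map is
    -- invertible.
    have hc := fderiv_comp y hd' hd
    have hid : (φ.symm ∘ φ) =ᶠ[𝓝 y] id := by
      filter_upwards [φ.open_source.mem_nhds hy] with z hz using φ.left_inv hz
    rw [hid.fderiv_eq, fderiv_id] at hc
    have hdet := congrArg ContinuousLinearMap.det hc
    intro h0
    have h1 : ((fderiv ℝ φ.symm (φ y)).comp (fderiv ℝ φ y)).det =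
        (fderiv ℝ φ.symm (φ y)).det * (fderiv ℝ φ y).det := LinearMap.det_comp _ _
    rw [h1, h0, mul_zero] at hdet
    have h2 : (ContinuousLinearMap.id ℝ (Eucl d)).det = 1 := LinearMap.det_id
    rw [h2] at hdet
    exact one_ne_zero hdet
  · intro y hy
    obtain ⟨x, hx, rfl⟩ := tsupport_pullCutoff_subset h hy
    refine ⟨e.map_source (h hx), ?_⟩
    change e.symm (e x) ∈ e'.source
    rw [e.left_inv (h hx)]
    exact h' hx

variable [IsManifold (𝓡 d) ∞ M]

/-- Smooth functions `η i` which are `1` on the support of `A.h i` and supported in the domain of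
the `i`-th chart. -/
theorem ChartPartition.exists_cutoff [T2Space M] [CompactSpace M] (A : ChartPartition d M)
    (i : Fin A.n) : ∃ η : M → ℝ, ContMDiff (𝓡 d) 𝓘(ℝ) ∞ η ∧ (∀ x, 0 ≤ η x ∧ η x ≤ 1) ∧
      tsupport η ⊆ (A.chart i).source ∧ ∀ x, A.h i x ≠ 0 → η x = 1 := by
  obtain ⟨W, hWo, hKW, hWs⟩ := normal_exists_closure_subset (isClosed_tsupport (A.h i))
    (A.chart i).open_source (A.tsupport_subset i)
  obtain ⟨f, hf0, hf1, hf⟩ := exists_contMDiffMap_zero_one_of_isClosed (n := ⊤) (𝓡 d)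
    hWo.isClosed_compl (isClosed_tsupport (A.h i))
    (disjoint_left.2 fun x hx hx' => hx (hKW hx'))
  refine ⟨f, f.contMDiff, fun x => hf x, ?_, fun x hx => hf1 (subset_tsupport _ hx)⟩
  refine (closure_mono ?_).trans hWs
  intro x hx
  by_contra hxW
  exact hx (hf0 hxW)

theorem tsupport_mul_subset (a b : M → ℝ) : tsupport (fun x => a x * b x) ⊆ tsupport a ∩ tsupport b :=
  subset_inter (closure_mono (Function.support_mul_subset_left a b))
    (closure_mono (Function.support_mul_subset_right a b))

theorem fourier_sum_of_integrable {ι : Type*} (S : Finset ι) {F : ι → Eucl d → ℂ}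
    (hF : ∀ i ∈ S, Integrable (F i)) (ξ : Eucl d) :
    𝓕 (fun x => ∑ i ∈ S, F i x) ξ = ∑ i ∈ S, 𝓕 (F i) ξ := by
  simp only [Real.fourier_eq, Finset.smul_sum]
  exact integral_finsetSum _ fun i hi => (Real.fourierIntegral_convergent_iff ξ).2 (hF i hi)

theorem hsSq_sum_le {ι : Type*} (S : Finset ι) (s : ℝ) {F : ι → Eucl d → ℂ}
    (hF : ∀ i ∈ S, Integrable (F i)) :
    hsSq s (fun x => ∑ i ∈ S, F i x) ≤ ENNReal.ofReal S.card * ∑ i ∈ S, hsSq s (F i) := by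
  have hw : Measurable fun ξ : Eucl d => ENNReal.ofReal ((1 + ‖ξ‖ ^ 2) ^ s) :=
    ((measurable_const.add (measurable_norm.pow_const 2)).pow_const s).ennreal_ofReal
  simp only [hsSq]
  rw [← lintegral_finsetSum S (f := fun i ξ => ENNReal.ofReal ((1 + ‖ξ‖ ^ 2) ^ s) *
    ‖𝓕 (F i) ξ‖ₑ ^ 2) fun i hi => hw.mul (measurable_enorm_fourier_sq (hF i hi)), ← lintegral_const_mul' _ _ ENNReal.ofReal_ne_top]
  refine lintegral_mono fun ξ => ?_
  rw [fourier_sum_of_integrable S hF, ← Finset.mul_sum, mul_left_comm]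
  refine mul_le_mul' le_rfl ?_
  simp_rw [← ofReal_norm, ← ENNReal.ofReal_pow (norm_nonneg _)]
  rw [← ENNReal.ofReal_sum_of_nonneg (fun _ _ => by positivity),
    ← ENNReal.ofReal_mul (by positivity)]
  refine ENNReal.ofReal_le_ofReal ?_
  exact (pow_le_pow_left₀ (norm_nonneg _) (norm_sum_le _ _) 2).trans sq_sum_le_card_mul_sum_sq

theorem hsNorm_sq (A : ChartPartition d M) (s : ℝ) (f : M → ℂ) :
    hsNorm A s f ^ 2 = ∑ i, hsSq s (localPiece A f i) := by
  simp only [hsNorm, euclHsNorm_sq]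
  rw [← ENNReal.rpow_natCast, ← ENNReal.rpow_mul]
  norm_num

variable [MeasurableSpace M] [BorelSpace M]

theorem ChartPartition.bddCpt_chart_pull [CompactSpace M] (A : ChartPartition d M) {f : M → ℂ}
    (hf : Measurable f) {N : ℝ} (hN : ∀ x, ‖f x‖ ≤ N) (i : Fin A.n) {θ : M → ℝ}
    (hθ : Continuous θ) (hθ1 : ∀ x, 0 ≤ θ x ∧ θ x ≤ 1) (hθs : tsupport θ ⊆ (A.chart i).source) :
    BddCpt ((A.chart i).target.indicator fun y =>
      (θ ((A.chart i).symm y) : ℂ) * f ((A.chart i).symm y)) ∧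
    ∀ y, ‖(A.chart i).target.indicator (fun y =>
      (θ ((A.chart i).symm y) : ℂ) * f ((A.chart i).symm y)) y‖ ≤ N := by
  have hb : ∀ y, ‖(A.chart i).target.indicator (fun y =>
      (θ ((A.chart i).symm y) : ℂ) * f ((A.chart i).symm y)) y‖ ≤ N := by
    intro y
    have hN0 : 0 ≤ N := (norm_nonneg _).trans (hN ((A.chart i).symm y))
    by_cases hy : y ∈ (A.chart i).target
    · rw [indicator_of_mem hy, norm_mul, Complex.norm_real, Real.norm_of_nonneg (hθ1 _).1]
      calc _ ≤ 1 * N := mul_le_mul (hθ1 _).2 (hN _) (norm_nonneg _) zero_le_one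
        _ = N := one_mul N
    · rw [indicator_of_notMem hy, norm_zero]; exact hN0
  refine ⟨⟨?_, ⟨N, hb⟩, ?_⟩, hb⟩
  · exact ((A.measurable_chart_pull (Ω := Unit) (f := fun _ => f) (hf.comp measurable_snd) hθ i).comp
      (measurable_const.prodMk measurable_id :
        Measurable fun y : Eucl d => ((), y))).aestronglyMeasurable
  · have h1 := (hasCompactSupport_pullCutoff hθs).mul_right
      (f' := fun y => f ((A.chart i).symm y))
    convert! h1 using 1
    ext y
    by_cases hy : y ∈ (A.chart i).target <;> simp [pullCutoff, hy]

/-- The tame estimate `‖|f|²‖_{H^s} ≤ C ‖f‖_{L^∞} ‖f‖_{H^s}` on the manifold. -/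
theorem ChartPartition.exists_hsNorm_sq_normSq_le [T2Space M] [CompactSpace M]
    (A : ChartPartition d M) {s : ℝ} (hs : 0 < s) : ∃ C : ℝ, 0 ≤ C ∧
    ∀ (f : M → ℂ) (N : ℝ), Measurable f → (∀ x, ‖f x‖ ≤ N) →
      hsNorm A s (fun x => ((‖f x‖ ^ 2 : ℝ) : ℂ)) ^ 2 ≤
        ENNReal.ofReal (C * N ^ 2) * hsNorm A s f ^ 2 := by
  choose η hηs hη01 hηsupp hη1 using A.exists_cutoff
  obtain ⟨C₁, hC₁, hprod⟩ := hsSq_mul_conj_le d hs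
  have hmulsmooth : ∀ i j, ContMDiff (𝓡 d) 𝓘(ℝ) ∞ fun x => η i x * η j x := fun i j =>
    (hηs i).mul (hηs j)
  have htrans := fun i j => (isCutoffChange_transition (A.chart_mem i) (A.chart_mem j)
    (hmulsmooth i j) ((tsupport_mul_subset _ _).trans (inter_subset_left.trans (hηsupp i)))
    ((tsupport_mul_subset _ _).trans (inter_subset_right.trans (hηsupp j)))).hsSq_le hs
  choose C₂ hC₂ hT using htrans
  set K : ℝ := ∑ i, ∑ j, C₂ i j with hK
  have hK0 : 0 ≤ K := Finset.sum_nonneg fun i _ => Finset.sum_nonneg fun j _ => hC₂ i j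
  have hC₂K : ∀ i j, C₂ i j ≤ K := fun i j =>
    (Finset.single_le_sum (f := fun j => C₂ i j) (fun j _ => hC₂ i j) (Finset.mem_univ j)).trans
      (Finset.single_le_sum (f := fun i => ∑ j, C₂ i j)
        (fun i _ => Finset.sum_nonneg fun j _ => hC₂ i j) (Finset.mem_univ i))
  refine ⟨C₁ * (1 + A.n * (A.n * K)), by positivity, fun f N hf hN => ?_⟩
  have hh1 : ∀ i x, 0 ≤ A.h i x ∧ A.h i x ≤ 1 := fun i x => ⟨A.h.nonneg i x, A.h.le_one i x⟩
  have hP : ∀ i, BddCpt (localPiece A f i) ∧ ∀ y, ‖localPiece A f i y‖ ≤ N := fun i =>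
    A.bddCpt_chart_pull hf hN i (A.h i).contMDiff.continuous (hh1 i) (A.tsupport_subset i)
  -- The enlarged piece η_i f: since η_i = 1 where h_i ≠ 0, h_i|f|² factors as (h_i f)·conj(η_i f),
  -- with no square root of h_i.
  set Q : Fin A.n → Eucl d → ℂ := fun i => (A.chart i).target.indicator fun y =>
    (η i ((A.chart i).symm y) : ℂ) * f ((A.chart i).symm y) with hQ
  have hQb : ∀ i, BddCpt (Q i) ∧ ∀ y, ‖Q i y‖ ≤ N := fun i =>
    A.bddCpt_chart_pull hf hN i (hηs i).continuous (hη01 i) (hηsupp i)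
  -- T i j is the part η_i h_j f of Q i, obtained by transporting the j-th local piece to the i-th
  -- chart; the factor η_j is free because it is 1 where h_j ≠ 0.
  set T : Fin A.n → Fin A.n → Eucl d → ℂ := fun i j y =>
    pullCutoff (A.chart i) (fun x => η i x * η j x) y *
      localPiece A f j (((A.chart i).symm.trans (A.chart j)) y) with hTdef
  have hTeq : ∀ i j, T i j = (A.chart i).target.indicator fun y =>
      ((η i ((A.chart i).symm y) * A.h j ((A.chart i).symm y) : ℝ) : ℂ) *
        f ((A.chart i).symm y) := by
    intro i j
    ext y
    by_cases hy : y ∈ (A.chart i).target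
    · set x := (A.chart i).symm y with hx
      by_cases hxj : x ∈ (A.chart j).source
      · have hjt : (A.chart j) x ∈ (A.chart j).target := (A.chart j).map_source hxj
        have e1 : localPiece A f j (((A.chart i).symm.trans (A.chart j)) y) =
            (A.h j x : ℂ) * f x := by
          change localPiece A f j ((A.chart j) x) = _
          rw [localPiece, indicator_of_mem hjt, (A.chart j).left_inv hxj]
        simp only [hTdef]
        rw [e1, pullCutoff, indicator_of_mem hy, indicator_of_mem hy, ← hx]
        by_cases h0 : A.h j x = 0
        · simp [h0]
        · rw [hη1 j x h0]; push_cast; ring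
      -- Off the domain of chart j the transition map has no meaning, and η_j kills its value. This
      -- is why the cutoff is η_i η_j rather than η_i.
      · have hη0 : η j x = 0 := by
          by_contra h0
          exact hxj (hηsupp j (subset_tsupport _ h0))
        have hh0 : A.h j x = 0 := by
          by_contra h0
          exact hxj (A.tsupport_subset j (subset_tsupport _ h0))
        simp only [hTdef]
        rw [pullCutoff, indicator_of_mem hy, indicator_of_mem hy, ← hx, hη0, hh0]
        simp
    · simp only [hTdef]
      rw [pullCutoff, indicator_of_notMem hy, indicator_of_notMem hy, zero_mul]
  have hTb : ∀ i j, BddCpt (T i j) := by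
    intro i j
    rw [hTeq]
    refine (A.bddCpt_chart_pull hf hN i (θ := fun x => η i x * A.h j x)
      ((hηs i).continuous.mul (A.h j).contMDiff.continuous) (fun x => ⟨?_, ?_⟩) ?_).1
    · exact mul_nonneg (hη01 i x).1 (hh1 j x).1
    · exact mul_le_one₀ (hη01 i x).2 (hh1 j x).1 (hh1 j x).2
    · exact (tsupport_mul_subset _ _).trans (inter_subset_left.trans (hηsupp i))
  have hQsum : ∀ i, Q i = fun y => ∑ j, T i j y := by
    intro i
    ext y
    simp only [hTeq]
    by_cases hy : y ∈ (A.chart i).target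
    · simp only [hQ, indicator_of_mem hy]
      rw [← Finset.sum_mul, ← Complex.ofReal_sum, ← Finset.mul_sum, A.sum_h, mul_one]
    · simp [hQ, indicator_of_notMem hy]
  -- Summing over the partition of unity bounds the enlarged piece by the H^s norm of f: one factor
  -- n comes from Cauchy–Schwarz over j, and K dominates all transition constants.
  have hQle : ∀ i, hsSq s (Q i) ≤ ENNReal.ofReal (A.n * K) * hsNorm A s f ^ 2 := by
    intro i
    rw [hQsum, hsNorm_sq]
    refine (hsSq_sum_le _ s fun j _ => (hTb i j).integrable).trans ?_
    rw [ENNReal.ofReal_mul (by positivity), mul_assoc, Finset.card_fin]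
    refine mul_le_mul' le_rfl ?_
    rw [Finset.mul_sum]
    refine Finset.sum_le_sum fun j _ => ?_
    exact (hT i j _ (hP j).1 (hTb i j)).trans
      (mul_le_mul' (ENNReal.ofReal_le_ofReal (hC₂K i j)) le_rfl)
  have hpiece : ∀ i, localPiece A (fun x => ((‖f x‖ ^ 2 : ℝ) : ℂ)) i =
      fun y => localPiece A f i y * starRingEnd ℂ (Q i y) := by
    intro i
    ext y
    by_cases hy : y ∈ (A.chart i).target
    · simp only [localPiece, hQ, indicator_of_mem hy]
      set x := (A.chart i).symm y
      by_cases h0 : A.h i x = 0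
      · simp [h0]
      · rw [hη1 i x h0]
        simp only [Complex.ofReal_one, one_mul, Complex.ofReal_pow]
        rw [mul_assoc, Complex.mul_conj']
    · simp [localPiece, hQ, indicator_of_notMem hy]
  calc hsNorm A s (fun x => ((‖f x‖ ^ 2 : ℝ) : ℂ)) ^ 2
      = ∑ i, hsSq s (fun y => localPiece A f i y * starRingEnd ℂ (Q i y)) := by
        rw [hsNorm_sq]
        simp_rw [hpiece]
    _ ≤ ∑ i, ENNReal.ofReal (C₁ * N ^ 2) * (hsSq s (localPiece A f i) +
          ENNReal.ofReal (A.n * K) * hsNorm A s f ^ 2) := by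
        refine Finset.sum_le_sum fun i _ => ?_
        exact (hprod _ _ N (hP i).1 (hQb i).1 (hP i).2 (hQb i).2).trans
          (mul_le_mul' le_rfl (add_le_add le_rfl (hQle i)))
    _ = ENNReal.ofReal (C₁ * N ^ 2) * (hsNorm A s f ^ 2 +
          ENNReal.ofReal A.n * (ENNReal.ofReal (A.n * K) * hsNorm A s f ^ 2)) := by
        rw [← Finset.mul_sum, Finset.sum_add_distrib, ← hsNorm_sq]
        simp
    _ = _ := by
        rw [← mul_assoc (ENNReal.ofReal A.n), ← ENNReal.ofReal_mul (by positivity),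
          ← one_add_mul, ← ENNReal.ofReal_one, ← ENNReal.ofReal_add zero_le_one (by positivity),
          ← mul_assoc, ← ENNReal.ofReal_mul (by positivity)]
        congr 2; ring

end Cutoff
-- H^s norms of integrals depending on a parameter
section HsIntegral
open FourierTransform

variable {d : ℕ}

theorem hsSq_add_le (s : ℝ) {F G : Eucl d → ℂ} (hF : Integrable F) (hG : Integrable G) :
    hsSq s (fun y => F y + G y) ≤ 2 * hsSq s F + 2 * hsSq s G := by
  have hw : Measurable fun ξ : Eucl d => ENNReal.ofReal ((1 + ‖ξ‖ ^ 2) ^ s) := by fun_prop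
  simp only [hsSq]
  have hm : Measurable fun ξ : Eucl d =>
      2 * (ENNReal.ofReal ((1 + ‖ξ‖ ^ 2) ^ s) * ‖𝓕 F ξ‖ₑ ^ 2) :=
    (hw.mul (measurable_enorm_fourier_sq hF)).const_mul 2
  rw [← lintegral_const_mul' _ _ (by norm_num), ← lintegral_const_mul' _ _ (by norm_num),
    ← lintegral_add_left hm]
  refine lintegral_mono fun ξ => ?_
  have h : 𝓕 (fun y => F y + G y) ξ = 𝓕 F ξ + 𝓕 G ξ := by
    simp only [Real.fourier_eq, smul_add]
    exact integral_add ((Real.fourierIntegral_convergent_iff ξ).2 hF)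
      ((Real.fourierIntegral_convergent_iff ξ).2 hG)
  simp only [h]
  rw [mul_left_comm 2, mul_left_comm 2, ← mul_add]
  exact mul_le_mul' le_rfl (enorm_add_sq_le _ _)

theorem hsSq_const_mul (s : ℝ) (c : ℂ) (F : Eucl d → ℂ) :
    hsSq s (fun y => c * F y) = ‖c‖ₑ ^ 2 * hsSq s F := by
  simp only [hsSq]
  rw [← lintegral_const_mul' _ _ (by simp)]
  congr 1 with ξ
  have h : 𝓕 (fun y => c * F y) ξ = c * 𝓕 F ξ := by
    simp only [Real.fourier_eq]
    rw [← integral_const_mul]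
    congr 1 with y
    exact (mul_smul_comm (Real.fourierChar (-inner ℝ y ξ)) c (F y)).symm
  rw [h, enorm_mul, mul_pow, mul_left_comm]

theorem sq_lintegral_le {Ω : Type*} [MeasurableSpace Ω] (ρ : Measure Ω) {f : Ω → ℝ≥0∞}
    (hf : AEMeasurable f ρ) : (∫⁻ l, f l ∂ρ) ^ 2 ≤ ρ univ * ∫⁻ l, f l ^ 2 ∂ρ := by
  have h := ENNReal.lintegral_mul_le_Lp_mul_Lq ρ Real.HolderConjugate.two_two hf
    (aemeasurable_const (b := (1 : ℝ≥0∞)))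
  simp only [Pi.mul_apply, mul_one, ENNReal.one_rpow, lintegral_one] at h
  calc (∫⁻ l, f l ∂ρ) ^ 2 ≤ ((∫⁻ l, f l ^ (2 : ℝ) ∂ρ) ^ (1 / 2 : ℝ) * ρ univ ^ (1 / 2 : ℝ)) ^ 2 :=
        pow_le_pow_left' h 2
    _ = _ := by
        rw [mul_pow, ← ENNReal.rpow_natCast, ← ENNReal.rpow_mul, ← ENNReal.rpow_natCast,
          ← ENNReal.rpow_mul]
        norm_num
        rw [mul_comm]

theorem measurable_uncurry_fourier {Ω : Type*} [MeasurableSpace Ω] {P : Ω → Eucl d → ℂ}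
    (hP : Measurable fun z : Ω × Eucl d => P z.1 z.2) :
    Measurable fun z : Ω × Eucl d => 𝓕 (P z.1) z.2 := by
  have h1 : Measurable fun w : (Ω × Eucl d) × Eucl d =>
      (Real.fourierChar (-inner ℝ w.2 w.1.2) : ℂ) * P w.1.1 w.2 := by
    refine Measurable.mul ?_ (hP.comp ((measurable_fst.comp measurable_fst).prodMk measurable_snd))
    have hc : Continuous fun t : ℝ => (Real.fourierChar t : ℂ) :=
      continuous_subtype_val.comp Real.continuous_fourierChar
    have hi : Measurable fun w : (Ω × Eucl d) × Eucl d => -inner ℝ w.2 w.1.2 :=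
      (measurable_snd.inner (measurable_snd.comp measurable_fst)).neg
    exact hc.measurable.comp hi
  have h2 : ∀ z : Ω × Eucl d, 𝓕 (P z.1) z.2 =
      ∫ y, (Real.fourierChar (-inner ℝ y z.2) : ℂ) * P z.1 y := fun z => Real.fourier_eq _ _
  simp_rw [h2]
  exact h1.stronglyMeasurable.integral_prod_right'.measurable

theorem measurable_hsSq {Ω : Type*} [MeasurableSpace Ω] (s : ℝ) {P : Ω → Eucl d → ℂ}
    (hP : Measurable fun z : Ω × Eucl d => P z.1 z.2) : Measurable fun l => hsSq s (P l) := by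
  have hw : Measurable fun ξ : Eucl d => ENNReal.ofReal ((1 + ‖ξ‖ ^ 2) ^ s) := by fun_prop
  exact Measurable.lintegral_prod_right' ((hw.comp measurable_snd).mul
    ((measurable_uncurry_fourier hP).enorm.pow_const 2))

theorem fourier_integral_eq {Ω : Type*} [MeasurableSpace Ω] (ρ : Measure Ω) [SFinite ρ]
    {P : Ω → Eucl d → ℂ} (hP : Measurable fun z : Ω × Eucl d => P z.1 z.2)
    (hPi : Integrable (fun z : Ω × Eucl d => P z.1 z.2) (ρ.prod volume)) (ξ : Eucl d) :
    𝓕 (fun y => ∫ l, P l y ∂ρ) ξ = ∫ l, 𝓕 (P l) ξ ∂ρ := by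
  have h2 : ∀ F : Eucl d → ℂ, 𝓕 F ξ = ∫ y, (Real.fourierChar (-inner ℝ y ξ) : ℂ) * F y :=
    fun F => Real.fourier_eq _ _
  simp_rw [h2]
  have hc : Measurable fun y : Eucl d => (Real.fourierChar (-inner ℝ y ξ) : ℂ) := by
    have h3 : Continuous fun t : ℝ => (Real.fourierChar t : ℂ) :=
      continuous_subtype_val.comp Real.continuous_fourierChar
    exact h3.measurable.comp (measurable_id.inner measurable_const).neg
  rw [integral_integral_swap]
  · congr 1 with y
    exact (integral_const_mul _ _).symm
  · refine Integrable.mono' hPi.norm ((hc.comp measurable_snd).mul hP).aestronglyMeasurable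
      (Eventually.of_forall fun z => ?_)
    exact (norm_mul _ _).trans_le (by rw [Circle.norm_coe, one_mul])

/-- The square of the `H^s` norm of an integral with respect to a finite measure. -/
theorem hsSq_integral_le {Ω : Type*} [MeasurableSpace Ω] (s : ℝ) (ρ : Measure Ω) [IsFiniteMeasure ρ]
    {P : Ω → Eucl d → ℂ} (hP : Measurable fun z : Ω × Eucl d => P z.1 z.2)
    (hPi : Integrable (fun z : Ω × Eucl d => P z.1 z.2) (ρ.prod volume)) :
    hsSq s (fun y => ∫ l, P l y ∂ρ) ≤ ρ univ * ∫⁻ l, hsSq s (P l) ∂ρ := by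
  have hF := measurable_uncurry_fourier hP
  have hw : Measurable fun ξ : Eucl d => ENNReal.ofReal ((1 + ‖ξ‖ ^ 2) ^ s) := by fun_prop
  have hm : Measurable fun z : Ω × Eucl d =>
      ENNReal.ofReal ((1 + ‖z.2‖ ^ 2) ^ s) * ‖𝓕 (P z.1) z.2‖ₑ ^ 2 :=
    (hw.comp measurable_snd).mul (hF.enorm.pow_const 2)
  have hswap : ∫⁻ l, hsSq s (P l) ∂ρ =
      ∫⁻ ξ, ∫⁻ l, ENNReal.ofReal ((1 + ‖ξ‖ ^ 2) ^ s) * ‖𝓕 (P l) ξ‖ₑ ^ 2 ∂ρ := by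
    exact lintegral_lintegral_swap (f := fun l ξ =>
      ENNReal.ofReal ((1 + ‖ξ‖ ^ 2) ^ s) * ‖𝓕 (P l) ξ‖ₑ ^ 2) hm.aemeasurable
  rw [hswap, ← lintegral_const_mul' _ _ (measure_ne_top _ _), hsSq]
  refine lintegral_mono fun ξ => ?_
  have hξ : Measurable fun l => 𝓕 (P l) ξ :=
    Measurable.of_uncurry_right (f := fun l ξ => 𝓕 (P l) ξ) hF
  have hc : ∫⁻ l, ENNReal.ofReal ((1 + ‖ξ‖ ^ 2) ^ s) * ‖𝓕 (P l) ξ‖ₑ ^ 2 ∂ρ =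
      ENNReal.ofReal ((1 + ‖ξ‖ ^ 2) ^ s) * ∫⁻ l, ‖𝓕 (P l) ξ‖ₑ ^ 2 ∂ρ :=
    lintegral_const_mul' _ _ ENNReal.ofReal_ne_top
  -- Fubini takes the Fourier transform inside the parameter integral; Cauchy–Schwarz against the
  -- constant 1 then produces the total mass of ρ.
  have hb : ‖𝓕 (fun y => ∫ l, P l y ∂ρ) ξ‖ₑ ^ 2 ≤ ρ univ * ∫⁻ l, ‖𝓕 (P l) ξ‖ₑ ^ 2 ∂ρ := by
    rw [fourier_integral_eq ρ hP hPi]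
    exact (pow_le_pow_left' (enorm_integral_le_lintegral_enorm _) 2).trans
      (sq_lintegral_le ρ hξ.enorm.aemeasurable)
  calc _ ≤ ENNReal.ofReal ((1 + ‖ξ‖ ^ 2) ^ s) * (ρ univ * ∫⁻ l, ‖𝓕 (P l) ξ‖ₑ ^ 2 ∂ρ) :=
        mul_le_mul' le_rfl hb
    _ = _ := by rw [mul_left_comm, ← hc]

variable {M : Type*} [TopologicalSpace M] [ChartedSpace (Eucl d) M] [IsManifold (𝓡 d) ∞ M]

theorem localPiece_add (A : ChartPartition d M) (f f' : M → ℂ) (i : Fin A.n) :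
    localPiece A (fun x => f x + f' x) i = fun y => localPiece A f i y + localPiece A f' i y := by
  ext y
  by_cases hy : y ∈ (A.chart i).target <;> simp [localPiece, hy, mul_add]

theorem localPiece_const_mul (A : ChartPartition d M) (c : ℂ) (f : M → ℂ) (i : Fin A.n) :
    localPiece A (fun x => c * f x) i = fun y => c * localPiece A f i y := by
  ext y
  by_cases hy : y ∈ (A.chart i).target <;> simp [localPiece, hy, mul_left_comm]

theorem localPiece_integral {Ω : Type*} [MeasurableSpace Ω] (A : ChartPartition d M) (ρ : Measure Ω)
    (U : Ω → M → ℂ) (i : Fin A.n) :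
    localPiece A (fun x => ∫ l, U l x ∂ρ) i = fun y => ∫ l, localPiece A (U l) i y ∂ρ := by
  ext y
  by_cases hy : y ∈ (A.chart i).target
  · simp [localPiece, hy, integral_const_mul]
  · simp [localPiece, hy]

theorem norm_localPiece_le (A : ChartPartition d M) {f : M → ℂ} {N : ℝ} (hN : ∀ x, ‖f x‖ ≤ N)
    (i : Fin A.n) (y : Eucl d) :
    ‖localPiece A f i y‖ ≤ (A.cell i).indicator (fun _ => N) y := by
  by_cases hy : y ∈ (A.chart i).target
  · rw [localPiece, indicator_of_mem hy, norm_mul, Complex.norm_real,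
      Real.norm_of_nonneg (A.h.nonneg i _)]
    by_cases h0 : A.h i ((A.chart i).symm y) = 0
    · rw [h0, zero_mul]
      exact indicator_nonneg (fun _ _ => (norm_nonneg _).trans (hN ((A.chart i).symm y))) y
    · rw [indicator_of_mem (A.mem_cell_of_ne_zero hy h0)]
      calc _ ≤ 1 * N := mul_le_mul (A.h.le_one i _) (hN _) (norm_nonneg _) zero_le_one
        _ = N := one_mul N
  · rw [localPiece, indicator_of_notMem hy, norm_zero,
      indicator_of_notMem fun h => hy (A.cell_subset_target i h)]

theorem hsNorm_const_mul_sq (A : ChartPartition d M) (s : ℝ) (c : ℂ) (f : M → ℂ) :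
    hsNorm A s (fun x => c * f x) ^ 2 = ‖c‖ₑ ^ 2 * hsNorm A s f ^ 2 := by
  simp only [hsNorm_sq, localPiece_const_mul, hsSq_const_mul, Finset.mul_sum]

variable [MeasurableSpace M] [BorelSpace M] [CompactSpace M]

theorem hsNorm_add_sq_le (g : Metric d M) (A : ChartPartition d M) (s : ℝ) {f f' : M → ℂ}
    (hf : Integrable f (riemVolume g A)) (hf' : Integrable f' (riemVolume g A)) :
    hsNorm A s (fun x => f x + f' x) ^ 2 ≤ 2 * hsNorm A s f ^ 2 + 2 * hsNorm A s f' ^ 2 := by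
  simp only [hsNorm_sq, localPiece_add, Finset.mul_sum, ← Finset.sum_add_distrib]
  exact Finset.sum_le_sum fun i _ =>
    hsSq_add_le s (A.integrable_localPiece g hf i) (A.integrable_localPiece g hf' i)

/-- The square of the `H^s(M)` norm of an integral with respect to a finite measure. -/
theorem hsNorm_integral_sq_le {Ω : Type*} [MeasurableSpace Ω] (A : ChartPartition d M) (s : ℝ)
    (ρ : Measure Ω) [IsFiniteMeasure ρ] {U : Ω → M → ℂ}
    (hU : Measurable fun z : Ω × M => U z.1 z.2) {b : Ω → ℝ} (hb : Integrable b ρ)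
    (hUb : ∀ l x, ‖U l x‖ ≤ b l) :
    hsNorm A s (fun x => ∫ l, U l x ∂ρ) ^ 2 ≤ ρ univ * ∫⁻ l, hsNorm A s (U l) ^ 2 ∂ρ := by
  simp only [hsNorm_sq, localPiece_integral]
  rw [lintegral_finsetSum _ fun i _ => measurable_hsSq s (A.measurable_localPiece hU i),
    Finset.mul_sum]
  refine Finset.sum_le_sum fun i _ => hsSq_integral_le s ρ (A.measurable_localPiece hU i) ?_
  -- The pieces are dominated on the product by b(l) times the indicator of a compact cell, which is
  -- the integrability Fubini needs.
  have hc : Integrable ((A.cell i).indicator fun _ : Eucl d => (1 : ℝ)) :=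
    (integrable_indicator_iff (A.isCompact_cell i).measurableSet).2
      (integrableOn_const (A.isCompact_cell i).measure_lt_top.ne)
  refine (hb.mul_prod hc).mono' (A.measurable_localPiece hU i).aestronglyMeasurable
    (Eventually.of_forall fun z => ?_)
  refine (norm_localPiece_le A (hUb z.1) i z.2).trans (le_of_eq ?_)
  by_cases hz : z.2 ∈ A.cell i <;> simp [hz]

end HsIntegral
-- Regularity of a(t) w + b(t) ∫₀ᵗ G
section TimeIntegral

/-- The moving endpoint is put into an indicator of a measurable set of triples, one for each
orientation of the interval; parametrised integration then preserves measurability. -/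
theorem measurable_intervalIntegral {M : Type*} [MeasurableSpace M] {G : ℝ → M → ℂ}
    (hG : Measurable fun z : ℝ × M => G z.1 z.2) :
    Measurable fun z : ℝ × M => ∫ l in (0 : ℝ)..z.1, G l z.2 := by
  have hG' : Measurable fun w : (ℝ × M) × ℝ => G w.2 w.1.2 :=
    hG.comp (measurable_snd.prodMk (measurable_snd.comp measurable_fst))
  have h1 : MeasurableSet {w : (ℝ × M) × ℝ | 0 < w.2 ∧ w.2 ≤ w.1.1} :=
    (measurableSet_lt measurable_const measurable_snd).inter
      (measurableSet_le measurable_snd (measurable_fst.comp measurable_fst))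
  have h2 : MeasurableSet {w : (ℝ × M) × ℝ | w.1.1 < w.2 ∧ w.2 ≤ 0} :=
    (measurableSet_lt (measurable_fst.comp measurable_fst) measurable_snd).inter
      (measurableSet_le measurable_snd measurable_const)
  have m1 := (hG'.indicator h1).stronglyMeasurable.integral_prod_right' (ν := volume)
  have m2 := (hG'.indicator h2).stronglyMeasurable.integral_prod_right' (ν := volume)
  convert (m1.sub m2).measurable using 1
  ext z
  rw [intervalIntegral, ← integral_indicator measurableSet_Ioc,
    ← integral_indicator measurableSet_Ioc]
  rfl

theorem integrable_of_bound {M : Type*} [MeasurableSpace M] {G : ℝ → M → ℂ}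
    (hG : Measurable fun z : ℝ × M => G z.1 z.2) {B : ℝ → ℝ} (hB : Integrable B)
    (hGB : ∀ l x, ‖G l x‖ ≤ B l) (x : M) : Integrable fun l => G l x :=
  hB.mono' (hG.comp measurable_prodMk_right).aestronglyMeasurable
    (Eventually.of_forall fun l => hGB l x)

theorem norm_intervalIntegral_le {M : Type*} {G : ℝ → M → ℂ} {B : ℝ → ℝ} (hB : Integrable B)
    (hGB : ∀ l x, ‖G l x‖ ≤ B l) (a b : ℝ) (x : M) :
    ‖∫ l in a..b, G l x‖ ≤ |∫ l in a..b, B l| :=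
  intervalIntegral.norm_integral_le_abs_of_norm_le (Eventually.of_forall fun l => hGB l x)
    hB.intervalIntegrable

theorem abs_intervalIntegral_le_integral {B : ℝ → ℝ} (hB : Integrable B) (hB0 : ∀ l, 0 ≤ B l)
    (a b : ℝ) : |∫ l in a..b, B l| ≤ ∫ l, B l := by
  rw [intervalIntegral.abs_integral_eq_abs_integral_uIoc,
    abs_of_nonneg (integral_nonneg hB0)]
  exact setIntegral_le_integral hB (Eventually.of_forall hB0)

variable {d : ℕ} {M : Type*} [TopologicalSpace M] [ChartedSpace (Eucl d) M]
  [IsManifold (𝓡 d) ∞ M] [MeasurableSpace M] [BorelSpace M] [CompactSpace M]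

/-- The factor |b - a|, the mass in Cauchy–Schwarz, is what yields continuity in time with values in
H^s. -/
theorem hsNorm_intervalIntegral_sq_le (A : ChartPartition d M) (s : ℝ) {G : ℝ → M → ℂ}
    (hG : Measurable fun z : ℝ × M => G z.1 z.2) {B : ℝ → ℝ} (hB : Integrable B)
    (hGB : ∀ l x, ‖G l x‖ ≤ B l) (a b : ℝ) :
    hsNorm A s (fun x => ∫ l in a..b, G l x) ^ 2 ≤
      ENNReal.ofReal |b - a| * ∫⁻ l, hsNorm A s (G l) ^ 2 := by
  have h1 : (fun x => ∫ l in a..b, G l x) = fun x =>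
      (if a ≤ b then (1 : ℂ) else -1) * ∫ l in uIoc a b, G l x := by
    ext x
    rw [intervalIntegral.intervalIntegral_eq_integral_uIoc]
    split_ifs <;> simp
  have h2 : ‖(if a ≤ b then (1 : ℂ) else -1)‖ₑ = 1 := by split_ifs <;> simp
  have : IsFiniteMeasure (volume.restrict (uIoc a b)) := ⟨by simp [uIoc]⟩
  rw [h1, hsNorm_const_mul_sq, h2, one_pow, one_mul]
  refine (hsNorm_integral_sq_le A s _ hG hB.restrict hGB).trans (mul_le_mul' (le_of_eq ?_) ?_)
  · simp [uIoc, max_sub_min_eq_abs]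
  · exact lintegral_mono' Measure.restrict_le_self le_rfl

/-- Bounds on the data of the ordinary differential equation solved by `v(t, x)`. -/
structure IsDuhamelData (A : ChartPartition d M) (s : ℝ) (w : M → ℂ) (N : ℝ) (G : ℝ → M → ℂ)
    (B : ℝ → ℝ) : Prop where
  meas_w : Measurable w
  norm_w_le : ∀ x, ‖w x‖ ≤ N
  hs_w : hsNorm A s w < ⊤
  meas_G : Measurable fun z : ℝ × M => G z.1 z.2
  integrable_B : Integrable B
  norm_G_le : ∀ l x, ‖G l x‖ ≤ B l
  hs_G : ∫⁻ l, hsNorm A s (G l) ^ 2 < ⊤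

/-- The function `a(t) w(x) + b(t) ∫_0^t G(l, x) dl`. -/
noncomputable def duhamel (a b : ℝ → ℂ) (w : M → ℂ) (G : ℝ → M → ℂ) (t : ℝ) (x : M) : ℂ :=
  a t * w x + b t * ∫ l in (0 : ℝ)..t, G l x

namespace IsDuhamelData

variable {A : ChartPartition d M} {s : ℝ} {w : M → ℂ} {N : ℝ} {G : ℝ → M → ℂ} {B : ℝ → ℝ}
  {a b : ℝ → ℂ}

omit [BorelSpace M] [CompactSpace M] in
theorem measurable_duhamel (h : IsDuhamelData A s w N G B) (ha : Continuous a)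
    (hb : Continuous b) : Measurable fun z : ℝ × M => duhamel a b w G z.1 z.2 :=
  ((ha.measurable.comp measurable_fst).mul (h.meas_w.comp measurable_snd)).add
    ((hb.measurable.comp measurable_fst).mul (measurable_intervalIntegral h.meas_G))

omit [BorelSpace M] [CompactSpace M] in
theorem measurable_integral (h : IsDuhamelData A s w N G B) (t₀ t : ℝ) :
    Measurable fun x => ∫ l in t₀..t, G l x := by
  have hm := measurable_intervalIntegral h.meas_G
  have h1 : (fun x => ∫ l in t₀..t, G l x) =
      fun x => (∫ l in (0 : ℝ)..t, G l x) - ∫ l in (0 : ℝ)..t₀, G l x := by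
    ext x
    have hi := integrable_of_bound h.meas_G h.integrable_B h.norm_G_le x
    rw [intervalIntegral.integral_interval_sub_left hi.intervalIntegrable hi.intervalIntegrable]
  rw [h1]
  exact (hm.comp measurable_prodMk_left).sub (hm.comp measurable_prodMk_left)

omit [BorelSpace M] [CompactSpace M] in
theorem B_nonneg [Nonempty M] (h : IsDuhamelData A s w N G B) (l : ℝ) : 0 ≤ B l :=
  (norm_nonneg _).trans (h.norm_G_le l (Classical.arbitrary M))

omit [BorelSpace M] [CompactSpace M] in
theorem norm_integral_le (h : IsDuhamelData A s w N G B) (t₀ t : ℝ) (x : M) :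
    ‖∫ l in t₀..t, G l x‖ ≤ ∫ l, B l :=
  have : Nonempty M := ⟨x⟩
  (norm_intervalIntegral_le h.integrable_B h.norm_G_le t₀ t x).trans
    (abs_intervalIntegral_le_integral h.integrable_B h.B_nonneg t₀ t)

omit [BorelSpace M] [CompactSpace M] in
-- Separates the variation of the coefficients from that of the integral, so that each term tends to
-- 0 for its own reason.
theorem duhamel_sub (h : IsDuhamelData A s w N G B) (t₀ t : ℝ) (x : M) :
    duhamel a b w G t x - duhamel a b w G t₀ x =
      ((a t - a t₀) * w x + (b t - b t₀) * ∫ l in (0 : ℝ)..t, G l x) +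
        b t₀ * ∫ l in t₀..t, G l x := by
  have hi := integrable_of_bound h.meas_G h.integrable_B h.norm_G_le x
  have hs : (∫ l in t₀..t, G l x) = (∫ l in (0 : ℝ)..t, G l x) - ∫ l in (0 : ℝ)..t₀, G l x :=
    (intervalIntegral.integral_interval_sub_left hi.intervalIntegrable hi.intervalIntegrable).symm
  rw [hs]
  simp only [duhamel]
  ring

omit [BorelSpace M] [CompactSpace M] in
theorem norm_duhamel_le (h : IsDuhamelData A s w N G B) (t : ℝ) (x : M) :
    ‖duhamel a b w G t x‖ ≤ ‖a t‖ * N + ‖b t‖ * ∫ l, B l := by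
  refine (norm_add_le _ _).trans ?_
  rw [norm_mul, norm_mul]
  gcongr
  · exact h.norm_w_le x
  · exact h.norm_integral_le 0 t x

omit [BorelSpace M] [CompactSpace M] in
theorem norm_duhamel_sub_le (h : IsDuhamelData A s w N G B) (t₀ t : ℝ) (x : M) :
    ‖duhamel a b w G t x - duhamel a b w G t₀ x‖ ≤
      ‖a t - a t₀‖ * N + ‖b t - b t₀‖ * (∫ l, B l) + ‖b t₀‖ * |∫ l in t₀..t, B l| := by
  rw [h.duhamel_sub]
  refine (norm_add₃_le).trans ?_
  rw [norm_mul, norm_mul, norm_mul]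
  gcongr
  · exact h.norm_w_le x
  · exact h.norm_integral_le 0 t x
  · exact norm_intervalIntegral_le h.integrable_B h.norm_G_le t₀ t x

omit [BorelSpace M] in
theorem memLp_duhamel (g : Metric d M) (h : IsDuhamelData A s w N G B) (ha : Continuous a)
    (hb : Continuous b) (t : ℝ) (p : ℝ≥0∞) : MemLp (duhamel a b w G t) p (riemVolume g A) :=
  have := A.isFiniteMeasure_riemVolume g
  MemLp.of_bound ((h.measurable_duhamel ha hb).comp measurable_prodMk_left).aestronglyMeasurable _
    (Eventually.of_forall (h.norm_duhamel_le t))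

omit [BorelSpace M] in
-- Continuity of t ↦ v(t) into L^∞, controlled by a, b and the primitive of B, gives strong
-- measurability and, on the compact interval, a bound; every exponent p follows.
theorem memLpLinfty_duhamel (g : Metric d M) (h : IsDuhamelData A s w N G B) (ha : Continuous a)
    (hb : Continuous b) (p : ℝ≥0∞) (T : ℝ) : MemLpLinfty g A p T (duhamel a b w G) := by
  have := A.isFiniteMeasure_riemVolume g
  have hm := fun t => h.memLp_duhamel g ha hb t ⊤
  let V : ℝ → Lp ℂ ⊤ (riemVolume g A) := fun t => (hm t).toLp
  have hV : Continuous V := by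
    rw [continuous_iff_continuousAt]
    intro t₀
    rw [ContinuousAt, tendsto_iff_norm_sub_tendsto_zero]
    -- On an empty M the pointwise bounds are vacuous and do not force N or B to be nonnegative.
    rcases isEmpty_or_nonempty M with hM | hM
    · have hz : riemVolume g A = 0 := Measure.eq_zero_of_isEmpty _
      have : ∀ t, ‖V t - V t₀‖ = 0 := fun t => by
        rw [← MemLp.toLp_sub, Lp.norm_toLp]
        simp [hz]
      simp [this]
    have hN : 0 ≤ N := (norm_nonneg _).trans (h.norm_w_le (Classical.arbitrary M))
    have hI : 0 ≤ ∫ l, B l := integral_nonneg h.B_nonneg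
    have hle : ∀ t, ‖V t - V t₀‖ ≤
        ‖a t - a t₀‖ * N + ‖b t - b t₀‖ * (∫ l, B l) + ‖b t₀‖ * |∫ l in t₀..t, B l| := by
      intro t
      have := Lp.norm_le_of_ae_bound (f := V t - V t₀)
        (C := ‖a t - a t₀‖ * N + ‖b t - b t₀‖ * (∫ l, B l) + ‖b t₀‖ * |∫ l in t₀..t, B l|)
        (by positivity) (by
          filter_upwards [Lp.coeFn_sub (V t) (V t₀), (hm t).coeFn_toLp, (hm t₀).coeFn_toLp]
            with x h1 h2 h3
          rw [h1, Pi.sub_apply, h2, h3]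
          exact h.norm_duhamel_sub_le t₀ t x)
      simpa using this
    refine squeeze_zero (fun _ => norm_nonneg _) hle ?_
    have hc : Continuous fun t => ‖a t - a t₀‖ * N + ‖b t - b t₀‖ * (∫ l, B l) +
        ‖b t₀‖ * |∫ l in t₀..t, B l| := by
      have := intervalIntegral.continuous_primitive
        (fun a b => h.integrable_B.intervalIntegrable (a := a) (b := b)) t₀
      fun_prop
    simpa using hc.tendsto t₀
  obtain ⟨C, hC⟩ := (isCompact_Icc (a := (0 : ℝ)) (b := T)).exists_bound_of_continuousOn
    hV.continuousOn
  refine ⟨V, MemLp.of_bound hV.aestronglyMeasurable C ?_, Eventually.of_forall fun t =>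
    (hm t).coeFn_toLp.symm⟩
  exact (ae_restrict_iff' measurableSet_Icc).2 (Eventually.of_forall hC)

/-- The coefficients are left free so that the same bound serves for the value at t and for the
increment from t₀ to t. -/
theorem hsNorm_duhamel_sq_le (g : Metric d M) (h : IsDuhamelData A s w N G B) (α β γ : ℂ)
    (t₀ t : ℝ) :
    hsNorm A s (fun x => (α * w x + β * ∫ l in (0 : ℝ)..t, G l x) + γ * ∫ l in t₀..t, G l x) ^ 2 ≤
      2 * (2 * (‖α‖ₑ ^ 2 * hsNorm A s w ^ 2) +
        2 * (‖β‖ₑ ^ 2 * (ENNReal.ofReal |t| * ∫⁻ l, hsNorm A s (G l) ^ 2))) +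
      2 * (‖γ‖ₑ ^ 2 * (ENNReal.ofReal |t - t₀| * ∫⁻ l, hsNorm A s (G l) ^ 2)) := by
  have := A.isFiniteMeasure_riemVolume g
  have hw : Integrable w (riemVolume g A) :=
    Integrable.of_bound h.meas_w.aestronglyMeasurable N (Eventually.of_forall h.norm_w_le)
  have hI : ∀ t₀ t, Integrable (fun x => ∫ l in t₀..t, G l x) (riemVolume g A) := fun t₀ t =>
    Integrable.of_bound (h.measurable_integral t₀ t).aestronglyMeasurable _
      (Eventually.of_forall (h.norm_integral_le t₀ t))
  have hb := hsNorm_intervalIntegral_sq_le A s h.meas_G h.integrable_B h.norm_G_le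
  refine (hsNorm_add_sq_le g A s ((hw.const_mul α).add ((hI 0 t).const_mul β))
    ((hI t₀ t).const_mul γ)).trans (add_le_add (mul_le_mul' le_rfl ?_) (mul_le_mul' le_rfl ?_))
  · refine (hsNorm_add_sq_le g A s (hw.const_mul α) ((hI 0 t).const_mul β)).trans
      (add_le_add (mul_le_mul' le_rfl ?_) (mul_le_mul' le_rfl ?_))
    · rw [hsNorm_const_mul_sq]
    · rw [hsNorm_const_mul_sq]
      have := hb 0 t
      rw [sub_zero] at this
      exact mul_le_mul' le_rfl this
  · rw [hsNorm_const_mul_sq]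
    exact mul_le_mul' le_rfl (hb t₀ t)

theorem memContHs_duhamel (g : Metric d M) (h : IsDuhamelData A s w N G B) (ha : Continuous a)
    (hb : Continuous b) (T : ℝ) : MemContHs g A s T (duhamel a b w G) := by
  set J := ∫⁻ l, hsNorm A s (G l) ^ 2 with hJ
  have hJt : J ≠ ⊤ := h.hs_G.ne
  have hWt : hsNorm A s w ^ 2 ≠ ⊤ := ENNReal.pow_ne_top h.hs_w.ne
  refine ⟨fun t _ => ⟨h.memLp_duhamel g ha hb t 2, ?_⟩, fun t₀ _ => ?_⟩
  -- The value at t is the case γ = 0.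
  · have h1 := h.hsNorm_duhamel_sq_le g (a t) (b t) 0 0 t
    simp only [zero_mul, add_zero] at h1
    refine ((ENNReal.pow_lt_top_iff (n := 2)).1 ?_).resolve_right two_ne_zero
    refine h1.trans_lt (lt_top_iff_ne_top.2 ?_)
    have h2 : ∀ z : ℂ, ‖z‖ₑ ^ 2 ≠ ⊤ := fun z => ENNReal.pow_ne_top enorm_ne_top
    exact ENNReal.add_ne_top.2 ⟨ENNReal.mul_ne_top (by simp) (ENNReal.add_ne_top.2
      ⟨ENNReal.mul_ne_top (by simp) (ENNReal.mul_ne_top (h2 _) hWt),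
        ENNReal.mul_ne_top (by simp) (ENNReal.mul_ne_top (h2 _)
          (ENNReal.mul_ne_top ENNReal.ofReal_ne_top hJt))⟩),
      ENNReal.mul_ne_top (by simp) (ENNReal.mul_ne_top (h2 _)
          (ENNReal.mul_ne_top ENNReal.ofReal_ne_top hJt))⟩
  · have hE : Tendsto (fun t => 2 * (2 * (‖a t - a t₀‖ₑ ^ 2 * hsNorm A s w ^ 2) +
        2 * (‖b t - b t₀‖ₑ ^ 2 * (ENNReal.ofReal |t| * J))) +
        2 * (‖b t₀‖ₑ ^ 2 * (ENNReal.ofReal |t - t₀| * J))) (𝓝 t₀) (𝓝 0) := by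
      have e1 : ∀ {f : ℝ → ℂ}, Continuous f →
          Tendsto (fun t => ‖f t - f t₀‖ₑ ^ 2) (𝓝 t₀) (𝓝 0) := by
        intro f hf
        have : Continuous fun t => ‖f t - f t₀‖ₑ ^ 2 :=
          (ENNReal.continuous_pow 2).comp (hf.sub continuous_const).enorm
        simpa using this.tendsto t₀
      have e2 : Tendsto (fun t => ENNReal.ofReal |t|) (𝓝 t₀) (𝓝 (ENNReal.ofReal |t₀|)) :=
        (ENNReal.continuous_ofReal.comp continuous_abs).tendsto t₀
      have e3 : Tendsto (fun t => ENNReal.ofReal |t - t₀|) (𝓝 t₀) (𝓝 0) := by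
        have : Continuous fun t => ENNReal.ofReal |t - t₀| :=
          ENNReal.continuous_ofReal.comp (by fun_prop)
        simpa using this.tendsto t₀
      have f1 := ENNReal.Tendsto.const_mul (a := 2)
        (ENNReal.Tendsto.mul_const (e1 ha) (Or.inr hWt)) (Or.inr (by simp))
      have f2 := ENNReal.Tendsto.const_mul (a := 2)
        (ENNReal.Tendsto.mul (e1 hb) (Or.inr (ENNReal.mul_ne_top ENNReal.ofReal_ne_top hJt))
          (ENNReal.Tendsto.mul_const e2 (Or.inr hJt)) (Or.inr (by simp))) (Or.inr (by simp))
      have f3 := ENNReal.Tendsto.const_mul (a := 2)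
        (ENNReal.Tendsto.const_mul (a := ‖b t₀‖ₑ ^ 2)
          (ENNReal.Tendsto.mul_const e3 (Or.inr hJt))
          (Or.inr (ENNReal.pow_ne_top enorm_ne_top))) (Or.inr (by simp))
      have f4 := (ENNReal.Tendsto.const_mul (a := 2) (f1.add f2) (Or.inr (by simp))).add f3
      simpa using f4
    have hsq : Tendsto (fun t => hsNorm A s
        (fun x => duhamel a b w G t x - duhamel a b w G t₀ x) ^ 2) (𝓝[Icc 0 T] t₀) (𝓝 0) := by
      refine tendsto_of_tendsto_of_tendsto_of_le_of_le tendsto_const_nhds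
        (hE.mono_left nhdsWithin_le_nhds) (fun _ => zero_le) fun t => ?_
      simp only [h.duhamel_sub]
      exact h.hsNorm_duhamel_sq_le g _ _ _ t₀ t
    -- The estimates are for squares of norms; the square root, continuous at 0, gives the norm
    -- itself.
    have hr := ((ENNReal.continuous_rpow_const (y := 1 / 2)).tendsto 0).comp hsq
    rw [ENNReal.zero_rpow_of_pos (by norm_num)] at hr
    refine hr.congr fun t => ?_
    rw [Function.comp, ← ENNReal.rpow_natCast, ← ENNReal.rpow_mul]
    norm_num

end IsDuhamelData

end TimeIntegral
-- Bounded measurable representatives and invariance under null sets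
section Regularization

theorem exists_measurable_bounded_of_memLp_top {M : Type*} [MeasurableSpace M] {μ : Measure M}
    {f : M → ℝ} (hf : MemLp f ⊤ μ) :
    ∃ f' : M → ℝ, ∃ N : ℝ, Measurable f' ∧ (∀ x, |f' x| ≤ N) ∧ f =ᵐ[μ] f' := by
  have hm := hf.1.aemeasurable
  set N := (eLpNormEssSup f μ).toReal
  have hfin : eLpNormEssSup f μ ≠ ⊤ := by simpa using hf.2.ne
  have hms : MeasurableSet {x | |hm.mk f x| ≤ N} :=
    measurableSet_le hm.measurable_mk.abs measurable_const
  refine ⟨{x | |hm.mk f x| ≤ N}.indicator (hm.mk f), N, hm.measurable_mk.indicator hms,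
    fun x => ?_, ?_⟩
  · by_cases hx : x ∈ {x | |hm.mk f x| ≤ N}
    · rw [indicator_of_mem hx]; exact hx
    · rw [indicator_of_notMem hx, abs_zero]; exact ENNReal.toReal_nonneg
  · filter_upwards [hm.ae_eq_mk, ae_le_eLpNormEssSup (f := f) (μ := μ)] with x h1 h2
    rw [indicator_of_mem, h1]
    change |hm.mk f x| ≤ N
    rw [← h1, ← Real.norm_eq_abs, ← toReal_enorm]
    exact ENNReal.toReal_mono hfin h2

variable {d : ℕ} {M : Type*} [TopologicalSpace M] [ChartedSpace (Eucl d) M]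
  [IsManifold (𝓡 d) ∞ M] [MeasurableSpace M] [CompactSpace M]

/-- An element of `L^p([0,T]; L^∞(M))` with `p ≥ 2` is represented by a measurable function that is
bounded by a square integrable function of time. -/
theorem exists_measurable_bounded_of_memLpLinfty (g : Metric d M) (A : ChartPartition d M)
    {p : ℝ≥0∞} (hp : 2 ≤ p) {T : ℝ} {u : ℝ → M → ℂ}
    (hum : AEStronglyMeasurable (fun z : ℝ × M => u z.1 z.2)
      ((volume.restrict (Icc 0 T)).prod (riemVolume g A)))
    (hu : MemLpLinfty g A p T u) :
    ∃ (u' : ℝ → M → ℂ) (N : ℝ → ℝ), (Measurable fun z : ℝ × M => u' z.1 z.2) ∧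
      (∀ l, l ∉ Icc 0 T → N l = 0) ∧ (Integrable fun l => N l ^ 2) ∧
      (∀ l x, ‖u' l x‖ ≤ N l) ∧ (fun z : ℝ × M => u z.1 z.2)
        =ᵐ[(volume.restrict (Icc 0 T)).prod (riemVolume g A)] fun z => u' z.1 z.2 := by
  have := A.isFiniteMeasure_riemVolume g
  obtain ⟨W, hW, huW⟩ := hu
  have hWn : AEMeasurable (fun l => ‖W l‖) (volume.restrict (Icc 0 T)) := hW.1.norm.aemeasurable
  -- N is a measurable version of ‖W(l)‖_{L^∞}, set to 0 off [0,T] so that bounds and integrals may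
  -- be taken over all of ℝ.
  set N : ℝ → ℝ := (Icc 0 T).indicator fun l => |hWn.mk _ l| with hN
  have hNm : Measurable N := hWn.measurable_mk.abs.indicator measurableSet_Icc
  have hN0 : ∀ l, 0 ≤ N l := fun l => indicator_nonneg (fun _ _ => abs_nonneg _) l
  have hNW : ∀ᵐ l ∂volume.restrict (Icc 0 T), N l = ‖W l‖ := by
    filter_upwards [ae_restrict_mem measurableSet_Icc, hWn.ae_eq_mk] with l hl h1
    rw [hN, indicator_of_mem hl, ← h1, abs_norm]
  set U := hum.mk _ with hU
  have hUm : Measurable U := hum.stronglyMeasurable_mk.measurable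
  have hS : MeasurableSet {z : ℝ × M | ‖U z‖ ≤ N z.1} :=
    measurableSet_le hUm.norm (hNm.comp measurable_fst)
  -- Truncating to 0 where the bound fails makes it hold everywhere; the truncated set is null by
  -- Fubini.
  refine ⟨fun l x => {z : ℝ × M | ‖U z‖ ≤ N z.1}.indicator U (l, x), N, hUm.indicator hS,
    fun l hl => indicator_of_notMem hl _, ?_, fun l x => ?_, ?_⟩
  · have h1 : Integrable (fun l => ‖W l‖ ^ 2) (volume.restrict (Icc 0 T)) :=
      (hW.norm.mono_exponent hp).integrable_sq
    have h2 : Integrable (fun l => N l ^ 2) (volume.restrict (Icc 0 T)) :=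
      h1.congr (hNW.mono fun l hl => by simp only [hl])
    rw [← integrableOn_iff_integrable_of_support_subset (s := Icc 0 T)]
    · exact h2
    · intro l hl
      by_contra h
      exact hl (by simp [hN, indicator_of_notMem h])
  · beta_reduce
    by_cases hx : (l, x) ∈ {z : ℝ × M | ‖U z‖ ≤ N z.1}
    · rw [indicator_of_mem hx]; exact hx
    · rw [indicator_of_notMem hx, norm_zero]; exact hN0 l
  · have h1 : ∀ᵐ z ∂(volume.restrict (Icc 0 T)).prod (riemVolume g A), ‖U z‖ ≤ N z.1 := by
      rw [Measure.ae_prod_iff_ae_ae hS]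
      filter_upwards [Measure.ae_ae_of_ae_prod hum.ae_eq_mk, huW, hNW] with l h1 h2 h3
      filter_upwards [h1, h2, ae_le_eLpNormEssSup (f := W l) (μ := riemVolume g A)] with x h4 h5 h6
      have h7 : u l x = U (l, x) := h4
      rw [← h7, h5, h3, ← enorm_le_iff_norm_le, Lp.enorm_def, eLpNorm_exponent_top]
      exact h6
    filter_upwards [hum.ae_eq_mk, h1] with z h2 h3
    rw [indicator_of_mem (show z ∈ {z : ℝ × M | ‖U z‖ ≤ N z.1} from h3), h2]

variable [BorelSpace M]

/-- Continuity is given only as convergence of the norm of differences. Near t₀ it bounds ‖u(t)‖² by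
2 + 2‖u(t₀)‖², and compactness of [0,T] passes from local to global. -/
theorem MemContHs.exists_bound {g : Metric d M} {A : ChartPartition d M} {s T : ℝ}
    {u : ℝ → M → ℂ} (hu : MemContHs g A s T u) :
    ∃ K : ℝ≥0∞, K ≠ ⊤ ∧ ∀ t ∈ Icc 0 T, hsNorm A s (u t) ^ 2 ≤ K := by
  have := A.isFiniteMeasure_riemVolume g
  have hi : ∀ t ∈ Icc 0 T, Integrable (u t) (riemVolume g A) := fun t ht =>
    (hu.1 t ht).1.integrable one_le_two
  refine (isCompact_Icc (a := (0 : ℝ)) (b := T)).induction_on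
    (p := fun S => ∃ K : ℝ≥0∞, K ≠ ⊤ ∧ ∀ t ∈ S, hsNorm A s (u t) ^ 2 ≤ K)
    ⟨0, by simp, by simp⟩ ?_ ?_ ?_
  · rintro S S' h ⟨K, hK, hb⟩
    exact ⟨K, hK, fun t ht => hb t (h ht)⟩
  · rintro S S' ⟨K, hK, hb⟩ ⟨K', hK', hb'⟩
    refine ⟨max K K', (max_lt hK.lt_top hK'.lt_top).ne, fun t ht => ?_⟩
    rcases ht with ht | ht
    · exact (hb t ht).trans (le_max_left _ _)
    · exact (hb' t ht).trans (le_max_right _ _)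
  · intro t₀ ht₀
    have h1 := ((hu.2 t₀ ht₀).eventually_le_const (u := 1) (by simp)).and self_mem_nhdsWithin
    refine ⟨_, h1, 2 * 1 ^ 2 + 2 * hsNorm A s (u t₀) ^ 2, ?_, fun t ⟨ht, htI⟩ => ?_⟩
    · exact ENNReal.add_ne_top.2 ⟨by simp, ENNReal.mul_ne_top (by simp)
        (ENNReal.pow_ne_top (hu.1 t₀ ht₀).2.ne)⟩
    · have h2 := hsNorm_add_sq_le g A s ((hi t htI).sub (hi t₀ ht₀)) (hi t₀ ht₀)
      simp only [Pi.sub_apply, sub_add_cancel] at h2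
      refine h2.trans (add_le_add (mul_le_mul' le_rfl ?_) le_rfl)
      exact pow_le_pow_left' ht 2

/-- The exceptional set of x is common to all t, so the two functions agree almost everywhere at
every single time, as C([0,T]; H^s) requires. -/
theorem MemXT.congr_ae {g : Metric d M} {A : ChartPartition d M} {s T : ℝ} {p : ℝ≥0∞}
    {w w' : ℝ → M → ℂ} (hw : MemXT g A s p T w)
    (h : ∀ᵐ x ∂riemVolume g A, ∀ t ∈ Icc 0 T, w t x = w' t x) : MemXT g A s p T w' := by
  have := A.isFiniteMeasure_riemVolume g
  have ht : ∀ t ∈ Icc 0 T, w t =ᵐ[riemVolume g A] w' t := fun t ht => h.mono fun x hx => hx t ht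
  obtain ⟨h1, ⟨h2, h3⟩, V, hV, hwV⟩ := hw
  refine ⟨h1.congr ?_, ⟨fun t hT => ⟨(h2 t hT).1.ae_eq (ht t hT), ?_⟩, fun t₀ hT => ?_⟩, V, hV, ?_⟩
  · filter_upwards [Measure.quasiMeasurePreserving_snd.ae h,
      Measure.quasiMeasurePreserving_fst.ae
        (ae_restrict_mem (μ := volume) (measurableSet_Icc (a := (0 : ℝ)) (b := T)))] with z hz hz'
    exact hz z.1 hz'
  · rw [← A.hsNorm_congr_ae g s (ht t hT)]
    exact (h2 t hT).2
  · refine (h3 t₀ hT).congr' ?_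
    filter_upwards [self_mem_nhdsWithin] with t htI
    refine A.hsNorm_congr_ae g s ?_
    filter_upwards [ht t htI, ht t₀ hT] with x hx hx'
    rw [hx, hx']
  · filter_upwards [hwV, ae_restrict_mem measurableSet_Icc] with t h4 h5
    exact (ht t h5).symm.trans h4

end Regularization

/-! ### Application to v -/

section Debye

variable {M : Type*}

/-- From e^{-(t-l)/κ} = e^{-t/κ} e^{l/κ}: the integrand no longer depends on t. -/
theorem debye_eq_duhamel (κ lam : ℝ) (v₀ : M → ℝ) (u : ℝ → M → ℂ) (t : ℝ) (x : M) :
    (debye κ lam v₀ u t x : ℂ) =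
      duhamel (fun t => (Real.exp (-t / κ) : ℂ)) (fun t => ((lam / κ * Real.exp (-t / κ) : ℝ) : ℂ))
        (fun x => (v₀ x : ℂ))
        (fun l x => (Real.exp (l / κ) : ℂ) * ((‖u l x‖ ^ 2 : ℝ) : ℂ)) t x := by
  have h : ∀ l, Real.exp (-(t - l) / κ) * ‖u l x‖ ^ 2 =
      Real.exp (-t / κ) * (Real.exp (l / κ) * ‖u l x‖ ^ 2) := by
    intro l
    rw [← mul_assoc, ← Real.exp_add]
    ring_nf
  simp only [debye, duhamel, h, intervalIntegral.integral_const_mul]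
  simp only [← Complex.ofReal_mul, intervalIntegral.integral_ofReal]
  push_cast
  ring

theorem debye_congr [MeasurableSpace M] {κ lam T : ℝ} {v₀ v₀' : M → ℝ} {u u' : ℝ → M → ℂ} {x : M}
    (hv : v₀ x = v₀' x) (hu : ∀ᵐ l ∂volume.restrict (Icc 0 T), u l x = u' l x) {t : ℝ}
    (ht : t ∈ Icc 0 T) : debye κ lam v₀ u t x = debye κ lam v₀' u' t x := by
  simp only [debye, hv]
  congr 2
  refine intervalIntegral.integral_congr_ae ?_
  filter_upwards [(ae_restrict_iff' measurableSet_Icc).1 hu] with l hl hlt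
  rw [uIoc_of_le ht.1] at hlt
  rw [hl ⟨hlt.1.le, hlt.2.trans ht.2⟩]

variable {d : ℕ} [TopologicalSpace M] [T2Space M] [ChartedSpace (Eucl d) M]
  [IsManifold (𝓡 d) ∞ M] [MeasurableSpace M] [CompactSpace M] [BorelSpace M]

/-- B(l) = e^{T/κ} N(l)² is the sup bound. The tame estimate gives ‖G(l)‖²_{H^s} ≤ e^{2T/κ} C N(l)²
K, so square integrability of N serves both bounds. -/
theorem exists_isDuhamelData (A : ChartPartition d M) {s : ℝ} (hs : 0 < s)
    {κ T : ℝ} (hκ : 0 < κ) {w : M → ℂ} {N₀ : ℝ} (hwm : Measurable w) (hwN : ∀ x, ‖w x‖ ≤ N₀)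
    (hws : hsNorm A s w < ⊤) {u : ℝ → M → ℂ} (hum : Measurable fun z : ℝ × M => u z.1 z.2)
    {N : ℝ → ℝ} (hN0 : ∀ l, l ∉ Icc 0 T → N l = 0) (hN : Integrable fun l => N l ^ 2)
    (huN : ∀ l x, ‖u l x‖ ≤ N l) {K : ℝ≥0∞} (hK : K ≠ ⊤)
    (huK : ∀ᵐ l ∂volume.restrict (Icc 0 T), hsNorm A s (u l) ^ 2 ≤ K) :
    ∃ B, IsDuhamelData A s w N₀
      (fun l x => (Real.exp (l / κ) : ℂ) * ((‖u l x‖ ^ 2 : ℝ) : ℂ)) B := by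
  obtain ⟨C, hC, htame⟩ := A.exists_hsNorm_sq_normSq_le hs
  have hexp : ∀ l ∈ Icc 0 T, Real.exp (l / κ) ≤ Real.exp (T / κ) := fun l hl =>
    Real.exp_le_exp.2 (div_le_div_of_nonneg_right hl.2 hκ.le)
  refine ⟨fun l => Real.exp (T / κ) * N l ^ 2, hwm, hwN, hws, ?_, hN.const_mul _,
    fun l x => ?_, ?_⟩
  · have h1 : Measurable fun z : ℝ × M => Real.exp (z.1 / κ) * ‖u z.1 z.2‖ ^ 2 :=
      (Real.measurable_exp.comp (measurable_fst.div_const κ)).mul (hum.norm.pow_const 2)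
    simp only [← Complex.ofReal_mul]
    exact Complex.measurable_ofReal.comp h1
  · rw [norm_mul, Complex.norm_real, Complex.norm_real, Real.norm_of_nonneg (Real.exp_pos _).le,
      Real.norm_of_nonneg (sq_nonneg _)]
    by_cases hl : l ∈ Icc 0 T
    · gcongr
      · exact hl.2
      · exact huN l x
    · have := huN l x
      rw [hN0 l hl] at this ⊢
      simp [norm_le_zero_iff.1 this]
  · have hle : ∀ᵐ l, hsNorm A s (fun x => (Real.exp (l / κ) : ℂ) * ((‖u l x‖ ^ 2 : ℝ) : ℂ)) ^ 2 ≤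
        ENNReal.ofReal (Real.exp (T / κ) ^ 2 * C * N l ^ 2) * K := by
      filter_upwards [(ae_restrict_iff' measurableSet_Icc).1 huK] with l hl
      have h1 := htame (u l) (N l) (hum.comp measurable_prodMk_left) (huN l)
      rw [hsNorm_const_mul_sq]
      by_cases hlT : l ∈ Icc 0 T
      · rw [mul_assoc, ENNReal.ofReal_mul (sq_nonneg _), mul_assoc]
        refine mul_le_mul' ?_ (h1.trans (mul_le_mul' le_rfl (hl hlT)))
        rw [← ofReal_norm, ← ENNReal.ofReal_pow (norm_nonneg _), Complex.norm_real,
          Real.norm_of_nonneg (Real.exp_pos _).le]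
        exact ENNReal.ofReal_le_ofReal (pow_le_pow_left₀ (Real.exp_pos _).le (hexp l hlT) 2)
      -- Off [0,T] no bound by K is available, but N = 0 makes the tame estimate give norm 0.
      · rw [hN0 l hlT] at h1
        simp only [ne_eq, OfNat.ofNat_ne_zero, not_false_eq_true, zero_pow, mul_zero,
          ENNReal.ofReal_zero, zero_mul] at h1
        rw [nonpos_iff_eq_zero.1 h1, mul_zero]
        exact zero_le
    refine (lintegral_mono_ae hle).trans_lt ?_
    rw [lintegral_mul_const' _ _ hK]
    exact ENNReal.mul_lt_top (hN.const_mul _).lintegral_lt_top hK.lt_top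

/-- The regularity of `v` in the Schrödinger-Debye system. -/
theorem memXT_debye (g : Metric d M) (A : ChartPartition d M) {κ lam s T : ℝ} (hκ : 0 < κ)
    (hs : 0 < s) {p : ℝ≥0∞} (hp : 2 ≤ p) {v₀ : M → ℝ} (hv₀ : MemHs g A s fun x => (v₀ x : ℂ))
    (hv₀_bdd : MemLp v₀ ⊤ (riemVolume g A)) {u : ℝ → M → ℂ} (hu : MemXT g A s p T u) :
    MemXT g A s p T fun t x => (debye κ lam v₀ u t x : ℂ) := by
  have := A.isFiniteMeasure_riemVolume g
  obtain ⟨hum, huH, huL⟩ := hu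
  obtain ⟨v₀', N₀, hv₀m, hv₀N, hvv'⟩ := exists_measurable_bounded_of_memLp_top hv₀_bdd
  obtain ⟨u', N, hum', hN0, hN, huN, huu'⟩ :=
    exists_measurable_bounded_of_memLpLinfty g A hp hum huL
  obtain ⟨K, hK, huK⟩ := huH.exists_bound
  have h1 : ∀ᵐ l ∂volume.restrict (Icc 0 T), hsNorm A s (u' l) ^ 2 ≤ K := by
    filter_upwards [Measure.ae_ae_of_ae_prod huu', ae_restrict_mem measurableSet_Icc] with l hl hlT
    rw [← A.hsNorm_congr_ae g s (f := u l) (f' := u' l) hl]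
    exact huK l hlT
  -- Fubini in the other order: for almost every x the two time histories agree almost everywhere,
  -- so the memory integrals at x agree for every t in [0,T].
  have h2 : ∀ᵐ x ∂riemVolume g A, ∀ᵐ l ∂volume.restrict (Icc 0 T), u l x = u' l x :=
    Measure.ae_ae_of_ae_prod
      (Measure.measurePreserving_swap.quasiMeasurePreserving.ae huu')
  have hw : hsNorm A s (fun x => (v₀' x : ℂ)) < ⊤ := by
    rw [← A.hsNorm_congr_ae g s (f := fun x => (v₀ x : ℂ))
      (hvv'.mono fun x hx => congrArg Complex.ofReal hx)]
    exact hv₀.2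
  obtain ⟨B, hD⟩ := exists_isDuhamelData A hs hκ (w := fun x => (v₀' x : ℂ))
    (Complex.measurable_ofReal.comp hv₀m) (fun x => by simpa using hv₀N x) hw hum' hN0 hN huN hK h1
  have ha : Continuous fun t : ℝ => (Real.exp (-t / κ) : ℂ) :=
    Complex.continuous_ofReal.comp (by fun_prop)
  have hb : Continuous fun t : ℝ => ((lam / κ * Real.exp (-t / κ) : ℝ) : ℂ) :=
    Complex.continuous_ofReal.comp (by fun_prop)
  have hX : MemXT g A s p T _ := ⟨(hD.measurable_duhamel ha hb).aestronglyMeasurable,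
    hD.memContHs_duhamel g ha hb T, hD.memLpLinfty_duhamel g ha hb p T⟩
  refine hX.congr_ae ?_
  filter_upwards [hvv', h2] with x hx hx' t ht
  rw [debye_congr (κ := κ) (lam := lam) hx hx' ht, debye_eq_duhamel]

end Debye
end SchrodingerDebye

theorem corollary1p2 {d : ℕ} (hd : 2 ≤ d)
    {M : Type*} [TopologicalSpace M] [T2Space M] [CompactSpace M]
    [ChartedSpace (SchrodingerDebye.Eucl d) M] [IsManifold (𝓡 d) ∞ M]
    [MeasurableSpace M] [BorelSpace M]
    (g : SchrodingerDebye.Metric d M) (A : SchrodingerDebye.ChartPartition d M)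
    (κ lam : ℝ) (hκ : 0 < κ) (hlam : lam = 1 ∨ lam = -1)
    (p q : ℝ≥0∞) (hpq : SchrodingerDebye.Admissible d p q) (hp : 2 < p)
    (s : ℝ) (hs : (d : ℝ) / 2 - (1 / p).toReal < s)
    (u₀ : M → ℂ) (v₀ : M → ℝ)
    (hu₀ : SchrodingerDebye.MemHs g A s u₀)
    (hv₀ : SchrodingerDebye.MemHs g A s fun x => (v₀ x : ℂ))
    (hv₀_bdd : MemLp v₀ ⊤ (SchrodingerDebye.riemVolume g A))
    (T : ℝ) (hT : 0 < T) (u : ℝ → M → ℂ)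
    (hu : SchrodingerDebye.MemXT g A s p T u)
    (hsol : SchrodingerDebye.IsSolution g A κ lam T u₀ v₀ u) :
    SchrodingerDebye.MemXT g A s p T
      (fun t x => (SchrodingerDebye.debye κ lam v₀ u t x : ℂ)) := by
  refine SchrodingerDebye.memXT_debye g A hκ ?_ hp.le hv₀ hv₀_bdd hu
  -- With d ≥ 2 and 1/p ≤ 1/2 the threshold d/2 - 1/p is at least 1/2, hence s > 0.
  have h1 : (1 / p).toReal ≤ 1 / 2 := by
    have h2 : 1 / p ≤ ENNReal.ofReal (1 / 2) := by
      rw [one_div, ENNReal.ofReal_div_of_pos two_pos, ENNReal.ofReal_one, ENNReal.ofReal_ofNat,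
        one_div]
      exact ENNReal.inv_le_inv.2 hp.le
    exact ENNReal.toReal_le_of_le_ofReal (by norm_num) h2
  have h2 : (2 : ℝ) ≤ d := by exact_mod_cast hd
  linarith
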